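/- **Setting.** Let $\mathcal V^s$ be a finite set of time series and $\mathcal V^f=\mathcal V^s\times\mathbb Z$, with $S_s:=(S,s)$. A *full-time causal graph* (FTCG) is an acyclic directed graph on $\mathcal V^f$ whose edges $A_{s'}\to B_s$ all satisfy $s'\le s$ (no consistency through time is assumed). A *summary causal graph* (SCG) is a directed graph $\mathcal G^s=(\mathcal V^s,\mathcal E^s)$, cycles and self-loops allowed; an FTCG $\mathcal G^f$ is a *candidate* for $\mathcal G^s$ if, for all $A,B$, $A\to B\in\mathcal E^s$ iff $A_{s-\gamma}\to B_s\in\mathcal G^f$ for some $s\in\mathbb Z$, $\gamma\ge 0$. Descendants of a vertex include the vertex itself; $\mathrm{Pa}$ and $\mathrm{Ch}$ denote parents and children. Let $\mathcal X^f=\{X^i_{t-\gamma_i}\}_{i=1}^n$ be a finite set of interventions and $Y_t\notin\mathcal X^f$ the target, with $\gamma_i\ge 0$ and $Y$ a descendant of $X^i$ in $\mathcal G^s$ for every $i$; put $\mathcal X^s=\{X^i\}_i$. For an FTCG, a path (distinct vertices, consecutive ones adjacent) from $\mathcal X^f$ to $Y_t$ is *proper* if only its first vertex is in $\mathcal X^f$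 and *causal* if all its edges point towards $Y_t$; $\mathrm{Forb}$ is the set of descendants of the vertices $W\notin\mathcal X^f$ lying on proper causal paths from $\mathcal X^f$ to $Y_t$. A set $Z$ *blocks* a path if $Z$ contains a non-collider of the path, or some collider of the path has no descendant in $Z$. The effect $P(y_t\mid \mathrm{do}((x^i_{t-\gamma_i})_i))$ is *identifiable by common adjustment in $\mathcal G^s$* if there is a set $Z\subseteq\mathcal V^f$ disjoint from $\mathcal X^f\cup\{Y_t\}$ such that in every candidate FTCG of $\mathcal G^s$ one has $Z\cap\mathrm{Forb}=\emptyset$ and $Z$ blocks every proper non-causal path from $\mathcal X^f$ to $Y_t$. **Algorithm.** Input: $\mathcal G^s$ (lists of parents and children), the list $\mathcal X^f$, $Y$, $t$. All "first/last time not in $\mathcal X^f$" queries below are answered from tables computed after sorting $\mathcal X^f$ by time. 1. *(Ancestor times.)* Put $A(Y)=t$, mark $Y$ seen, $A(S)=-\infty$ for $S\ne Y$, and let the priority queue be $Q=\{Y_t\}$. While $Q\ne\emptyset$, pop an $S_s$ of maximal time; for every unseen $P\in\mathrm{Pa}(S)$ put $A(P)=\max\{s_1\le s\mid P_{s_1}\notin\mathcal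 X^f\}$, insert $P_{A(P)}$ into $Q$, mark $P$ seen. 2. *(Entrance times.)* For each $C\in\mathrm{Ch}(\mathcal X^s)$ let $t_{\min}=\min\{t-\gamma_i\mid X^i\in\mathrm{Pa}(C)\}$, $t_C=\min\{s\in[t_{\min},A(C)]\mid C_s\notin\mathcal X^f\}$ ($+\infty$ if there is none), and let $d(C)$ be true iff $t-\gamma_i<t_C$ for some $X^i\in\mathrm{Pa}(C)$ or $t-\gamma_i=t_C$ for at least two $i$ with $X^i\in\mathrm{Pa}(C)$. Put $t_{\mathcal{NC}}(S)=+\infty$ for all $S$, all $S$ unseen. Go through the $C$ with $t_C<+\infty$ in increasing lexicographic order of $(t_C,\ \text{not } d(C))$. If $d(C)$, put $t_{\mathcal{NC}}(D)=\min\{s\ge t_C\mid D_s\notin\mathcal X^f\}$ for every unseen descendant $D$ of $C$ in $\mathcal G^s$ and mark $D$ seen. If not $d(C)$, let $X^i$ be the only parent of $C$ intervened on at a time $\le t_C$; do the same for every unseen descendant $D$ of $C$ in $\mathcal G^s\setminus\{X^i\}$, and then put $t_{\mathcal{NC}}(D)=\min\{s\ge t_C+1\mid D_s\notin\mathcal X^f\}$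 for every still unseen descendant $D$ of $C$ in $\mathcal G^s$ and mark $D$ seen. 3. *(Directed paths.)* Let $\mathcal S=\{S\mid t_{\mathcal{NC}}(S)\le t\}\cup\{X^i\mid\gamma_i=0\}$. If some $X^i$ with $\gamma_i=0$ is a descendant of $Y$ in the subgraph of $\mathcal G^s$ induced by $\mathcal S$, return False. 4. *(Accessibility times.)* For each $v\in\{Y_t\}\cup\mathcal X^f$ compute $t^{\mathcal{NC}}_v$: start with $t^{\mathcal{NC}}_v(S)=-\infty$, all $S$ unseen, $Q=\{v\}$; while $Q\neq\emptyset$, pop an $S_s$ of maximal time, and for every unseen $P\in\mathrm{Pa}(S)$ put $t^{\mathcal{NC}}_v(P)=\max\{s_1\le s\mid s_1\ge t_{\mathcal{NC}}(P),\ P_{s_1}\notin\mathcal X^f\cup\{v\}\}$ ($-\infty$ if there is none), insert $P_{t^{\mathcal{NC}}_v(P)}$ into $Q$ if this is finite, and mark $P$ seen. 5. *(Fork paths.)* If $t_{\mathcal{NC}}(F)\le t^{\mathcal{NC}}_{X^i_{t-\gamma_i}}(F)$ and $t_{\mathcal{NC}}(F)\le t^{\mathcal{NC}}_{Y_t}(F)$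 for some $F\in\mathcal V^s$ and some $i$, return False. Otherwise return True. **Theorem.** The effect is identifiable by common adjustment in $\mathcal G^s$ if and only if the algorithm returns True. Moreover, for $n\ge 1$ the algorithm (with the priority queue and the sorting implemented by heaps) runs on a unit-cost random access machine in $$O\bigl(|\mathcal X^f|\,(\log|\mathcal X^f|+(|\mathcal E^s|+|\mathcal V^s|)\log|\mathcal V^s|)\bigr)$$ steps, i.e. there is an absolute constant $K$ such that the number of steps is at most $K\bigl(1+|\mathcal X^f|(\log|\mathcal X^f|+(|\mathcal E^s|+|\mathcal V^s|)\log|\mathcal V^s|)\bigr)$ on every input. -/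

import Mathlib

namespace CommonAdjustment

/-! ### Directed graphs: paths, blocking, the adjustment criterion

A directed graph on `W` is given by its edge relation `E : W → W → Prop`. -/

section Graphs

variable {W : Type*}

/-- `π` is a path: distinct vertices, consecutive ones joined by an edge (in either direction). -/
def IsPath (E : W → W → Prop) (π : List W) : Prop :=
  π.Nodup ∧ π.IsChain (fun a b => E a b ∨ E b a)

/-- `π` is a path from some vertex of `A` to some vertex of `B` and only its first vertex is
in `A`. -/
def IsProperPath (E : W → W → Prop) (A B : Set W) (π : List W) : Prop :=
  IsPath E π ∧ (∃ a ∈ A, π.head? = some a) ∧ (∃ b ∈ B, π.getLast? = some b) ∧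
    ∀ v ∈ π.tail, v ∉ A

/-- All edges of `π` point towards its last vertex. -/
def IsCausal (E : W → W → Prop) (π : List W) : Prop := π.IsChain E

/-- Descendants of `v`, including `v` itself. -/
def Desc (E : W → W → Prop) (v : W) : Set W := {w | Relation.ReflTransGen E v w}

/-- `c` is a collider on `π`: `π` contains `a → c ← b` as a subpath. -/
def IsCollider (E : W → W → Prop) (π : List W) (c : W) : Prop :=
  ∃ a b, [a, c, b] <:+: π ∧ E a c ∧ E b c

/-- `Z` blocks `π`. -/
def Blocks (E : W → W → Prop) (Z : Set W) (π : List W) : Prop :=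
  (∃ v ∈ π, ¬ IsCollider E π v ∧ v ∈ Z) ∨
    ∃ c, IsCollider E π c ∧ ∀ d ∈ Desc E c, d ∉ Z

/-- The forbidden set: all descendants of any `w ∉ A` lying on a proper causal path from `A`
to `B`. -/
def Forb (E : W → W → Prop) (A B : Set W) : Set W :=
  {d | ∃ π, IsProperPath E A B π ∧ IsCausal E π ∧ ∃ w ∈ π, w ∉ A ∧ d ∈ Desc E w}

/-- The adjustment criterion for `Z` relative to `(A, B)`. -/
def AdjustmentCriterion (E : W → W → Prop) (A B Z : Set W) : Prop :=
  Disjoint (Forb E A B) Z ∧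
    ∀ π, IsProperPath E A B π → ¬ IsCausal E π → Blocks E Z π

end Graphs

/-! ### Full-time causal graphs, summary causal graphs, common adjustment -/

section TimeSeries

variable {V : Type*}

/-- A full-time causal graph on the series `V`: an acyclic graph on the vertices `(S, s)`
(series `S` at time `s : ℤ`) whose edges do not go backward in time.  No consistency through
time is required. -/
structure FTCG (V : Type*) where
  Edge : V × ℤ → V × ℤ → Prop
  forward : ∀ a b, Edge a b → a.2 ≤ b.2
  acyclic : ∀ a, ¬ Relation.TransGen Edge a a

/-- `F` is a candidate for the summary graph with edge relation `E`: `E` is reduced from `F`. -/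
def IsCandidate (E : V → V → Prop) (F : FTCG V) : Prop :=
  ∀ A B, E A B ↔ ∃ (s : ℤ) (γ : ℕ), F.Edge (A, s - γ) (B, s)

/-- The common adjustment criterion for `Z` relative to `(A, B)` in the summary graph. -/
def CommonAdjustmentCriterion (E : V → V → Prop) (A B Z : Set (V × ℤ)) : Prop :=
  ∀ F : FTCG V, IsCandidate E F → AdjustmentCriterion F.Edge A B Z

/-- The effect of `A` on `B` is identifiable by common adjustment in the summary graph. -/
def IsIdentifiable (E : V → V → Prop) (A B : Set (V × ℤ)) : Prop :=
  ∃ Z : Set (V × ℤ), Disjoint Z A ∧ Disjoint Z B ∧ CommonAdjustmentCriterion E A B Z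

end TimeSeries

/-- A summary causal graph on `p` time series, given by its adjacency lists (children and
parents of each series).  Cycles and self-loops are allowed. -/
structure SCG (p : ℕ) where
  ch : Fin p → List (Fin p)
  pa : Fin p → List (Fin p)
  ch_nodup : ∀ v, (ch v).Nodup
  pa_nodup : ∀ v, (pa v).Nodup
  mem_pa : ∀ u v, u ∈ pa v ↔ v ∈ ch u

/-- `u → v` in the summary graph. -/
def SCG.Edge {p : ℕ} (G : SCG p) (u v : Fin p) : Prop := v ∈ G.ch u

instance {p : ℕ} (G : SCG p) (u v : Fin p) : Decidable (G.Edge u v) :=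
  inferInstanceAs (Decidable (v ∈ G.ch u))

/-- The number of edges of the summary graph. -/
def SCG.numEdges {p : ℕ} (G : SCG p) : ℕ :=
  (Finset.univ.filter fun e : Fin p × Fin p => G.Edge e.1 e.2).card

/-! ### Step counting

A computation of type `Timed α` is a result together with the number of steps spent on it.
The model is the unit-cost random access machine: every memory access, every iteration of a
loop and every recursive call is charged one step, and between two charges only a bounded number
of register operations (integer arithmetic and comparisons, tests, following a pointer) is
executed.  Arrays are used in a single-threaded way only. -/

structure Timed (α : Type) where
  val : α
  cost : ℕ

instance : Monad Timed where
  pure a := ⟨a, 0⟩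
  bind x f := ⟨(f x.val).val, x.cost + (f x.val).cost⟩

/-- One step. -/
def step : Timed Unit := ⟨(), 1⟩

/-- `for a in l do s ← f s a`, one step per iteration plus the cost of the body. -/
def forEach {α σ : Type} : List α → σ → (σ → α → Timed σ) → Timed σ
  | [], s, _ => pure s
  | a :: l, s, f => do
    step
    let s ← f s a
    forEach l s f

/-- Is `f a` true for some `a` in `l`?  Leaves the loop at the first such `a`. -/
def anyOf {α : Type} : List α → (α → Timed Bool) → Timed Bool
  | [], _ => pure false
  | a :: l, f => do
    step
    let b ← f a
    if b then pure true else anyOf l f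

/-- A block of memory cells indexed by `ι`. -/
def Arr (ι α : Type) : Type := ι → α

/-- Reading a cell. -/
def Arr.get {ι α : Type} (a : Arr ι α) (i : ι) : Timed α := ⟨a i, 1⟩

/-- Writing a cell. -/
def Arr.set {ι α : Type} [DecidableEq ι] (a : Arr ι α) (i : ι) (v : α) : Timed (Arr ι α) :=
  ⟨Function.update a i v, 1⟩

/-- An array with one cell per series, every cell being set to `v`. -/
def newArr {α : Type} (p : ℕ) (v : α) : Timed (Arr (Fin p) α) := ⟨fun _ => v, p + 1⟩

/-- Memory addressed by (series, time), all cells being blank at the start. -/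
abbrev Table (p : ℕ) : Type := Arr (Fin p × ℤ) (Option ℤ)

/-- A blank table. -/
def newTable (p : ℕ) : Timed (Table p) := ⟨fun _ => none, 1⟩

/-! ### Priority queues (leftist heaps) and sorting -/

inductive Heap (α : Type) where
  | leaf : Heap α
  | node (rank : ℕ) (x : α) (l r : Heap α) : Heap α

namespace Heap

variable {α : Type}

def rank : Heap α → ℕ
  | leaf => 0
  | node k _ _ _ => k

def make (x : α) (a b : Heap α) : Heap α :=
  if b.rank ≤ a.rank then node (b.rank + 1) x a b else node (a.rank + 1) x b a

/-- `before x y` means that `x` may leave the queue before `y`. -/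
def merge (before : α → α → Bool) : Heap α → Heap α → Timed (Heap α)
  | leaf, b => do
    step
    pure b
  | node k x l r, leaf => do
    step
    pure (node k x l r)
  | node k x l r, node k' x' l' r' => do
    step
    if before x x' then
      let m ← merge before r (node k' x' l' r')
      pure (make x l m)
    else
      let m ← merge before (node k x l r) r'
      pure (make x' l' m)
termination_by a b => sizeOf a + sizeOf b

def insert (before : α → α → Bool) (x : α) (h : Heap α) : Timed (Heap α) :=
  merge before (node 1 x leaf leaf) h

def pop (before : α → α → Bool) : Heap α → Timed (Option (α × Heap α))
  | leaf => do
    step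
    pure none
  | node _ x l r => do
    step
    let m ← merge before l r
    pure (some (x, m))

/-- Pop the elements one after the other; the numerical argument is the number of elements. -/
def drain (before : α → α → Bool) : ℕ → Heap α → Timed (List α)
  | 0, _ => pure []
  | k + 1, h => do
    step
    match ← h.pop before with
    | none => pure []
    | some (x, h) => do
      let l ← drain before k h
      pure (x :: l)

end Heap

/-- Sorting in the order `before`. -/
def heapSort {α : Type} (before : α → α → Bool) (l : List α) : Timed (List α) := do
  let h ← forEach l Heap.leaf fun h x => h.insert before x
  h.drain before l.length

/-! ### The next and the previous time at which a series is not intervened on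

`X` is the list of interventions. -/

/-- For every intervention `(S, s)` the cell `(S, s)` receives
`min {s₁ ≥ s | (S, s₁) ∉ X}`; the other cells stay blank. -/
def nextTable {p : ℕ} (X : List (Fin p × ℤ)) : Timed (Table p) := do
  let L ← heapSort (fun a b => decide (b.2 ≤ a.2)) X
  let T ← newTable p
  forEach L T fun T x => do
    let r ← T.get (x.1, x.2 + 1)
    T.set x (some (r.getD (x.2 + 1)))

/-- For every intervention `(S, s)` the cell `(S, s)` receives
`max {s₁ ≤ s | (S, s₁) ∉ X}`; the other cells stay blank. -/
def prevTable {p : ℕ} (X : List (Fin p × ℤ)) : Timed (Table p) := do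
  let L ← heapSort (fun a b => decide (a.2 ≤ b.2)) X
  let T ← newTable p
  forEach L T fun T x => do
    let r ← T.get (x.1, x.2 - 1)
    T.set x (some (r.getD (x.2 - 1)))

/-- `min {s₁ ≥ s | (S, s₁) ∉ X}` if `T` is the table of next times and
`max {s₁ ≤ s | (S, s₁) ∉ X}` if it is the table of previous times. -/
def free {p : ℕ} (T : Table p) (S : Fin p) (s : ℤ) : Timed ℤ := do
  let r ← T.get (S, s)
  pure (r.getD s)

/-! ### Backward search with a priority queue ordered by time -/

structure SearchState (p : ℕ) where
  queue : Heap (Fin p × ℤ)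
  seen : Arr (Fin p) Bool
  val : Arr (Fin p) (Option ℤ)

/-- The vertex with the largest time leaves the queue first. -/
def later {p : ℕ} (a b : Fin p × ℤ) : Bool := decide (b.2 ≤ a.2)

/-- `while Q ≠ ∅`: pop the vertex `(S, s)` of `Q` with the largest time; for every unseen parent
`P` of `S` record `best P s` (`none` is `-∞`), insert `P` at that time into `Q` if it is finite,
and mark `P` as seen.  Every series is inserted at most once on top of the initial vertex, so
that the loop ends with an empty queue after at most `p + 1` pops; the numerical argument only
makes the termination visible. -/
def search {p : ℕ} (G : SCG p) (best : Fin p → ℤ → Timed (Option ℤ)) :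
    ℕ → SearchState p → Timed (Arr (Fin p) (Option ℤ))
  | 0, σ => pure σ.val
  | k + 1, σ => do
    step
    match ← σ.queue.pop later with
    | none => pure σ.val
    | some (u, Q) => do
      let σ ← forEach (G.pa u.1) (⟨Q, σ.seen, σ.val⟩ : SearchState p) fun σ P => do
        let b ← σ.seen.get P
        if b then pure σ
        else
          let τ ← best P u.2
          let val ← σ.val.set P τ
          let seen ← σ.seen.set P true
          match τ with
          | none => pure ⟨σ.queue, seen, val⟩
          | some τ => do
            let Q ← σ.queue.insert later (P, τ)
            pure ⟨Q, seen, val⟩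
      search G best k σ

/-- For each series `S` the largest time at which `S` is an ancestor of `Y_t` outside the
interventions. -/
def ancestorTimes {p : ℕ} (G : SCG p) (prv : Table p) (Y : Fin p) (t : ℤ) :
    Timed (Arr (Fin p) (Option ℤ)) := do
  let Q ← Heap.leaf.insert later (Y, t)
  let val ← newArr p none
  let seen ← newArr p false
  let val ← val.set Y (some t)
  let seen ← seen.set Y true
  search G (fun P s => do
    let τ ← free prv P s
    pure (some τ)) (p + 2) ⟨Q, seen, val⟩

/-- The times of accessibility from each series to the vertex `v` inside the non-conditionable
set, the latter being given by the entrance times `tNC` (`none` is `+∞`):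
`best P s = max {s₁ ≤ s | s₁ ≥ tNC P, (P, s₁) ∉ X, (P, s₁) ≠ v}`. -/
def accessTimes {p : ℕ} (G : SCG p) (prv : Table p) (tNC : Arr (Fin p) (Option ℤ))
    (v : Fin p × ℤ) : Timed (Arr (Fin p) (Option ℤ)) := do
  let Q ← Heap.leaf.insert later v
  let val ← newArr p none
  let seen ← newArr p false
  search G (fun P s => do
    let τ₀ ← free prv P s
    let τ ← if (P, τ₀) = v then free prv P (τ₀ - 1) else pure τ₀
    match ← tNC.get P with
    | none => pure none
    | some e => pure (if e ≤ τ then some τ else none)) (p + 2) ⟨Q, seen, val⟩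

/-! ### Forward search -/

/-- Graph search: `stack` holds the vertices that are marked in `vis` but not yet expanded; only
vertices that satisfy `ok` are entered.  Returns the marks and the list of expanded vertices.
Every series enters the stack at most once, so that the stack is empty after at most `p`
rounds; the numerical argument only makes the termination visible. -/
def explore {p : ℕ} (G : SCG p) (ok : Fin p → Timed Bool) :
    ℕ → List (Fin p) → Arr (Fin p) Bool → List (Fin p) →
      Timed (Arr (Fin p) Bool × List (Fin p))
  | 0, _, vis, acc => pure (vis, acc)
  | _ + 1, [], vis, acc => do
    step
    pure (vis, acc)
  | k + 1, v :: stack, vis, acc => do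
    step
    let σ ← forEach (G.ch v) (stack, vis) fun σ w => do
      let b ← σ.2.get w
      let c ← ok w
      if b || !c then pure σ
      else
        let vis ← σ.2.set w true
        pure (w :: σ.1, vis)
    explore G ok k σ.1 σ.2 (v :: acc)

/-- The descendants of `C` in the subgraph induced by `ok` that are reached through vertices not
marked in `vis`; they become marked. -/
def descendants {p : ℕ} (G : SCG p) (ok : Fin p → Timed Bool) (C : Fin p)
    (vis : Arr (Fin p) Bool) : Timed (Arr (Fin p) Bool × List (Fin p)) := do
  let b ← vis.get C
  let c ← ok C
  if b || !c then pure (vis, [])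
  else
    let vis ← vis.set C true
    explore G ok (p + 1) [C] vis []

/-! ### Entrance times of the series into the non-conditionable set -/

/-- Minimum, `none` being `+∞`. -/
def optMin : Option ℤ → Option ℤ → Option ℤ
  | none, b => b
  | some a, none => some a
  | some a, some b => some (min a b)

/-- For each series the time of its first intervention. -/
def firstTimes {p : ℕ} (X : List (Fin p × ℤ)) : Timed (Arr (Fin p) (Option ℤ)) := do
  let A ← newArr p none
  forEach X A fun A x => do
    let r ← A.get x.1
    A.set x.1 (optMin r (some x.2))

/-- A child `C` of an intervened series with its finite time `t_C`.  The field `skip` is `none`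
if `d(C)` holds; otherwise it is the only series `X^i` with `X^i → C` that is intervened on at a
time `≤ t_C`. -/
structure Entry (p : ℕ) where
  C : Fin p
  time : ℤ
  skip : Option (Fin p)

/-- The order by `(t_C, not d(C))`. -/
def Entry.before {p : ℕ} (a b : Entry p) : Bool :=
  decide (a.time < b.time) ||
    (decide (a.time = b.time) && (a.skip.isNone || b.skip.isSome))

/-- The list of the children `C` of intervened series with `t_C < +∞`, where
`t_min = min {t - γ_i | X^i → C}`, `t_C = min {s ∈ [t_min, anc C] | (C, s) ∉ X}` and `d(C)` holds
if some `X^i → C` has `t - γ_i < t_C` or at least two have `t - γ_i = t_C`. -/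
def entries {p : ℕ} (G : SCG p) (nxt : Table p) (first anc : Arr (Fin p) (Option ℤ)) :
    Timed (List (Entry p)) :=
  forEach (List.finRange p) [] fun L C => do
    let tmin ← forEach (G.pa C) none fun m x => do
      let r ← first.get x
      pure (optMin m r)
    let a ← anc.get C
    match tmin, a with
    | some tmin, some a => do
      let tC ← free nxt C tmin
      if a < tC then pure L
      else
        let simul ← forEach (G.pa C) [] fun l x => do
          let r ← nxt.get (x, tC)
          pure (if r.isSome then x :: l else l)
        let d := decide (tmin < tC) || decide (2 ≤ simul.length)
        pure (⟨C, tC, if d then none else simul.head?⟩ :: L)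
    | _, _ => pure L

/-- For each `D` in `ds` whose entrance time is not yet set, set it to
`min {s₁ ≥ s | (D, s₁) ∉ X}`. -/
def assign {p : ℕ} (nxt : Table p) (s : ℤ) (ds : List (Fin p))
    (tNC : Arr (Fin p) (Option ℤ)) : Timed (Arr (Fin p) (Option ℤ)) :=
  forEach ds tNC fun tNC D => do
    match ← tNC.get D with
    | some _ => pure tNC
    | none => do
      let τ ← free nxt D s
      tNC.set D (some τ)

structure EntranceState (p : ℕ) where
  /-- marks of the searches in the graph with a series removed -/
  vis₁ : Arr (Fin p) Bool
  /-- marks of the searches in the whole graph -/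
  vis₂ : Arr (Fin p) Bool
  tNC : Arr (Fin p) (Option ℤ)

/-- Computation of the entrance times (`none` is `+∞`). -/
def entranceTimes {p : ℕ} (G : SCG p) (X : List (Fin p × ℤ)) (Y : Fin p) (t : ℤ)
    (nxt prv : Table p) : Timed (Arr (Fin p) (Option ℤ)) := do
  let anc ← ancestorTimes G prv Y t
  let first ← firstTimes X
  let L ← entries G nxt first anc
  let L ← heapSort Entry.before L
  let vis₁ ← newArr p false
  let vis₂ ← newArr p false
  let tNC ← newArr p none
  let σ ← forEach L (⟨vis₁, vis₂, tNC⟩ : EntranceState p) fun σ e => do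
    match e.skip with
    | none => do
      let r₂ ← descendants G (fun _ => pure true) e.C σ.vis₂
      let tNC ← assign nxt e.time r₂.2 σ.tNC
      pure ⟨σ.vis₁, r₂.1, tNC⟩
    | some x => do
      let r₁ ← descendants G (fun w => pure (decide (w ≠ x))) e.C σ.vis₁
      let tNC ← assign nxt e.time r₁.2 σ.tNC
      let r₂ ← descendants G (fun _ => pure true) e.C σ.vis₂
      let tNC ← assign nxt (e.time + 1) r₂.2 tNC
      pure ⟨r₁.1, r₂.1, tNC⟩
  pure σ.tNC

/-! ### The decision algorithm -/

/-- Comparison of an entrance time (`none` is `+∞`) with a time of accessibility (`none` is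
`-∞`). -/
def leTimes : Option ℤ → Option ℤ → Bool
  | some a, some b => decide (a ≤ b)
  | _, _ => false

/-- The decision algorithm for identifiability by common adjustment of the effect of the
interventions `X` on `Y_t`. -/
def decideIdentifiable {p : ℕ} (G : SCG p) (X : List (Fin p × ℤ)) (Y : Fin p) (t : ℤ) :
    Timed Bool := do
  let nxt ← nextTable X
  let prv ← prevTable X
  let tNC ← entranceTimes G X Y t nxt prv
  -- directed paths: descendants of `Y` in the graph induced by
  -- `{S | tNC S ≤ t} ∪ {X^i | γ_i = 0}`
  let inS ← newArr p false
  let inS ← forEach (List.finRange p) inS fun inS S => do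
    let e ← tNC.get S
    if leTimes e (some t) then inS.set S true else pure inS
  let inS ← forEach X inS fun inS x =>
    if x.2 = t then inS.set x.1 true else pure inS
  let vis ← newArr p false
  let r ← descendants G (fun w => inS.get w) Y vis
  let direct ← anyOf X fun x => do
    let b ← r.1.get x.1
    pure (b && decide (x.2 = t))
  if direct then pure false
  else
    -- fork paths
    let accY ← accessTimes G prv tNC (Y, t)
    let accX ← forEach X [] fun l x => do
      let a ← accessTimes G prv tNC x
      pure (a :: l)
    let fork ← anyOf accX fun a =>
      anyOf (List.finRange p) fun F => do
        let e ← tNC.get F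
        let s₁ ← a.get F
        let s₂ ← accY.get F
        pure (leTimes e s₁ && leTimes e s₂)
    pure (!fork)

end CommonAdjustment

/-!
A series becomes *non-conditionable* from its entrance time on: a vertex outside the interventions
that is not earlier than the entrance time of its series lies in `Forb` for some candidate graph, so
no common adjustment set contains it. Conversely, an adjustment set should be taken as large as
possible, namely as the complement `Z` of the interventions and of the set `N` of all these
vertices.

A simple walk of the summary graph, equipped with nondecreasing times, is a walk of some candidate:
take all edges between different times, and those edges inside one time slice that respect an
enumeration of the vertices. Two walks inside `N` from a common vertex, one to an intervention and
one to the target, contain a simple fork, and a candidate containing this fork refutes every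
adjustment set. In the other direction, a path that `Z` leaves open cannot enter a collider, since
`N` is closed under descendants outside the interventions; so it is such a fork. This is why
latest-time backward searches from the target and from each intervention decide the question: going
back as late as possible only enlarges the set of vertices that can be reached next.

The delicate entries are those whose only parent intervened on at or before that time is itself
reached from the entered series. If there is such a cyclic entry, the cycle through the skipped
parent already yields a fork, so the exact shape of `N` matters in its absence only.

For the running time, the weights of the queue elements and of the unseen series add up to a
potential that pays for the expansion of each series at most once. Thus each of the `|X| + 1`
searches takes `O((|E| + |V|) log |V|)` steps, and sorting `X` takes `O(|X| log |X|)`.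
-/

namespace CommonAdjustment

open Relation

/-! ### Timed computations -/

@[simp] lemma Timed.pure_val {α : Type} (a : α) : (pure a : Timed α).val = a := rfl

@[simp] lemma Timed.pure_cost {α : Type} (a : α) : (pure a : Timed α).cost = 0 := rfl

@[simp] lemma Timed.bind_val {α β : Type} (x : Timed α) (f : α → Timed β) :
    (x >>= f).val = (f x.val).val := rfl

@[simp] lemma Timed.bind_cost {α β : Type} (x : Timed α) (f : α → Timed β) :
    (x >>= f).cost = x.cost + (f x.val).cost := rfl

@[simp] lemma step_cost : step.cost = 1 := rfl

@[simp] lemma Arr.get_val {ι α : Type} (a : Arr ι α) (i : ι) : (a.get i).val = a i := rfl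

@[simp] lemma Arr.get_cost {ι α : Type} (a : Arr ι α) (i : ι) : (a.get i).cost = 1 := rfl

/-- The array `a` with the cell `i` set to `v`; unlike `Function.update` it is an `Arr`. -/
def Arr.update {ι α : Type} [DecidableEq ι] (a : Arr ι α) (i : ι) (v : α) : Arr ι α :=
  fun j => if j = i then v else a j

lemma Arr.update_apply {ι α : Type} [DecidableEq ι] (a : Arr ι α) (i j : ι) (v : α) :
    a.update i v j = if j = i then v else a j := rfl

@[simp] lemma Arr.update_self {ι α : Type} [DecidableEq ι] (a : Arr ι α) (i : ι) (v : α) :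
    a.update i v i = v :=
  if_pos rfl

lemma Arr.update_of_ne {ι α : Type} [DecidableEq ι] {a : Arr ι α} {i j : ι} (h : j ≠ i)
    (v : α) : a.update i v j = a j :=
  if_neg h

/-- The array all of whose cells are `v`. -/
def Arr.const {ι α : Type} (v : α) : Arr ι α := fun _ => v

@[simp] lemma Arr.const_apply {ι α : Type} (v : α) (i : ι) : (Arr.const v : Arr ι α) i = v := rfl

@[simp] lemma Arr.set_val {ι α : Type} [DecidableEq ι] (a : Arr ι α) (i : ι) (v : α) :
    (a.set i v).val = a.update i v :=
  funext fun j => Function.update_apply (β := α) a i v j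

@[simp] lemma Arr.set_cost {ι α : Type} [DecidableEq ι] (a : Arr ι α) (i : ι) (v : α) :
    (a.set i v).cost = 1 := rfl

@[simp] lemma newArr_val {α : Type} (p : ℕ) (v : α) : (newArr p v).val = Arr.const v := rfl

@[simp] lemma newArr_cost {α : Type} (p : ℕ) (v : α) : (newArr p v).cost = p + 1 := rfl

@[simp] lemma newTable_cost (p : ℕ) : (newTable p).cost = 1 := rfl

@[simp] lemma free_val {p : ℕ} (T : Table p) (S : Fin p) (s : ℤ) :
    (free T S s).val = (T (S, s)).getD s := rfl

@[simp] lemma free_cost {p : ℕ} (T : Table p) (S : Fin p) (s : ℤ) : (free T S s).cost = 1 := rfl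

section Loops

variable {α σ : Type}

@[simp] lemma forEach_nil (s : σ) (f : σ → α → Timed σ) : forEach [] s f = pure s := rfl

@[simp] lemma forEach_cons_val (a : α) (l : List α) (s : σ) (f : σ → α → Timed σ) :
    (forEach (a :: l) s f).val = (forEach l (f s a).val f).val := rfl

lemma forEach_cons_cost (a : α) (l : List α) (s : σ) (f : σ → α → Timed σ) :
    (forEach (a :: l) s f).cost = 1 + ((f s a).cost + (forEach l (f s a).val f).cost) := rfl

lemma forEach_append_val (l₁ l₂ : List α) (s : σ) (f : σ → α → Timed σ) :
    (forEach (l₁ ++ l₂) s f).val = (forEach l₂ (forEach l₁ s f).val f).val := by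
  induction l₁ generalizing s with
  | nil => rfl
  | cons _ _ ih => exact ih _

lemma forEach_append_cost (l₁ l₂ : List α) (s : σ) (f : σ → α → Timed σ) :
    (forEach (l₁ ++ l₂) s f).cost =
      (forEach l₁ s f).cost + (forEach l₂ (forEach l₁ s f).val f).cost := by
  induction l₁ generalizing s with
  | nil => simp
  | cons a l ih => simp only [List.cons_append, forEach_cons_cost, forEach_cons_val, ih, add_assoc]

/-- `I` is a loop invariant that may refer to the part of the list already treated, `Φ` a
potential that pays for the excess of the actual cost of a round over its amortized cost `c`. -/
theorem forEach_amortized (I : List α → σ → Prop) (Φ : σ → ℕ) (c : α → ℕ) {f : σ → α → Timed σ}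
    {l : List α} {s : σ} (h₀ : I [] s)
    (hstep : ∀ pre a s, pre ++ [a] <+: l → I pre s →
      I (pre ++ [a]) (f s a).val ∧ (f s a).cost + Φ (f s a).val ≤ c a + Φ s) :
    I l (forEach l s f).val ∧
      (forEach l s f).cost + Φ (forEach l s f).val ≤ (l.map fun a => c a + 1).sum + Φ s := by
  induction l using List.reverseRecOn with
  | nil => simpa using h₀
  | append_singleton l a ih =>
    obtain ⟨hI, hcost⟩ := ih fun pre b s h => hstep pre b s (h.trans (List.prefix_append l [a]))
    obtain ⟨hI', hcost'⟩ := hstep l a _ List.prefix_rfl hI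
    rw [forEach_append_cost, forEach_append_val, List.map_append, List.sum_append,
      forEach_cons_val, forEach_cons_cost]
    refine ⟨hI', ?_⟩
    simp only [forEach_nil, Timed.pure_val, Timed.pure_cost, List.map_cons, List.map_nil,
      List.sum_singleton]
    omega

lemma forEach_prefix_inv (I : List α → σ → Prop) (f : σ → α → Timed σ) (l : List α) (s : σ)
    (h₀ : I [] s)
    (hstep : ∀ pre a s, pre ++ [a] <+: l → I pre s → I (pre ++ [a]) (f s a).val) :
    I l (forEach l s f).val := by
  induction l using List.reverseRecOn with
  | nil => exact h₀
  | append_singleton l a ih =>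
    rw [forEach_append_val]
    exact hstep l a _ List.prefix_rfl
      (ih fun pre b s h => hstep pre b s (h.trans (List.prefix_append l [a])))

lemma forEach_inv (I : σ → Prop) (f : σ → α → Timed σ) (l : List α) (s : σ)
    (h₀ : I s) (hstep : ∀ a ∈ l, ∀ s, I s → I (f s a).val) : I (forEach l s f).val :=
  forEach_prefix_inv (fun _ => I) f l s h₀ fun _ a s hp hI =>
    hstep a (hp.subset (List.mem_append_right _ (List.mem_singleton_self a))) s hI

lemma forEach_cost_sum (c : α → ℕ) (f : σ → α → Timed σ) (l : List α) (s : σ)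
    (hf : ∀ a s, (f s a).cost ≤ c a) : (forEach l s f).cost ≤ (l.map fun a => c a + 1).sum :=
  (forEach_amortized (fun _ _ => True) (fun _ => 0) c trivial
    fun _ a s _ _ => ⟨trivial, hf a s⟩).2

lemma forEach_cost_le (c : ℕ) (f : σ → α → Timed σ) (l : List α) (s : σ)
    (hf : ∀ a s, (f s a).cost ≤ c) : (forEach l s f).cost ≤ l.length * (c + 1) := by
  simpa [List.map_const', List.sum_replicate] using forEach_cost_sum (fun _ => c) f l s hf

lemma anyOf_val (l : List α) (f : α → Timed Bool) :
    (anyOf l f).val = true ↔ ∃ a ∈ l, (f a).val = true := by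
  induction l with
  | nil => simp [anyOf]
  | cons a l ih =>
    simp only [anyOf, Timed.bind_val, List.mem_cons, exists_eq_or_imp]
    split <;> simp_all

lemma anyOf_cost_le (c : ℕ) (l : List α) (f : α → Timed Bool) (hf : ∀ a ∈ l, (f a).cost ≤ c) :
    (anyOf l f).cost ≤ l.length * (c + 1) := by
  induction l with
  | nil => simp [anyOf]
  | cons a l ih =>
    have hhead := hf a List.mem_cons_self
    have htail := ih fun b hb => hf b (List.mem_cons_of_mem a hb)
    simp only [anyOf, Timed.bind_cost, step_cost, List.length_cons, add_mul]
    split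
    · simp only [Timed.pure_cost]; omega
    · omega

end Loops

/-! ### Leftist heaps -/

namespace Heap

variable {α : Type}

/-- The multiset of the elements of a heap. -/
def elems : Heap α → Multiset α
  | leaf => 0
  | node _ x l r => x ::ₘ (l.elems + r.elems)

@[simp] lemma elems_leaf : (leaf : Heap α).elems = 0 := rfl

@[simp] lemma elems_node (k : ℕ) (x : α) (l r : Heap α) :
    (node k x l r).elems = x ::ₘ (l.elems + r.elems) := rfl

/-- The heap property: every node comes `before` everything below it. -/
def Ordered (before : α → α → Bool) : Heap α → Prop
  | leaf => True
  | node _ x l r =>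
    (∀ y ∈ l.elems + r.elems, before x y = true) ∧ l.Ordered before ∧ r.Ordered before

/-- The leftist property: ranks are the lengths of the right spines, and no right subtree has
a larger rank than its left sibling. -/
def Leftist : Heap α → Prop
  | leaf => True
  | node k _ l r => k = r.rank + 1 ∧ r.rank ≤ l.rank ∧ l.Leftist ∧ r.Leftist

@[simp] lemma rank_node (k : ℕ) (x : α) (l r : Heap α) : (node k x l r).rank = k := rfl

lemma leftist_singleton (x : α) : (node 1 x leaf leaf).Leftist := ⟨rfl, le_rfl, trivial, trivial⟩

lemma elems_make (x : α) (a b : Heap α) : (make x a b).elems = x ::ₘ (a.elems + b.elems) := by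
  unfold make
  split <;> simp [add_comm]

lemma Leftist.make {x : α} {a b : Heap α} (ha : a.Leftist) (hb : b.Leftist) :
    (make x a b).Leftist := by
  unfold Heap.make
  split
  case isTrue h => exact ⟨rfl, h, ha, hb⟩
  case isFalse h => exact ⟨rfl, (not_le.1 h).le, hb, ha⟩

lemma Leftist.two_pow_rank_le {h : Heap α} (hh : h.Leftist) : 2 ^ h.rank ≤ h.elems.card + 1 := by
  induction h with
  | leaf => simp [rank]
  | node k x l r ihl ihr =>
    obtain ⟨rfl, hrank, hl, hr⟩ := hh
    have hle := ihl hl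
    have hre := ihr hr
    have hpow : 2 ^ r.rank ≤ 2 ^ l.rank := Nat.pow_le_pow_right two_pos hrank
    simp only [rank_node, pow_succ, elems_node, Multiset.card_cons, Multiset.card_add]
    omega

lemma Leftist.rank_le {h : Heap α} (hh : h.Leftist) {n : ℕ} (hn : h.elems.card ≤ n) :
    h.rank ≤ Nat.log 2 (n + 1) :=
  Nat.le_log_of_pow_le one_lt_two (hh.two_pow_rank_le.trans (Nat.succ_le_succ hn))

variable (before : α → α → Bool)

lemma elems_merge (a b : Heap α) : (merge before a b).val.elems = a.elems + b.elems := by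
  fun_induction merge before a b with
  | case1 b => simp
  | case2 => simp
  | case3 k x l r k' x' l' r' ih₁ ih₂ =>
    rw [Timed.bind_val]
    split
    · simp only [Timed.bind_val, Timed.pure_val, elems_make, ih₁, elems_node, Multiset.cons_add,
        Multiset.add_cons, add_assoc]
      exact Multiset.cons_swap ..
    · simp only [Timed.bind_val, Timed.pure_val, elems_make, ih₂, elems_node, Multiset.cons_add,
        Multiset.add_cons]
      rw [add_left_comm]

lemma elems_insert (x : α) (h : Heap α) : (h.insert before x).val.elems = x ::ₘ h.elems := by
  simp [insert, elems_merge]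

lemma Leftist.merge {a b : Heap α} (ha : a.Leftist) (hb : b.Leftist) :
    (merge before a b).val.Leftist := by
  fun_induction Heap.merge before a b with
  | case1 b => exact hb
  | case2 => exact ha
  | case3 k x l r k' x' l' r' ih₁ ih₂ =>
    rw [Timed.bind_val]
    split
    · exact Leftist.make ha.2.2.1 (ih₁ ha.2.2.2 hb)
    · exact Leftist.make hb.2.2.1 (ih₂ ha hb.2.2.2)

lemma Leftist.insert (x : α) {h : Heap α} (hh : h.Leftist) : (h.insert before x).val.Leftist :=
  Leftist.merge before (leftist_singleton x) hh

lemma merge_cost_le {a b : Heap α} (ha : a.Leftist) (hb : b.Leftist) :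
    (merge before a b).cost ≤ a.rank + b.rank + 1 := by
  fun_induction Heap.merge before a b with
  | case1 b => simp
  | case2 => simp
  | case3 k x l r k' x' l' r' ih₁ ih₂ =>
    have hleft := ih₁ ha.2.2.2 hb
    have hright := ih₂ ha hb.2.2.2
    have hk := ha.1
    have hk' := hb.1
    simp only [rank_node] at hleft hright ⊢
    rw [Timed.bind_cost, step_cost]
    split <;> (simp only [Timed.bind_cost, Timed.pure_cost]; omega)

lemma insert_cost_le (x : α) {h : Heap α} (hh : h.Leftist) {n : ℕ} (hn : h.elems.card ≤ n) :
    (h.insert before x).cost ≤ Nat.log 2 (n + 1) + 2 :=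
  calc (h.insert before x).cost ≤ 1 + h.rank + 1 := merge_cost_le before (leftist_singleton x) hh
    _ ≤ Nat.log 2 (n + 1) + 2 := by have := hh.rank_le hn; omega

lemma pop_eq_none_iff (h : Heap α) : (h.pop before).val = none ↔ h.elems = 0 := by
  cases h <;> simp [pop]

variable {before}

lemma pop_eq_some_iff {h h' : Heap α} {x : α} :
    (h.pop before).val = some (x, h') ↔
      ∃ k l r, h = node k x l r ∧ h' = (merge before l r).val := by
  cases h with
  | leaf => simp [pop]
  | node k y l r => simp [pop, eq_comm]

lemma elems_of_pop {h h' : Heap α} {x : α} (hp : (h.pop before).val = some (x, h')) :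
    h.elems = x ::ₘ h'.elems := by
  obtain ⟨k, l, r, rfl, rfl⟩ := pop_eq_some_iff.1 hp
  rw [elems_node, elems_merge]

lemma before_of_pop {h h' : Heap α} {x : α} (hh : h.Ordered before)
    (hp : (h.pop before).val = some (x, h')) : ∀ y ∈ h'.elems, before x y = true := by
  obtain ⟨k, l, r, rfl, rfl⟩ := pop_eq_some_iff.1 hp
  rw [elems_merge]
  exact hh.1

lemma Leftist.of_pop {h h' : Heap α} {x : α} (hh : h.Leftist)
    (hp : (h.pop before).val = some (x, h')) : h'.Leftist := by
  obtain ⟨k, l, r, rfl, rfl⟩ := pop_eq_some_iff.1 hp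
  exact Leftist.merge before hh.2.2.1 hh.2.2.2

lemma pop_cost_le {h : Heap α} (hh : h.Leftist) {n : ℕ} (hn : h.elems.card ≤ n) :
    (h.pop before).cost ≤ 2 * Nat.log 2 (n + 1) + 2 := by
  cases h with
  | leaf => simp [pop]
  | node k y l r =>
    have hcard : l.elems.card + r.elems.card + 1 ≤ n := by simpa using hn
    have hmerge := merge_cost_le before hh.2.2.1 hh.2.2.2
    have hl := hh.2.2.1.rank_le (n := n) (by omega)
    have hr := hh.2.2.2.rank_le (n := n) (by omega)
    simp only [pop, Timed.bind_cost, step_cost, Timed.pure_cost]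
    omega

lemma drain_cost_le (k : ℕ) {n : ℕ} {h : Heap α} (hh : h.Leftist) (hn : h.elems.card ≤ n) :
    (h.drain before k).cost ≤ k * (2 * Nat.log 2 (n + 1) + 3) := by
  induction k generalizing h with
  | zero => simp [drain]
  | succ k ih =>
    have hpop := pop_cost_le (before := before) hh hn
    simp only [drain, Timed.bind_cost, step_cost, add_mul, one_mul]
    rcases hp : (h.pop before).val with _ | ⟨x, h'⟩
    · simp only [Timed.pure_cost]; omega
    · rw [elems_of_pop hp, Multiset.card_cons] at hn
      have hrest := ih (hh.of_pop hp) (Nat.le_of_succ_le hn)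
      simp only [Timed.bind_cost, Timed.pure_cost]
      omega

lemma Ordered.make {x : α} {a b : Heap α} (ha : a.Ordered before)
    (hb : b.Ordered before) (h : ∀ y ∈ a.elems + b.elems, before x y = true) :
    (make x a b).Ordered before := by
  unfold Heap.make
  split
  · exact ⟨h, ha, hb⟩
  · exact ⟨by rwa [add_comm], hb, ha⟩

variable (total : ∀ x y, before x y || before y x)
  (trans : ∀ x y z, before x y → before y z → before x z)
include trans

lemma Ordered.before_of_mem_node {k : ℕ} {z x : α} {l r : Heap α}
    (h : (node k x l r).Ordered before) (hz : before z x) :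
    ∀ y ∈ (node k x l r).elems, before z y = true := by
  rw [elems_node, Multiset.forall_mem_cons]
  exact ⟨hz, fun y hy => trans _ _ _ hz (h.1 y hy)⟩

include total

lemma Ordered.merge {a b : Heap α} (ha : a.Ordered before) (hb : b.Ordered before) :
    (merge before a b).val.Ordered before := by
  fun_induction Heap.merge before a b with
  | case1 b => exact hb
  | case2 => exact ha
  | case3 k x l r k' x' l' r' ih₁ ih₂ =>
    rw [Timed.bind_val]
    split
    case isTrue h =>
      refine Ordered.make ha.2.1 (ih₁ ha.2.2 hb) fun y hy => ?_
      rw [elems_merge, ← add_assoc, Multiset.mem_add] at hy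
      exact hy.elim (ha.1 y) (hb.before_of_mem_node trans h y)
    case isFalse h =>
      have h' : before x' x := ((Bool.or_eq_true_iff ..).1 (total x x')).resolve_left h
      refine Ordered.make hb.2.1 (ih₂ ha hb.2.2) fun y hy => ?_
      rw [elems_merge, add_left_comm, Multiset.mem_add] at hy
      exact hy.elim (ha.before_of_mem_node trans h' y) (hb.1 y)

lemma Ordered.insert (x : α) {h : Heap α} (hh : h.Ordered before) :
    (h.insert before x).val.Ordered before :=
  Ordered.merge total trans ⟨by simp, trivial, trivial⟩ hh

lemma Ordered.of_pop {h h' : Heap α} {x : α} (hh : h.Ordered before)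
    (hp : (h.pop before).val = some (x, h')) : h'.Ordered before := by
  obtain ⟨k, l, r, rfl, rfl⟩ := pop_eq_some_iff.1 hp
  exact Ordered.merge total trans hh.2.1 hh.2.2

lemma drain_spec {k : ℕ} {h : Heap α} (hh : h.Ordered before) (hk : h.elems.card = k) :
    ((h.drain before k).val : Multiset α) = h.elems ∧
      (h.drain before k).val.Pairwise (fun a b => before a b = true) := by
  induction k generalizing h with
  | zero => simp [drain, Multiset.card_eq_zero.1 hk]
  | succ k ih =>
    simp only [drain, Timed.bind_val]
    rcases hp : (h.pop before).val with _ | ⟨x, h'⟩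
    · simp [(pop_eq_none_iff before h).1 hp] at hk
    · rw [elems_of_pop hp, Multiset.card_cons, Nat.succ_inj] at hk
      obtain ⟨hperm, hsorted⟩ := ih (hh.of_pop total trans hp) hk
      simp only [Timed.bind_val, Timed.pure_val]
      refine ⟨by rw [elems_of_pop hp, ← hperm]; rfl,
        List.pairwise_cons.2 ⟨fun y hy => before_of_pop hh hp y ?_, hsorted⟩⟩
      rwa [← hperm]

end Heap

section Sorting

variable {α : Type} {before : α → α → Bool}

lemma elems_forEach_insert (l : List α) :
    (forEach l Heap.leaf fun h x => h.insert before x).val.elems = (l : Multiset α) :=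
  forEach_prefix_inv (fun pre (h : Heap α) => h.elems = (pre : Multiset α)) _ l _ rfl
    fun pre a h _ hh => by
      rw [Heap.elems_insert, hh, Multiset.cons_coe, Multiset.coe_eq_coe]
      exact (List.perm_append_singleton a pre).symm

theorem heapSort_spec (total : ∀ x y, before x y || before y x)
    (trans : ∀ x y z, before x y → before y z → before x z) (l : List α) :
    (heapSort before l).val.Perm l ∧
      (heapSort before l).val.Pairwise (fun a b => before a b = true) := by
  have hordered := forEach_inv (fun h : Heap α => h.Ordered before)
    (fun h x => h.insert before x) l Heap.leaf trivial
    fun a _ h hh => hh.insert total trans a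
  have hcard := congrArg Multiset.card (elems_forEach_insert (before := before) l)
  obtain ⟨hperm, hsorted⟩ := Heap.drain_spec total trans hordered hcard
  exact ⟨Multiset.coe_eq_coe.1 (hperm.trans (elems_forEach_insert l)), hsorted⟩

theorem heapSort_cost_le (before : α → α → Bool) (l : List α) :
    (heapSort before l).cost ≤ l.length * (3 * Nat.log 2 (l.length + 1) + 6) := by
  obtain ⟨⟨-, hleftist⟩, hinsert⟩ := forEach_amortized
    (f := fun h x => h.insert before x) (l := l) (s := Heap.leaf)
    (fun pre (h : Heap α) => h.elems.card = pre.length ∧ h.Leftist) (fun _ => 0)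
    (fun _ => Nat.log 2 (l.length + 1) + 2) ⟨rfl, trivial⟩
    fun pre a h hpre hh => ⟨⟨by
      rw [Heap.elems_insert, Multiset.card_cons, hh.1, List.length_append, List.length_singleton],
      hh.2.insert before a⟩, Heap.insert_cost_le before a hh.2
        (hh.1.trans_le ((List.prefix_append pre [a]).trans hpre).length_le)⟩
  have hdrain := Heap.drain_cost_le (before := before) l.length hleftist
    (congrArg Multiset.card (elems_forEach_insert l)).le
  simp only [List.map_const', List.sum_replicate, smul_eq_mul] at hinsert
  simp only [heapSort, Timed.bind_cost]
  calc _ ≤ _ := add_le_add hinsert hdrain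
    _ = _ := by rw [Multiset.coe_card]; ring

end Sorting

/-! ### The tables of next and previous times -/

section Tables

variable {p : ℕ}

lemma later_total (a b : Fin p × ℤ) : later a b || later b a := by
  simpa [later] using le_total b.2 a.2

lemma later_trans (a b c : Fin p × ℤ) (hab : later a b) (hbc : later b c) : later a c :=
  decide_eq_true ((of_decide_eq_true hbc).trans (of_decide_eq_true hab))

lemma earlier_total (a b : Fin p × ℤ) : decide (a.2 ≤ b.2) || decide (b.2 ≤ a.2) := by
  simpa using le_total a.2 b.2

lemma earlier_trans (a b c : Fin p × ℤ) (hab : decide (a.2 ≤ b.2)) (hbc : decide (b.2 ≤ c.2)) :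
    decide (a.2 ≤ c.2) :=
  decide_eq_true ((of_decide_eq_true hab).trans (of_decide_eq_true hbc))

/-- A round of the loops that fill the tables: the cell `x` receives the value of its neighbour
`nb x`, a blank neighbour standing for its own time. -/
def fillCell (nb : Fin p × ℤ → Fin p × ℤ) (T : Table p) (x : Fin p × ℤ) : Timed (Table p) := do
  let r ← T.get (nb x)
  T.set x (some (r.getD (nb x).2))

/-- The relation `P x v` stands for "`v` is the correct value at `x`". -/
lemma forEach_fillCell_spec {nb : Fin p × ℤ → Fin p × ℤ} (hnb : ∀ x, nb x ≠ x)
    {P : Fin p × ℤ → ℤ → Prop} {L : List (Fin p × ℤ)} (hblank : ∀ x ∉ L, P x x.2)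
    (hfill : ∀ x ∈ L, ∀ v, P (nb x) v → P x v) (hL : L.Pairwise fun x y => nb x ≠ y) (x) :
    (((forEach L (Arr.const none) (fillCell nb)).val x).isSome ↔ x ∈ L) ∧
      P x (((forEach L (Arr.const none) (fillCell nb)).val x).getD x.2) := by
  have hinv := forEach_prefix_inv
    (fun pre (T : Table p) => ∀ x, ((T x).isSome ↔ x ∈ pre) ∧ (x ∈ pre → P x ((T x).getD x.2)))
    (fillCell nb) L (Arr.const none) (by simp) fun pre a T ⟨post, hpost⟩ hT x => by
      simp only [fillCell, Timed.bind_val, Arr.get_val, Arr.set_val]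
      by_cases hxa : x = a
      · subst hxa
        refine ⟨by simp, fun _ => ?_⟩
        rw [Arr.update_self]
        refine hfill x (by simp [← hpost]) _ ?_
        by_cases hpre : nb x ∈ pre
        · exact (hT _).2 hpre
        · have hnone : T (nb x) = none := by
            rw [← Option.not_isSome_iff_eq_none, (hT _).1]
            exact hpre
          have hlater : nb x ∉ post := fun h => by
            rw [← hpost, List.append_assoc, List.singleton_append] at hL
            exact (List.pairwise_cons.1 (List.pairwise_append.1 hL).2.1).1 _ h rfl
          rw [hnone]
          exact hblank _ (by simp [← hpost, hpre, hlater, hnb])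
      · rw [Arr.update_of_ne hxa]
        simpa [hxa] using hT x
  refine ⟨(hinv x).1, ?_⟩
  by_cases hx : x ∈ L
  · exact (hinv x).2 hx
  · rw [Option.not_isSome_iff_eq_none.1 (mt (hinv x).1.1 hx)]
    exact hblank x hx

variable (X : List (Fin p × ℤ))

/-- `T` is the table of the next times outside the interventions. -/
structure IsNextTable (T : Table p) : Prop where
  isSome_iff : ∀ x, (T x).isSome ↔ x ∈ X
  isLeast : ∀ S s, IsLeast {s₁ | s ≤ s₁ ∧ (S, s₁) ∉ X} ((T (S, s)).getD s)

/-- `T` is the table of the previous times outside the interventions. -/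
structure IsPrevTable (T : Table p) : Prop where
  isGreatest : ∀ S s, IsGreatest {s₁ | s₁ ≤ s ∧ (S, s₁) ∉ X} ((T (S, s)).getD s)

theorem isNextTable_nextTable : IsNextTable X (nextTable X).val := by
  obtain ⟨hperm, hsort⟩ := heapSort_spec (before := fun a b : Fin p × ℤ => decide (b.2 ≤ a.2))
    later_total later_trans X
  have hspec := forEach_fillCell_spec (nb := fun x => (x.1, x.2 + 1))
    (P := fun x v => IsLeast {s | x.2 ≤ s ∧ (x.1, s) ∉ X} v)
    (fun x h => absurd (congrArg Prod.snd h) (by simp))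
    (fun x hx => ⟨⟨le_rfl, mt hperm.mem_iff.2 hx⟩, fun s hs => hs.1⟩)
    (fun x hx v hv => ⟨⟨(Int.le_add_one le_rfl).trans hv.1.1, hv.1.2⟩, fun s hs => hv.2
      ⟨hs.1.lt_of_ne fun h => hs.2 (h ▸ hperm.subset hx), hs.2⟩⟩)
    (hsort.imp fun hxy h => by simp [← h] at hxy)
  exact ⟨fun x => (hspec x).1.trans hperm.mem_iff, fun S s => (hspec (S, s)).2⟩

theorem isPrevTable_prevTable : IsPrevTable X (prevTable X).val := by
  obtain ⟨hperm, hsort⟩ := heapSort_spec (before := fun a b : Fin p × ℤ => decide (a.2 ≤ b.2))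
    earlier_total earlier_trans X
  have hspec := forEach_fillCell_spec (nb := fun x => (x.1, x.2 - 1))
    (P := fun x v => IsGreatest {s | s ≤ x.2 ∧ (x.1, s) ∉ X} v)
    (fun x h => absurd (congrArg Prod.snd h) (by simp))
    (fun x hx => ⟨⟨le_rfl, mt hperm.mem_iff.2 hx⟩, fun s hs => hs.1⟩)
    (fun x hx v hv => ⟨⟨hv.1.1.trans (Int.sub_le_self _ zero_le_one), hv.1.2⟩, fun s hs => hv.2
      ⟨Int.le_sub_one_of_lt (hs.1.lt_of_ne fun h => hs.2 (h ▸ hperm.subset hx)), hs.2⟩⟩)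
    (hsort.imp fun hxy h => by simp [← h] at hxy)
  exact ⟨fun S s => (hspec (S, s)).2⟩

lemma forEach_fillCell_cost_le (nb : Fin p × ℤ → Fin p × ℤ) (L : List (Fin p × ℤ)) (T : Table p) :
    (forEach L T (fillCell nb)).cost ≤ L.length * 3 :=
  forEach_cost_le 2 (fillCell nb) L T fun _ _ => le_rfl

lemma heapSort_bind_fillCell_cost_le {before : Fin p × ℤ → Fin p × ℤ → Bool}
    (total : ∀ x y, before x y || before y x)
    (trans : ∀ x y z, before x y → before y z → before x z) (nb : Fin p × ℤ → Fin p × ℤ) :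
    (do
      let L ← heapSort before X
      let T ← newTable p
      forEach L T (fillCell nb) : Timed (Table p)).cost ≤
      X.length * (3 * Nat.log 2 (X.length + 1) + 9) + 1 := by
  have hsort := heapSort_cost_le before X
  have hfill := forEach_fillCell_cost_le nb (heapSort before X).val (newTable p).val
  rw [(heapSort_spec total trans X).1.length_eq] at hfill
  simp only [Timed.bind_cost, newTable_cost]
  linarith

theorem nextTable_cost_le :
    (nextTable X).cost ≤ X.length * (3 * Nat.log 2 (X.length + 1) + 9) + 1 :=
  heapSort_bind_fillCell_cost_le X later_total later_trans fun x => (x.1, x.2 + 1)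

theorem prevTable_cost_le :
    (prevTable X).cost ≤ X.length * (3 * Nat.log 2 (X.length + 1) + 9) + 1 :=
  heapSort_bind_fillCell_cost_le X earlier_total earlier_trans fun x => (x.1, x.2 - 1)

end Tables

/-! ### Backward search -/

/-- Comparison of times, `none` being `-∞`. -/
def OptLe (a b : Option ℤ) : Prop := ∀ s, a = some s → ∃ s', b = some s' ∧ s ≤ s'

lemma OptLe.refl (a : Option ℤ) : OptLe a a := fun s h => ⟨s, h, le_rfl⟩

lemma OptLe.trans {a b c : Option ℤ} (hab : OptLe a b) (hbc : OptLe b c) : OptLe a c := by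
  intro s hs
  obtain ⟨s', hs', hle⟩ := hab s hs
  obtain ⟨s'', hs'', hle'⟩ := hbc s' hs'
  exact ⟨s'', hs'', hle.trans hle'⟩

section Search

variable {p : ℕ} (G : SCG p) (best : Fin p → ℤ → Timed (Option ℤ))

/-- The treatment of the parent `P` of a vertex at time `s` in the backward search. -/
def relax (s : ℤ) (σ : SearchState p) (P : Fin p) : Timed (SearchState p) := do
  let b ← σ.seen.get P
  if b then pure σ
  else
    let τ ← best P s
    let val ← σ.val.set P τ
    let seen ← σ.seen.set P true
    match τ with
    | none => pure ⟨σ.queue, seen, val⟩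
    | some τ => do
      let Q ← σ.queue.insert later (P, τ)
      pure ⟨Q, seen, val⟩

lemma search_succ (k : ℕ) (σ : SearchState p) :
    search G best (k + 1) σ = (do
      step
      match ← σ.queue.pop later with
      | none => pure σ.val
      | some (u, Q) => do
        let σ ← forEach (G.pa u.1) (⟨Q, σ.seen, σ.val⟩ : SearchState p) (relax best u.2)
        search G best k σ) := rfl

section Relax

variable {best} {s : ℤ} {σ : SearchState p} {P : Fin p}

lemma relax_of_seen (h : σ.seen P = true) : (relax best s σ P).val = σ := by
  simp [relax, h]

lemma seen_relax (h : σ.seen P = false) :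
    (relax best s σ P).val.seen = σ.seen.update P true := by
  cases hb : (best P s).val <;> simp [relax, h, hb]

lemma val_relax (h : σ.seen P = false) :
    (relax best s σ P).val.val = σ.val.update P (best P s).val := by
  cases hb : (best P s).val <;> simp [relax, h, hb]

lemma elems_queue_relax (h : σ.seen P = false) :
    (relax best s σ P).val.queue.elems =
      ((best P s).val.elim 0 fun τ => {(P, τ)}) + σ.queue.elems := by
  cases hb : (best P s).val <;> simp [relax, h, hb, Heap.elems_insert]

lemma mem_queue_relax (h : σ.seen P = false) {w : Fin p × ℤ} :
    w ∈ (relax best s σ P).val.queue.elems ↔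
      (w.1 = P ∧ (best P s).val = some w.2) ∨ w ∈ σ.queue.elems := by
  rw [elems_queue_relax h, Multiset.mem_add]
  cases (best P s).val <;> simp [Prod.ext_iff, eq_comm]

lemma ordered_queue_relax (h : σ.queue.Ordered later) :
    (relax best s σ P).val.queue.Ordered later := by
  cases hs : σ.seen P <;> cases hb : (best P s).val <;>
    simp [relax, hs, hb, h, h.insert later_total later_trans]

lemma leftist_queue_relax (h : σ.queue.Leftist) : (relax best s σ P).val.queue.Leftist := by
  cases hs : σ.seen P <;> cases hb : (best P s).val <;>
    simp [relax, hs, hb, h, h.insert]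

end Relax

/-- The weighted number of the vertices in the queue and of the unseen series; for the weight `1`
it bounds the number of rounds that are left. -/
def SearchState.potential (w : Fin p → ℕ) (σ : SearchState p) : ℕ :=
  (σ.queue.elems.map fun u => w u.1).sum + ∑ P, if σ.seen P then 0 else w P

lemma card_queue_le_potential (σ : SearchState p) :
    σ.queue.elems.card ≤ σ.potential 1 := by
  simp [SearchState.potential]

lemma sum_unmarked_update (w : Fin p → ℕ) {seen : Arr (Fin p) Bool} {P : Fin p}
    (h : seen P = false) :
    (∑ Q, if seen.update P true Q then 0 else w Q) + w P = ∑ Q, if seen Q then 0 else w Q := by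
  rw [← Finset.sum_erase_add Finset.univ _ (Finset.mem_univ P),
    ← Finset.sum_erase_add Finset.univ (fun Q => if seen Q then 0 else w Q) (Finset.mem_univ P)]
  simp only [Arr.update_self, if_true, h, add_zero, Bool.false_eq_true, if_false]
  congr 1
  refine Finset.sum_congr rfl fun Q hQ => ?_
  rw [Arr.update_of_ne (Finset.ne_of_mem_erase hQ)]

lemma potential_relax_le (w : Fin p → ℕ) (s : ℤ) (σ : SearchState p) (P : Fin p) :
    (relax best s σ P).val.potential w ≤ σ.potential w := by
  cases h : σ.seen P with
  | true => rw [relax_of_seen h]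
  | false =>
    have hunseen := sum_unmarked_update w h
    simp only [SearchState.potential, seen_relax h, elems_queue_relax h, Multiset.map_add,
      Multiset.sum_add]
    cases (best P s).val <;> simp <;> omega

lemma potential_of_pop {w : Fin p → ℕ} {σ : SearchState p} {u : Fin p × ℤ}
    {Q : Heap (Fin p × ℤ)} (hp : (σ.queue.pop later).val = some (u, Q)) :
    σ.potential w = w u.1 + (⟨Q, σ.seen, σ.val⟩ : SearchState p).potential w := by
  simp only [SearchState.potential, Heap.elems_of_pop hp, Multiset.map_cons, Multiset.sum_cons]
  ring

theorem search_inv (I : SearchState p → Prop)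
    (hI : ∀ σ u Q, I σ → (σ.queue.pop later).val = some (u, Q) →
      I (forEach (G.pa u.1) (⟨Q, σ.seen, σ.val⟩ : SearchState p) (relax best u.2)).val)
    (k : ℕ) (σ : SearchState p) (hσ : I σ) (hk : σ.potential 1 ≤ k) :
    ∃ σ' : SearchState p, I σ' ∧ σ'.queue.elems = 0 ∧ (search G best k σ).val = σ'.val := by
  induction k generalizing σ with
  | zero =>
    exact ⟨σ, hσ, Multiset.card_eq_zero.1
      (Nat.le_zero.1 ((card_queue_le_potential σ).trans hk)), rfl⟩
  | succ k ih =>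
    rw [search_succ]
    simp only [Timed.bind_val]
    rcases hp : (σ.queue.pop later).val with _ | ⟨u, Q⟩
    · exact ⟨σ, hσ, (Heap.pop_eq_none_iff _ _).1 hp, rfl⟩
    · have hround := forEach_inv
        (fun σ' : SearchState p =>
          σ'.potential 1 ≤ (⟨Q, σ.seen, σ.val⟩ : SearchState p).potential 1)
        (relax best u.2) (G.pa u.1) _ le_rfl
        fun P _ s hs => (potential_relax_le best 1 u.2 s P).trans hs
      rw [potential_of_pop hp, Pi.one_apply] at hk
      exact ih _ (hI σ u Q hσ hp) (by omega)

/-- Everything that the search records satisfies a property `V` that passes to the parents;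
`R` is the weaker property of the vertices in the queue, which include the initial one. -/
theorem search_sound {R V : Fin p × ℤ → Prop} (hVR : ∀ u, V u → R u)
    (hstep : ∀ u, R u → ∀ P ∈ G.pa u.1, ∀ b, (best P u.2).val = some b → V (P, b))
    (k : ℕ) (σ : SearchState p) (hQ : ∀ u ∈ σ.queue.elems, R u)
    (hv : ∀ P b, σ.val P = some b → V (P, b)) (hk : σ.potential 1 ≤ k) :
    ∀ P b, (search G best k σ).val P = some b → V (P, b) := by
  let I (σ : SearchState p) : Prop :=
    (∀ u ∈ σ.queue.elems, R u) ∧ ∀ P b, σ.val P = some b → V (P, b)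
  obtain ⟨σ', hσ', -, hval⟩ := search_inv G best I (fun σ u Q hσ hp => by
    have hpop := Heap.elems_of_pop hp
    have hu : R u := hσ.1 u (by simp [hpop])
    refine forEach_inv I _ _ _ ⟨fun w hw => hσ.1 w (by simp [hpop, hw]), hσ.2⟩ fun P hP s hs => ?_
    cases h : s.seen P with
    | true => rwa [relax_of_seen h]
    | false =>
      refine ⟨fun w hw => ?_, fun P' b hb => ?_⟩
      · rcases (mem_queue_relax h).1 hw with ⟨rfl, hb⟩ | hw
        · exact hVR _ (hstep u hu _ hP _ hb)
        · exact hs.1 w hw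
      · rw [val_relax h] at hb
        by_cases hPP : P' = P
        · subst hPP
          rw [Arr.update_self] at hb
          exact hstep u hu _ hP _ hb
        · rw [Arr.update_of_ne hPP] at hb
          exact hs.2 P' b hb) k σ ⟨hQ, hv⟩ hk
  rw [hval]
  exact hσ'.2

namespace SearchState

/-- The parents of `u` are seen, at times that are best possible for `u`. -/
def Treats (σ : SearchState p) (u : Fin p × ℤ) : Prop :=
  ∀ P ∈ G.pa u.1, σ.seen P = true ∧ OptLe (best P u.2).val (σ.val P)

/-- The invariant of the search from `v` that makes the recorded times maximal. -/
structure Invariant (v : Fin p × ℤ) (σ : SearchState p) : Prop where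
  ordered : σ.queue.Ordered later
  bound : ∀ u ∈ σ.queue.elems, ∀ P, σ.seen P = true → OptLe (best P u.2).val (σ.val P)
  seen : ∀ P b, σ.val P = some b → σ.seen P = true
  treated : ∀ u, (u = v ∨ σ.val u.1 = some u.2) → u ∈ σ.queue.elems ∨ σ.Treats G best u

/-- The form that `Invariant` takes during the round of `u`, after the parents in `pre`. -/
structure RoundInvariant (v u : Fin p × ℤ) (pre : List (Fin p)) (σ : SearchState p) : Prop where
  ordered : σ.queue.Ordered later
  queue_le : ∀ w ∈ σ.queue.elems, w.2 ≤ u.2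
  bound : ∀ P, σ.seen P = true → OptLe (best P u.2).val (σ.val P)
  seen : ∀ P b, σ.val P = some b → σ.seen P = true
  treated : ∀ w, (w = v ∨ σ.val w.1 = some w.2) →
    w = u ∨ w ∈ σ.queue.elems ∨ σ.Treats G best w
  seen_pre : ∀ P ∈ pre, σ.seen P = true

variable {G best} {v u : Fin p × ℤ} {σ : SearchState p}

lemma Invariant.roundInvariant (hσ : σ.Invariant G best v) {Q : Heap (Fin p × ℤ)}
    (hp : (σ.queue.pop later).val = some (u, Q)) :
    RoundInvariant G best v u [] ⟨Q, σ.seen, σ.val⟩ where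
  ordered := hσ.ordered.of_pop later_total later_trans hp
  queue_le w hw := of_decide_eq_true (Heap.before_of_pop hσ.ordered hp w hw)
  bound := hσ.bound u (by simp [Heap.elems_of_pop hp])
  seen := hσ.seen
  treated w hw := by
    have h := hσ.treated w hw
    rwa [Heap.elems_of_pop hp, Multiset.mem_cons, or_assoc] at h
  seen_pre := by simp

lemma Treats.relax {s : ℤ} {P : Fin p} (h : σ.seen P = false) (hu : σ.Treats G best u) :
    (relax best s σ P).val.Treats G best u := fun P' hP' => by
  obtain ⟨hseen, hle⟩ := hu P' hP'
  have hne : P' ≠ P := fun heq => by simp [← heq, hseen] at h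
  rw [seen_relax h, val_relax h, Arr.update_of_ne hne, Arr.update_of_ne hne]
  exact ⟨hseen, hle⟩

lemma RoundInvariant.relax (hle : ∀ P s b, (best P s).val = some b → b ≤ s)
    {pre : List (Fin p)} (hσ : σ.RoundInvariant G best v u pre) (P : Fin p) :
    (relax best u.2 σ P).val.RoundInvariant G best v u (pre ++ [P]) := by
  cases h : σ.seen P with
  | true =>
    rw [relax_of_seen h]
    exact { hσ with seen_pre := by simpa [or_imp, forall_and, h] using hσ.seen_pre }
  | false =>
    refine ⟨ordered_queue_relax hσ.ordered, fun w hw => ?_, fun P' hP' => ?_, fun P' b hb => ?_,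
      fun w hw => ?_, fun P' hP' => ?_⟩
    · rcases (mem_queue_relax h).1 hw with ⟨-, hb⟩ | hw
      · exact hle _ _ _ hb
      · exact hσ.queue_le w hw
    · rw [seen_relax h] at hP'
      rw [val_relax h]
      by_cases hPP : P' = P
      · rw [hPP, Arr.update_self]
        exact OptLe.refl _
      · rw [Arr.update_of_ne hPP] at hP' ⊢
        exact hσ.bound P' hP'
    · rw [val_relax h] at hb
      rw [seen_relax h]
      by_cases hPP : P' = P
      · rw [hPP, Arr.update_self]
      · rw [Arr.update_of_ne hPP] at hb ⊢
        exact hσ.seen P' b hb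
    · rw [val_relax h] at hw
      by_cases hnew : w.1 = P ∧ (best P u.2).val = some w.2
      · exact Or.inr (Or.inl ((mem_queue_relax h).2 (Or.inl hnew)))
      · have hold : w = v ∨ σ.val w.1 = some w.2 := hw.imp_right fun hw => by
          by_cases hwP : w.1 = P
          · rw [hwP, Arr.update_self] at hw
            exact absurd ⟨hwP, hw⟩ hnew
          · rwa [Arr.update_of_ne hwP] at hw
        exact (hσ.treated w hold).imp_right
          (Or.imp (fun hw => (mem_queue_relax h).2 (Or.inr hw)) (Treats.relax h))
    · rw [seen_relax h]
      by_cases hPP : P' = P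
      · rw [hPP, Arr.update_self]
      · rw [Arr.update_of_ne hPP]
        exact hσ.seen_pre P' (by simpa [hPP] using hP')

lemma RoundInvariant.invariant (hmono : ∀ P s s', s ≤ s' → OptLe (best P s).val (best P s').val)
    (hσ : σ.RoundInvariant G best v u (G.pa u.1)) : σ.Invariant G best v where
  ordered := hσ.ordered
  bound w hw P hP := (hmono P _ _ (hσ.queue_le w hw)).trans (hσ.bound P hP)
  seen := hσ.seen
  treated w hw := by
    rcases hσ.treated w hw with rfl | h
    · exact Or.inr fun P hP => ⟨hσ.seen_pre P hP, hσ.bound P (hσ.seen_pre P hP)⟩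
    · exact h

end SearchState

theorem search_complete (hle : ∀ P s b, (best P s).val = some b → b ≤ s)
    (hmono : ∀ P s s', s ≤ s' → OptLe (best P s).val (best P s').val)
    {v : Fin p × ℤ} (k : ℕ) (σ : SearchState p) (hσ : σ.Invariant G best v)
    (hk : σ.potential 1 ≤ k) :
    ∀ u : Fin p × ℤ, (u = v ∨ (search G best k σ).val u.1 = some u.2) →
      ∀ P ∈ G.pa u.1, OptLe (best P u.2).val ((search G best k σ).val P) := by
  obtain ⟨σ', hσ', hempty, hval⟩ := search_inv G best (fun σ => σ.Invariant G best v)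
    (fun σ u Q hσ hp => (forEach_prefix_inv (SearchState.RoundInvariant G best v u) _ _ _
      (hσ.roundInvariant hp) fun _ P _ _ hs => hs.relax hle P).invariant hmono) k σ hσ hk
  rw [hval]
  intro u hu P hP
  rcases hσ'.treated u hu with h | h
  · simp [hempty] at h
  · exact (h P hP).2

end Search

/-! ### Ancestor times and times of accessibility -/

section TimeEdges

variable {V : Type*}

/-- The edges that a candidate full-time graph may have. -/
def TimeEdge (E : V → V → Prop) (u w : V × ℤ) : Prop := E u.1 w.1 ∧ u.2 ≤ w.2

/-- A possible edge that leaves a vertex of `A`; thus a walk along such edges has all its vertices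
but the last one in `A`. -/
def TimeEdgeFrom (E : V → V → Prop) (A : Set (V × ℤ)) (u w : V × ℤ) : Prop :=
  TimeEdge E u w ∧ u ∈ A

lemma TimeEdgeFrom.mono {E : V → V → Prop} {A B : Set (V × ℤ)} (h : A ⊆ B) {u w : V × ℤ}
    (huw : TimeEdgeFrom E A u w) : TimeEdgeFrom E B u w := ⟨huw.1, h huw.2⟩

lemma TimeEdgeFrom.time_le {E : V → V → Prop} {A : Set (V × ℤ)} {u w : V × ℤ}
    (h : ReflTransGen (TimeEdgeFrom E A) u w) : u.2 ≤ w.2 := by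
  induction h with
  | refl => exact le_rfl
  | tail _ h ih => exact ih.trans h.1.2

end TimeEdges

section SearchSpec

variable {p : ℕ} (G : SCG p) (best : Fin p → ℤ → Timed (Option ℤ)) (A : Set (Fin p × ℤ))

/-- `best P s` is the largest time `≤ s` at which `P` is in `A`. -/
structure IsBestIn : Prop where
  mem : ∀ P s b, (best P s).val = some b → b ≤ s ∧ (P, b) ∈ A
  le : ∀ P s s₁, s₁ ≤ s → (P, s₁) ∈ A → ∃ b, (best P s).val = some b ∧ s₁ ≤ b

/-- `σ` is a state in which a search from `v` may start; `v` itself may be recorded or not. -/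
structure SearchState.IsInitial (v : Fin p × ℤ) (σ : SearchState p) : Prop where
  elems_queue : σ.queue.elems = {v}
  ordered : σ.queue.Ordered later
  eq_of_val : ∀ P b, σ.val P = some b → (P, b) = v
  seen_iff : ∀ P, σ.seen P = true ↔ ∃ b, σ.val P = some b

variable {best A}

lemma IsBestIn.mono (h : IsBestIn best A) (P : Fin p) (s s' : ℤ) (hs : s ≤ s') :
    OptLe (best P s).val (best P s').val := fun b hb =>
  h.le P s' b ((h.mem P s b hb).1.trans hs) (h.mem P s b hb).2

variable {v : Fin p × ℤ} {σ : SearchState p}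

lemma SearchState.isInitial_const (v : Fin p × ℤ) :
    SearchState.IsInitial v
      ⟨(Heap.leaf.insert later v).val, Arr.const false, Arr.const none⟩ where
  elems_queue := by rw [Heap.elems_insert]; rfl
  ordered := Heap.Ordered.insert later_total later_trans _ trivial
  eq_of_val := by simp
  seen_iff := by simp

lemma SearchState.isInitial_update (S : Fin p) (s : ℤ) :
    SearchState.IsInitial (S, s) ⟨(Heap.leaf.insert later (S, s)).val,
      (Arr.const false).update S true, (Arr.const none).update S (some s)⟩ where
  elems_queue := by rw [Heap.elems_insert]; rfl
  ordered := Heap.Ordered.insert later_total later_trans _ trivial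
  eq_of_val P b h := by
    by_cases hP : P = S
    · simp_all
    · simp [Arr.update_of_ne hP] at h
  seen_iff P := by
    by_cases hP : P = S
    · simp [hP]
    · simp [Arr.update_of_ne hP]

lemma SearchState.IsInitial.potential_le (hσ : σ.IsInitial v) (w : Fin p → ℕ) :
    σ.potential w ≤ w v.1 + ∑ P, w P := by
  rw [SearchState.potential, hσ.elems_queue, Multiset.map_singleton, Multiset.sum_singleton]
  gcongr with P
  split <;> simp

lemma SearchState.IsInitial.potential_one_le (hσ : σ.IsInitial v) : σ.potential 1 ≤ p + 2 := by
  have h := hσ.potential_le 1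
  simp only [Pi.one_apply, Finset.sum_const, Finset.card_univ, Fintype.card_fin, smul_eq_mul,
    mul_one] at h
  omega

lemma SearchState.IsInitial.invariant (hb : IsBestIn best A) (hσ : σ.IsInitial v) :
    σ.Invariant G best v where
  ordered := hσ.ordered
  bound u hu P hP s hs := by
    rw [hσ.elems_queue, Multiset.mem_singleton] at hu
    obtain ⟨b, hPb⟩ := (hσ.seen_iff P).1 hP
    rw [hu, ← hσ.eq_of_val P b hPb] at hs
    exact ⟨b, hPb, (hb.mem _ _ _ hs).1⟩
  seen P b h := (hσ.seen_iff P).2 ⟨b, h⟩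
  treated u hu := by
    rw [hσ.elems_queue, Multiset.mem_singleton]
    exact Or.inl (hu.elim id (hσ.eq_of_val _ _))

lemma search_val_of_seen (hσ : σ.IsInitial v) {S : Fin p} (hS : σ.seen S = true) :
    (search G best (p + 2) σ).val S = σ.val S := by
  let I (s : SearchState p) : Prop := s.seen S = true ∧ s.val S = σ.val S
  obtain ⟨σ', hσ', -, hval⟩ := search_inv G best I (fun s u Q hs _ =>
    forEach_inv I _ _ _ hs fun P _ s hs => by
      cases h : s.seen P with
      | true => rwa [relax_of_seen h]
      | false =>
        have hne : S ≠ P := fun heq => by simp [← heq, hs.1] at h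
        change _ ∧ _
        rw [seen_relax h, val_relax h, Arr.update_of_ne hne, Arr.update_of_ne hne]
        exact hs) (p + 2) σ ⟨hS, rfl⟩ hσ.potential_one_le
  rw [hval, hσ'.2]

theorem search_sound_walk (hb : IsBestIn best A) (hσ : σ.IsInitial v) {P : Fin p} {b : ℤ}
    (h : (search G best (p + 2) σ).val P = some b) :
    σ.val P = some b ∨ TransGen (TimeEdgeFrom G.Edge A) (P, b) v := by
  refine search_sound G best (R := fun u => ReflTransGen (TimeEdgeFrom G.Edge A) u v)
    (V := fun u => σ.val u.1 = some u.2 ∨ TransGen (TimeEdgeFrom G.Edge A) u v)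
    ?_ ?_ (p + 2) σ ?_ (fun P b => Or.inl) hσ.potential_one_le P b h
  · rintro u (hu | hu)
    · obtain rfl : u = v := hσ.eq_of_val _ _ hu
      exact ReflTransGen.refl
    · exact hu.to_reflTransGen
  · intro u hu P hP b hPb
    obtain ⟨hbu, hA⟩ := hb.mem P u.2 b hPb
    exact Or.inr (TransGen.head' ⟨⟨(G.mem_pa P u.1).1 hP, hbu⟩, hA⟩ hu)
  · intro u hu
    rw [hσ.elems_queue, Multiset.mem_singleton] at hu
    rw [hu]

theorem search_complete_walk (hb : IsBestIn best A) (hσ : σ.IsInitial v) {u : Fin p × ℤ}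
    (h : TransGen (TimeEdgeFrom G.Edge A) u v) :
    ∃ b, (search G best (p + 2) σ).val u.1 = some b ∧ u.2 ≤ b := by
  have hparent := search_complete G best (fun P s b h => (hb.mem P s b h).1) hb.mono (p + 2) σ
    (hσ.invariant G hb) hσ.potential_one_le
  induction h using TransGen.head_induction_on with
  | single h =>
    obtain ⟨b, hbest, hle⟩ := hb.le _ _ _ h.1.2 h.2
    obtain ⟨b', hval, hle'⟩ := hparent _ (Or.inl rfl) _ ((G.mem_pa _ _).2 h.1.1) b hbest
    exact ⟨b', hval, hle.trans hle'⟩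
  | @head a c h _ ih =>
    obtain ⟨τ, hτ, hcτ⟩ := ih
    obtain ⟨b, hbest, hle⟩ := hb.le a.1 τ a.2 (h.1.2.trans hcτ) h.2
    obtain ⟨b', hval, hle'⟩ := hparent (c.1, τ) (Or.inr hτ) _ ((G.mem_pa _ _).2 h.1.1) b hbest
    exact ⟨b', hval, hle.trans hle'⟩

end SearchSpec

section AncestorTimes

variable {p : ℕ} {G : SCG p} {X : List (Fin p × ℤ)} {prv : Table p} {Y : Fin p} {t : ℤ}

lemma IsPrevTable.isBestIn (hprv : IsPrevTable X prv) :
    IsBestIn (fun P s => do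
      let τ ← free prv P s
      pure (some τ)) {x | x ∈ X}ᶜ where
  mem P s b h := by
    simp only [Timed.bind_val, free_val, Timed.pure_val, Option.some.injEq] at h
    subst h
    exact (hprv.isGreatest P s).1
  le P s s₁ hs h := ⟨_, rfl, (hprv.isGreatest P s).2 ⟨hs, h⟩⟩

lemma ancestorTimes_val (G : SCG p) (prv : Table p) (Y : Fin p) (t : ℤ) :
    (ancestorTimes G prv Y t).val =
      (search G (fun P s => do
        let τ ← free prv P s
        pure (some τ)) (p + 2) ⟨(Heap.leaf.insert later (Y, t)).val,
          (Arr.const false).update Y true, (Arr.const none).update Y (some t)⟩).val := by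
  simp [ancestorTimes]

theorem ancestorTimes_sound (hprv : IsPrevTable X prv) {P : Fin p} {b : ℤ}
    (h : (ancestorTimes G prv Y t).val P = some b) :
    ReflTransGen (TimeEdgeFrom G.Edge {x | x ∈ X}ᶜ) (P, b) (Y, t) := by
  rw [ancestorTimes_val] at h
  have hinit := SearchState.isInitial_update Y t
  rcases search_sound_walk G hprv.isBestIn hinit h with h | h
  · rw [hinit.eq_of_val P b h]
  · exact h.to_reflTransGen

theorem ancestorTimes_complete (hprv : IsPrevTable X prv) {u : Fin p × ℤ}
    (h : ReflTransGen (TimeEdgeFrom G.Edge {x | x ∈ X}ᶜ) u (Y, t)) :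
    ∃ b, (ancestorTimes G prv Y t).val u.1 = some b ∧ u.2 ≤ b := by
  rw [ancestorTimes_val]
  have hinit := SearchState.isInitial_update Y t
  rcases reflTransGen_iff_eq_or_transGen.1 h with h | h
  · rw [← h, search_val_of_seen G hinit (Arr.update_self _ _ _)]
    exact ⟨t, Arr.update_self _ _ _, le_rfl⟩
  · exact search_complete_walk G hprv.isBestIn hinit h

end AncestorTimes

section AccessTimes

variable {p : ℕ} {G : SCG p} {X : List (Fin p × ℤ)} {prv : Table p}
  {T : Arr (Fin p) (Option ℤ)} {v : Fin p × ℤ}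

/-- The entrance time of `D` recorded in `T` is at most `s`. -/
def EnteredBy (T : Arr (Fin p) (Option ℤ)) (D : Fin p) (s : ℤ) : Prop := ∃ e, T D = some e ∧ e ≤ s

/-- The non-conditionable set given by the entrance times `T`. -/
def ncSet (X : List (Fin p × ℤ)) (T : Arr (Fin p) (Option ℤ)) : Set (Fin p × ℤ) :=
  {u | u ∉ X ∧ EnteredBy T u.1 u.2}

/-- The function `best` of the search for the times of accessibility to `v`. -/
def accessBest (prv : Table p) (T : Arr (Fin p) (Option ℤ)) (v : Fin p × ℤ) (P : Fin p)
    (s : ℤ) : Timed (Option ℤ) := do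
  let τ₀ ← free prv P s
  let τ ← if (P, τ₀) = v then free prv P (τ₀ - 1) else pure τ₀
  match ← T.get P with
  | none => pure none
  | some e => pure (if e ≤ τ then some τ else none)

/-- The last time `≤ s` at which `P` is neither intervened on nor equal to `v`. -/
def prevAvoiding (prv : Table p) (v : Fin p × ℤ) (P : Fin p) (s : ℤ) : ℤ :=
  if (P, (prv (P, s)).getD s) = v then
    (prv (P, (prv (P, s)).getD s - 1)).getD ((prv (P, s)).getD s - 1)
  else (prv (P, s)).getD s

lemma accessBest_val (prv : Table p) (T : Arr (Fin p) (Option ℤ)) (v : Fin p × ℤ) (P : Fin p)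
    (s : ℤ) : (accessBest prv T v P s).val = (T P).bind fun e =>
      if e ≤ prevAvoiding prv v P s then some (prevAvoiding prv v P s) else none := by
  unfold accessBest prevAvoiding
  rw [Timed.bind_val, free_val]
  cases he : T P with
  | none => split <;> simp [he]
  | some e =>
    split <;> simp only [Timed.bind_val, free_val, Timed.pure_val, Arr.get_val, he] <;> rfl

lemma accessBest_cost_le (prv : Table p) (T : Arr (Fin p) (Option ℤ)) (v : Fin p × ℤ)
    (P : Fin p) (s : ℤ) : (accessBest prv T v P s).cost ≤ 3 := by
  unfold accessBest
  rw [Timed.bind_cost, free_val]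
  split <;> cases he : T P <;> simp [he]

lemma IsPrevTable.isGreatest_prevAvoiding (hprv : IsPrevTable X prv) (v : Fin p × ℤ)
    (P : Fin p) (s : ℤ) :
    IsGreatest {s₁ | s₁ ≤ s ∧ (P, s₁) ∉ X ∧ (P, s₁) ≠ v} (prevAvoiding prv v P s) := by
  have hlast := hprv.isGreatest P s
  unfold prevAvoiding
  split
  next hv =>
    have hlast' := hprv.isGreatest P ((prv (P, s)).getD s - 1)
    have hlt := Int.lt_of_le_sub_one hlast'.1.1
    refine ⟨⟨hlt.le.trans hlast.1.1, hlast'.1.2, fun h => hlt.ne ?_⟩,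
      fun s' hs' => hlast'.2 ⟨Int.le_sub_one_of_lt ?_, hs'.2.1⟩⟩
    · exact congrArg Prod.snd (h.trans hv.symm)
    · exact (hlast.2 ⟨hs'.1, hs'.2.1⟩).lt_of_ne fun h => hs'.2.2 (h ▸ hv)
  next hv => exact ⟨⟨hlast.1.1, hlast.1.2, hv⟩, fun s' hs' => hlast.2 ⟨hs'.1, hs'.2.1⟩⟩

lemma IsPrevTable.isBestIn_accessBest (hprv : IsPrevTable X prv) :
    IsBestIn (accessBest prv T v) (ncSet X T \ {v}) where
  mem P s b h := by
    have hprev := (hprv.isGreatest_prevAvoiding v P s).1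
    simp only [accessBest_val, Option.bind_eq_some_iff, Option.ite_none_right_eq_some,
      Option.some.injEq] at h
    obtain ⟨e, he, hle, rfl⟩ := h
    exact ⟨hprev.1, ⟨hprev.2.1, e, he, hle⟩, hprev.2.2⟩
  le := by
    rintro P s s₁ hs ⟨⟨hX, e, he, hle⟩, hv⟩
    have hprev := (hprv.isGreatest_prevAvoiding v P s).2 ⟨hs, hX, hv⟩
    rw [accessBest_val, he]
    exact ⟨_, if_pos (hle.trans hprev), hprev⟩

theorem accessTimes_sound (hprv : IsPrevTable X prv) {P : Fin p} {b : ℤ}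
    (h : (accessTimes G prv T v).val P = some b) :
    TransGen (TimeEdgeFrom G.Edge (ncSet X T \ {v})) (P, b) v :=
  (search_sound_walk G hprv.isBestIn_accessBest (SearchState.isInitial_const v) h).resolve_left
    (by simp)

theorem accessTimes_complete (hprv : IsPrevTable X prv) {u : Fin p × ℤ}
    (h : TransGen (TimeEdgeFrom G.Edge (ncSet X T \ {v})) u v) :
    ∃ b, (accessTimes G prv T v).val u.1 = some b ∧ u.2 ≤ b :=
  search_complete_walk G hprv.isBestIn_accessBest (SearchState.isInitial_const v) h

end AccessTimes

/-! ### Forward search -/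

section Explore

variable {p : ℕ} (G : SCG p) (ok : Fin p → Timed Bool)

/-- The edges along which the forward search moves. -/
def OkEdge (u w : Fin p) : Prop := G.Edge u w ∧ (ok w).val = true

/-- The treatment of a child `w` of the expanded vertex in the forward search; the state is the
stack together with the marks. -/
def enter (σ : List (Fin p) × Arr (Fin p) Bool) (w : Fin p) :
    Timed (List (Fin p) × Arr (Fin p) Bool) := do
  let b ← σ.2.get w
  let c ← ok w
  if b || !c then pure σ
  else
    let vis ← σ.2.set w true
    pure (w :: σ.1, vis)

lemma explore_cons (k : ℕ) (v : Fin p) (stack : List (Fin p)) (vis : Arr (Fin p) Bool)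
    (acc : List (Fin p)) :
    explore G ok (k + 1) (v :: stack) vis acc = (do
      step
      let σ ← forEach (G.ch v) (stack, vis) (enter ok)
      explore G ok k σ.1 σ.2 (v :: acc)) := rfl

variable {ok}

lemma enter_val (σ : List (Fin p) × Arr (Fin p) Bool) (w : Fin p) :
    (enter ok σ w).val = if σ.2 w = false ∧ (ok w).val = true then (w :: σ.1, σ.2.update w true)
      else σ := by
  unfold enter
  rcases h : σ.2 w <;> rcases h' : (ok w).val <;> simp [h, h']

/-- The weighted number of vertices on the stack and of unmarked vertices: an upper bound for the
work still to be done by the forward search. -/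
def stackPotential (w : Fin p → ℕ) (σ : List (Fin p) × Arr (Fin p) Bool) : ℕ :=
  (σ.1.map w).sum + ∑ P, if σ.2 P then 0 else w P

lemma stackPotential_enter (w : Fin p → ℕ) (σ : List (Fin p) × Arr (Fin p) Bool) (v : Fin p) :
    stackPotential w (enter ok σ v).val = stackPotential w σ := by
  rw [enter_val]
  split
  next h =>
    have hsum := sum_unmarked_update w h.1
    simp only [stackPotential, List.map_cons, List.sum_cons]
    omega
  next => rfl

lemma stackPotential_forEach_enter (w : Fin p → ℕ) (l : List (Fin p))
    (σ : List (Fin p) × Arr (Fin p) Bool) :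
    stackPotential w (forEach l σ (enter ok)).val = stackPotential w σ :=
  forEach_inv (fun σ' => stackPotential w σ' = stackPotential w σ) _ _ _ rfl
    fun a _ s hs => (stackPotential_enter w s a).trans hs

lemma stackPotential_singleton_le (w : Fin p → ℕ) (C : Fin p) (vis : Arr (Fin p) Bool) :
    stackPotential w ([C], vis) ≤ w C + ∑ P, w P := by
  have hsum : (∑ P, if vis P then 0 else w P) ≤ ∑ P, w P :=
    Finset.sum_le_sum fun P _ => by split <;> simp
  simpa [stackPotential] using hsum

lemma stackPotential_one_singleton_le (C : Fin p) (vis : Arr (Fin p) Bool) :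
    stackPotential 1 ([C], vis) ≤ p + 1 := by
  simpa [add_comm] using stackPotential_singleton_le 1 C vis

variable (ok) in
lemma explore_inv (I : List (Fin p) → Arr (Fin p) Bool → List (Fin p) → Prop)
    (hI : ∀ v stack vis acc, I (v :: stack) vis acc →
      I (forEach (G.ch v) (stack, vis) (enter ok)).val.1
        (forEach (G.ch v) (stack, vis) (enter ok)).val.2 (v :: acc))
    (k : ℕ) (stack : List (Fin p)) (vis : Arr (Fin p) Bool) (acc : List (Fin p))
    (h : I stack vis acc) (hk : stackPotential 1 (stack, vis) ≤ k) :
    I [] (explore G ok k stack vis acc).val.1 (explore G ok k stack vis acc).val.2 := by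
  induction k generalizing stack vis acc with
  | zero =>
    cases stack with
    | nil => simpa [explore] using h
    | cons v stack => simp [stackPotential] at hk
  | succ k ih =>
    cases stack with
    | nil => simpa [explore] using h
    | cons v stack =>
      rw [explore_cons]
      refine ih _ _ _ (hI v stack vis acc h) ?_
      rw [Prod.mk.eta, stackPotential_forEach_enter]
      simp only [stackPotential, List.map_cons, List.sum_cons, Pi.one_apply] at hk ⊢
      omega

lemma marked_forEach_enter_iff (l stack : List (Fin p)) (vis : Arr (Fin p) Bool) (u : Fin p) :
    (forEach l (stack, vis) (enter ok)).val.2 u = true ↔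
      vis u = true ∨ u ∈ l ∧ (ok u).val = true := by
  refine forEach_prefix_inv (fun pre (σ : List (Fin p) × Arr (Fin p) Bool) =>
    σ.2 u = true ↔ vis u = true ∨ u ∈ pre ∧ (ok u).val = true) _ l (stack, vis) (by simp) ?_
  rintro pre a σ - hσ
  rw [enter_val]
  by_cases hu : u = a
  · subst hu
    split
    next h => simp [h.2]
    next h =>
      rcases hmark : σ.2 u <;> rcases hok : (ok u).val <;> simp_all
  · split <;> simp [Arr.update_of_ne hu, hσ, hu]

lemma mem_forEach_enter_iff (l stack : List (Fin p)) (vis : Arr (Fin p) Bool) (u : Fin p) :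
    u ∈ (forEach l (stack, vis) (enter ok)).val.1 ↔
      u ∈ stack ∨ (vis u = false ∧ u ∈ l ∧ (ok u).val = true) := by
  refine (forEach_prefix_inv (fun pre (σ : List (Fin p) × Arr (Fin p) Bool) =>
    (σ.2 u = true ↔ vis u = true ∨ u ∈ pre ∧ (ok u).val = true) ∧
    (u ∈ σ.1 ↔ u ∈ stack ∨ (vis u = false ∧ u ∈ pre ∧ (ok u).val = true)))
    _ l (stack, vis) (by simp) ?_).2
  rintro pre a σ - ⟨hmark, hmem⟩
  rw [enter_val]
  by_cases hu : u = a
  · subst hu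
    rcases hσ : σ.2 u <;> rcases hok : (ok u).val <;> rcases hvis : vis u <;> simp_all
  · split <;> simp [Arr.update_of_ne hu, hmark, hmem, hu]

variable (ok) in
/-- The invariant of the forward search from `C` started with the marks `vis`. -/
structure Explores (C : Fin p) (vis : Arr (Fin p) Bool) (stack : List (Fin p))
    (vis' : Arr (Fin p) Bool) (acc : List (Fin p)) : Prop where
  start : C ∈ stack ∨ C ∈ acc
  marked_iff : ∀ u, vis' u = true ↔ vis u = true ∨ u ∈ stack ∨ u ∈ acc
  reachable : ∀ u, u ∈ stack ∨ u ∈ acc → ReflTransGen (OkEdge G ok) C u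
  closed : ∀ u ∈ acc, ∀ w, OkEdge G ok u w → vis' w = true

lemma Explores.init (C : Fin p) (vis : Arr (Fin p) Bool) :
    Explores G ok C vis [C] (vis.update C true) [] where
  start := by simp
  marked_iff u := by
    by_cases hu : u = C
    · simp [hu]
    · simp [Arr.update_of_ne hu, hu]
  reachable u hu := by
    obtain rfl : u = C := by simpa using hu
    exact ReflTransGen.refl
  closed := by simp

variable {G} {C v : Fin p} {vis vis' : Arr (Fin p) Bool} {stack acc : List (Fin p)}

lemma Explores.expand (h : Explores G ok C vis (v :: stack) vis' acc) :
    Explores G ok C vis (forEach (G.ch v) (stack, vis') (enter ok)).val.1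
      (forEach (G.ch v) (stack, vis') (enter ok)).val.2 (v :: acc) where
  start := by
    have := h.start
    simp only [mem_forEach_enter_iff, List.mem_cons] at this ⊢
    tauto
  marked_iff u := by
    have := h.marked_iff u
    rw [marked_forEach_enter_iff, mem_forEach_enter_iff]
    cases hu : vis' u <;> simp only [hu, List.mem_cons] at this ⊢ <;> tauto
  reachable u hu := by
    have hv := h.reachable v (Or.inl List.mem_cons_self)
    have := h.reachable u
    simp only [mem_forEach_enter_iff, List.mem_cons] at this hu
    rcases hu with (hu | ⟨-, huv, huok⟩) | rfl | hu
    · exact this (Or.inl (Or.inr hu))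
    · exact hv.tail ⟨huv, huok⟩
    · exact hv
    · exact this (Or.inr hu)
  closed u hu w huw := by
    rw [marked_forEach_enter_iff]
    rcases List.mem_cons.1 hu with rfl | hu
    · exact Or.inr huw
    · exact Or.inl (h.closed u hu w huw)

lemma explores_explore (C : Fin p) (vis : Arr (Fin p) Bool) :
    Explores G ok C vis [] (explore G ok (p + 1) [C] (vis.update C true) []).val.1
      (explore G ok (p + 1) [C] (vis.update C true) []).val.2 :=
  explore_inv G ok (Explores G ok C vis) (fun _ _ _ _ h => h.expand) _ _ _ _
    (Explores.init G C vis) (stackPotential_one_singleton_le C _)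

lemma descendants_val_of_not (h : ¬ (vis C = false ∧ (ok C).val = true)) :
    (descendants G ok C vis).val = (vis, []) := by
  unfold descendants
  rcases hvis : vis C <;> rcases hok : (ok C).val <;> simp_all

lemma descendants_val_of (hvis : vis C = false) (hok : (ok C).val = true) :
    (descendants G ok C vis).val = (explore G ok (p + 1) [C] (vis.update C true) []).val := by
  unfold descendants
  simp [hvis, hok]

lemma marked_descendants_iff (u : Fin p) :
    (descendants G ok C vis).val.1 u = true ↔
      vis u = true ∨ u ∈ (descendants G ok C vis).val.2 := by
  by_cases h : vis C = false ∧ (ok C).val = true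
  · simpa [descendants_val_of h.1 h.2] using (explores_explore C vis).marked_iff u
  · simp [descendants_val_of_not h]

lemma reflTransGen_of_mem_descendants {u : Fin p} (hu : u ∈ (descendants G ok C vis).val.2) :
    (ok C).val = true ∧ ReflTransGen (OkEdge G ok) C u := by
  by_cases h : vis C = false ∧ (ok C).val = true
  · rw [descendants_val_of h.1 h.2] at hu
    exact ⟨h.2, (explores_explore C vis).reachable u (Or.inr hu)⟩
  · simp [descendants_val_of_not h] at hu

lemma descendants_closed (hvis : ∀ u w, vis u = true → OkEdge G ok u w → vis w = true)
    (u w : Fin p) (hu : (descendants G ok C vis).val.1 u = true) (huw : OkEdge G ok u w) :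
    (descendants G ok C vis).val.1 w = true := by
  rcases (marked_descendants_iff u).1 hu with hu | hu
  · exact (marked_descendants_iff w).2 (Or.inl (hvis u w hu huw))
  by_cases h : vis C = false ∧ (ok C).val = true
  · rw [descendants_val_of h.1 h.2] at hu ⊢
    exact (explores_explore C vis).closed u hu w huw
  · simp [descendants_val_of_not h] at hu

theorem marked_descendants_of_reflTransGen
    (hvis : ∀ u w, vis u = true → OkEdge G ok u w → vis w = true) (hC : (ok C).val = true)
    {D : Fin p} (hD : ReflTransGen (OkEdge G ok) C D) :
    (descendants G ok C vis).val.1 D = true := by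
  induction hD with
  | refl =>
    cases h : vis C with
    | true => exact (marked_descendants_iff C).2 (Or.inl h)
    | false =>
      rw [marked_descendants_iff, descendants_val_of h hC]
      exact Or.inr ((explores_explore C vis).start.resolve_left (by simp))
  | tail _ h ih => exact descendants_closed hvis _ _ ih h

end Explore

/-! ### Entrance times -/

section OptMin

/-- `o` is the minimum of `S`, where `none` stands for `+∞`, the minimum of the empty set. -/
def IsOptMin (S : Set ℤ) : Option ℤ → Prop
  | none => S = ∅
  | some m => IsLeast S m

variable {S T : Set ℤ} {a b : Option ℤ}

lemma IsOptMin.optMin (ha : IsOptMin S a) (hb : IsOptMin T b) :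
    IsOptMin (S ∪ T) (optMin a b) := by
  rcases a with _ | a <;> rcases b with _ | b <;>
    simp only [IsOptMin, CommonAdjustment.optMin] at ha hb ⊢
  · simp [ha, hb]
  · simpa [ha] using hb
  · simpa [hb] using ha
  · exact ha.union hb

lemma IsOptMin.eq_some_of_mem (ha : IsOptMin S a) {s : ℤ} (hs : s ∈ S) :
    ∃ m, a = some m ∧ IsLeast S m := by
  cases a with
  | none => exact absurd hs (by rw [show S = ∅ from ha]; exact Set.notMem_empty s)
  | some m => exact ⟨m, rfl, ha⟩

end OptMin

section Entries

variable {p : ℕ} {G : SCG p} {X : List (Fin p × ℤ)} {nxt : Table p}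

lemma isOptMin_firstTimes (X : List (Fin p × ℤ)) (S : Fin p) :
    IsOptMin {s | (S, s) ∈ X} ((firstTimes X).val S) := by
  refine forEach_prefix_inv (fun pre (A : Arr (Fin p) (Option ℤ)) =>
    IsOptMin {s | (S, s) ∈ pre} (A S)) _ X (Arr.const none) (by simp [IsOptMin]) ?_
  rintro pre a A - hA
  simp only [Timed.bind_val, Arr.get_val, Arr.set_val]
  by_cases hS : S = a.1
  · subst hS
    have hunion : {s | (a.1, s) ∈ pre ++ [a]} = {s | (a.1, s) ∈ pre} ∪ {a.2} := by
      ext s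
      simp [Prod.ext_iff, or_comm]
    rw [Arr.update_self, hunion]
    exact hA.optMin isLeast_singleton
  · rw [Arr.update_of_ne hS]
    convert hA using 3 with s
    simp [Prod.ext_iff, hS]

/-- The computation of `t_min` for the series `C`. -/
def earliestParentTime (G : SCG p) (first : Arr (Fin p) (Option ℤ)) (C : Fin p) :
    Timed (Option ℤ) :=
  forEach (G.pa C) none fun m x => do
    let r ← first.get x
    pure (optMin m r)

/-- The computation of the list of the parents of `C` that are intervened on at time `s`. -/
def simultaneousParents (G : SCG p) (nxt : Table p) (C : Fin p) (s : ℤ) :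
    Timed (List (Fin p)) :=
  forEach (G.pa C) [] fun l x => do
    let r ← nxt.get (x, s)
    pure (if r.isSome then x :: l else l)

/-- The body of the loop that collects the entries. -/
def entryStep (G : SCG p) (nxt : Table p) (first anc : Arr (Fin p) (Option ℤ))
    (L : List (Entry p)) (C : Fin p) : Timed (List (Entry p)) := do
  let tmin ← earliestParentTime G first C
  let a ← anc.get C
  match tmin, a with
  | some tmin, some a => do
    let tC ← free nxt C tmin
    if a < tC then pure L
    else
      let simul ← simultaneousParents G nxt C tC
      let d := decide (tmin < tC) || decide (2 ≤ simul.length)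
      pure (⟨C, tC, if d then none else simul.head?⟩ :: L)
  | _, _ => pure L

lemma entries_eq (first anc : Arr (Fin p) (Option ℤ)) :
    entries G nxt first anc = forEach (List.finRange p) [] (entryStep G nxt first anc) := rfl

lemma isOptMin_earliestParentTime (G : SCG p) (X : List (Fin p × ℤ)) (C : Fin p) :
    IsOptMin {s | ∃ x, (x, s) ∈ X ∧ G.Edge x C}
      (earliestParentTime G (firstTimes X).val C).val := by
  have hpa : {s | ∃ x, (x, s) ∈ X ∧ G.Edge x C} = {s | ∃ x, (x, s) ∈ X ∧ x ∈ G.pa C} := by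
    ext s
    simp only [G.mem_pa, SCG.Edge]
  rw [hpa]
  refine forEach_prefix_inv (fun pre (m : Option ℤ) => IsOptMin {s | ∃ x, (x, s) ∈ X ∧ x ∈ pre} m)
    _ (G.pa C) none (by simp [IsOptMin]) ?_
  rintro pre a m - hm
  have hunion : {s | ∃ x, (x, s) ∈ X ∧ x ∈ pre ++ [a]} =
      {s | ∃ x, (x, s) ∈ X ∧ x ∈ pre} ∪ {s | (a, s) ∈ X} := by
    ext s
    simp [and_or_left, exists_or]
  rw [hunion]
  exact hm.optMin (isOptMin_firstTimes X a)

lemma IsNextTable.of_mem_simultaneousParents (hnxt : IsNextTable X nxt) {C x : Fin p} {s : ℤ}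
    (hx : x ∈ (simultaneousParents G nxt C s).val) : (x, s) ∈ X ∧ G.Edge x C := by
  revert x
  refine forEach_inv (fun m : List (Fin p) => ∀ {x}, x ∈ m → (x, s) ∈ X ∧ G.Edge x C) _ _ []
    (by simp) ?_
  intro a ha m hm x hx
  simp only [Timed.bind_val, Timed.pure_val, Arr.get_val] at hx
  by_cases hsome : (nxt (a, s)).isSome
  · replace hx : x ∈ a :: m := by simpa [hsome] using hx
    rcases List.mem_cons.1 hx with rfl | hx
    · exact ⟨(hnxt.isSome_iff _).1 hsome, (G.mem_pa _ _).1 ha⟩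
    · exact hm hx
  · replace hx : x ∈ m := by simpa [hsome] using hx
    exact hm hx

/-- The times at which `C` is not intervened on but not earlier than an intervention on one of
its parents. -/
def entryTimes (G : SCG p) (X : List (Fin p × ℤ)) (C : Fin p) : Set ℤ :=
  {c | (C, c) ∉ X ∧ ∃ x ∈ X, x.2 ≤ c ∧ G.Edge x.1 C}

lemma IsNextTable.isLeast_entryTimes (hnxt : IsNextTable X nxt) {C : Fin p} {tmin : ℤ}
    (hmin : IsLeast {s | ∃ x, (x, s) ∈ X ∧ G.Edge x C} tmin) :
    IsLeast (entryTimes G X C) (free nxt C tmin).val := by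
  obtain ⟨⟨x, hx, hxC⟩, hlow⟩ := hmin
  obtain ⟨⟨hle, hC⟩, hlow'⟩ := hnxt.isLeast C tmin
  refine ⟨⟨hC, (x, tmin), hx, hle, hxC⟩, ?_⟩
  rintro c ⟨hc, x', hx', hle', hxC'⟩
  exact hlow' ⟨(hlow ⟨x'.1, hx', hxC'⟩).trans hle', hc⟩

/-- The properties of an entry on which the correctness of the entrance times rests; of the flag
`d(C)` one only needs that a skipped series is a parent of `C` intervened on at time `t_C`. -/
structure Entry.IsValid (G : SCG p) (X : List (Fin p × ℤ)) (anc : Arr (Fin p) (Option ℤ))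
    (e : Entry p) : Prop where
  isLeast : IsLeast (entryTimes G X e.C) e.time
  le_anc : ∃ a, anc e.C = some a ∧ e.time ≤ a
  skip_mem : ∀ x, e.skip = some x → (x, e.time) ∈ X ∧ G.Edge x e.C

lemma entryStep_val (hnxt : IsNextTable X nxt) (anc : Arr (Fin p) (Option ℤ))
    (L : List (Entry p)) (C : Fin p) :
    ((entryStep G nxt (firstTimes X).val anc L C).val = L ∧
      ∀ c ∈ entryTimes G X C, ∀ a, anc C = some a → a < c) ∨
    ∃ e : Entry p, (entryStep G nxt (firstTimes X).val anc L C).val = e :: L ∧ e.C = C ∧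
      e.IsValid G X anc := by
  have hmin := isOptMin_earliestParentTime G X C
  unfold entryStep
  simp only [Timed.bind_val, Arr.get_val]
  cases htmin : (earliestParentTime G (firstTimes X).val C).val with
  | none =>
    refine Or.inl ⟨rfl, ?_⟩
    rintro c ⟨-, x, hx, -, hxC⟩
    obtain ⟨m, hm, -⟩ := hmin.eq_some_of_mem ⟨x.1, hx, hxC⟩
    simp [htmin] at hm
  | some tmin =>
    rw [htmin] at hmin
    have hleast := hnxt.isLeast_entryTimes hmin
    cases ha : anc C with
    | none => exact Or.inl ⟨rfl, by simp⟩
    | some a =>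
      simp only [Timed.bind_val]
      by_cases hlt : a < (free nxt C tmin).val
      · rw [if_pos hlt]
        refine Or.inl ⟨rfl, fun c hc a' ha' => ?_⟩
        obtain rfl : a = a' := Option.some.inj ha'
        exact hlt.trans_le (hleast.2 hc)
      · rw [if_neg hlt]
        refine Or.inr ⟨_, rfl, rfl, hleast, ⟨a, ha, not_lt.1 hlt⟩, fun x hx => ?_⟩
        simp only [Option.ite_none_left_eq_some] at hx
        exact hnxt.of_mem_simultaneousParents (List.mem_of_mem_head? hx.2)

lemma IsNextTable.isValid_of_mem_entries (hnxt : IsNextTable X nxt)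
    {anc : Arr (Fin p) (Option ℤ)} :
    ∀ e ∈ (entries G nxt (firstTimes X).val anc).val, e.IsValid G X anc := by
  rw [entries_eq]
  refine forEach_inv (fun L => ∀ e ∈ L, Entry.IsValid G X anc e) _ _ [] (by simp) ?_
  intro C _ L hL
  rcases entryStep_val (G := G) hnxt anc L C with ⟨heq, -⟩ | ⟨e, heq, -, he⟩
  · rwa [heq]
  · rw [heq]
    exact List.forall_mem_cons.2 ⟨he, hL⟩

lemma IsNextTable.exists_mem_entries (hnxt : IsNextTable X nxt) {anc : Arr (Fin p) (Option ℤ)}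
    {C : Fin p} {a c : ℤ} (hc : c ∈ entryTimes G X C) (ha : anc C = some a) (hca : c ≤ a) :
    ∃ e ∈ (entries G nxt (firstTimes X).val anc).val, e.C = C := by
  rw [entries_eq]
  refine forEach_prefix_inv (fun pre L => C ∈ pre → ∃ e ∈ L, Entry.C e = C) _ _ [] (by simp)
    ?_ (List.mem_finRange C)
  intro pre C' L _ hL hC
  rcases entryStep_val (G := G) hnxt anc L C' with ⟨heq, hlt⟩ | ⟨e, heq, heC, -⟩ <;> rw [heq] <;>
    rcases List.mem_append.1 hC with hC | hC
  · exact hL hC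
  · obtain rfl : C = C' := List.mem_singleton.1 hC
    exact absurd hca (hlt c hc a ha).not_ge
  · obtain ⟨e', he', heC'⟩ := hL hC
    exact ⟨e', List.mem_cons_of_mem e he', heC'⟩
  · exact ⟨e, List.mem_cons_self, heC.trans (List.mem_singleton.1 hC).symm⟩

end Entries

section Assign

variable {p : ℕ}

lemma assign_val (nxt : Table p) (s : ℤ) (ds : List (Fin p)) (T : Arr (Fin p) (Option ℤ))
    (D : Fin p) : (assign nxt s ds T).val D =
      if D ∈ ds then some ((T D).getD ((nxt (D, s)).getD s)) else T D := by
  refine forEach_prefix_inv (fun pre (T' : Arr (Fin p) (Option ℤ)) => T' D =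
    if D ∈ pre then some ((T D).getD ((nxt (D, s)).getD s)) else T D) _ ds T (by simp) ?_
  rintro pre a T' - hI
  simp only [Timed.bind_val, Arr.get_val]
  by_cases hD : D = a
  · subst hD
    by_cases hpre : D ∈ pre
    · rw [if_pos hpre] at hI
      simp [hI]
    · rw [if_neg hpre] at hI
      cases hT : T D <;> simp [hI, hT, free]
  · cases T' a <;> simp [Arr.update_of_ne hD, hI, hD]

end Assign

section NextFree

variable {p : ℕ} {X : List (Fin p × ℤ)} {nxt : Table p}

/-- The first time `≥ s` at which `D` is not intervened on, read off the table of next times. -/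
def nextFree (nxt : Table p) (D : Fin p) (s : ℤ) : ℤ := (nxt (D, s)).getD s

lemma IsNextTable.nextFree_le (hnxt : IsNextTable X nxt) {D : Fin p} {s s₁ : ℤ} (hs : s ≤ s₁)
    (h : (D, s₁) ∉ X) : nextFree nxt D s ≤ s₁ := (hnxt.isLeast D s).2 ⟨hs, h⟩

lemma IsNextTable.le_nextFree (hnxt : IsNextTable X nxt) (D : Fin p) (s : ℤ) :
    s ≤ nextFree nxt D s := (hnxt.isLeast D s).1.1

lemma IsNextTable.nextFree_notMem (hnxt : IsNextTable X nxt) (D : Fin p) (s : ℤ) :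
    (D, nextFree nxt D s) ∉ X := (hnxt.isLeast D s).1.2

lemma IsNextTable.nextFree_mono (hnxt : IsNextTable X nxt) (D : Fin p) :
    Monotone (nextFree nxt D) := fun _ s hs =>
  hnxt.nextFree_le (hs.trans (hnxt.le_nextFree D s)) (hnxt.nextFree_notMem D s)

end NextFree

section Assign

variable {p : ℕ} {nxt : Table p} {s : ℤ} {ds : List (Fin p)} {T : Arr (Fin p) (Option ℤ)}
  {D : Fin p} {v : ℤ}

lemma EnteredBy.mono {s' : ℤ} (h : EnteredBy T D s) (hs : s ≤ s') : EnteredBy T D s' := by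
  obtain ⟨v, hv, hvs⟩ := h
  exact ⟨v, hv, hvs.trans hs⟩

lemma assign_of_some (h : T D = some v) : (assign nxt s ds T).val D = some v := by
  rw [assign_val, h]
  simp

lemma EnteredBy.assign {s' : ℤ} (h : EnteredBy T D s') :
    EnteredBy (assign nxt s ds T).val D s' := by
  obtain ⟨v, hv, hvs⟩ := h
  exact ⟨v, assign_of_some hv, hvs⟩

lemma isSome_assign_iff : ((assign nxt s ds T).val D).isSome ↔ (T D).isSome ∨ D ∈ ds := by
  rw [assign_val]
  split <;> simp [*]

lemma of_assign_eq_some (h : (assign nxt s ds T).val D = some v) :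
    T D = some v ∨ D ∈ ds ∧ v = nextFree nxt D s := by
  rw [assign_val] at h
  cases hT : T D with
  | some w => exact Or.inl (by simpa [hT] using h)
  | none =>
    obtain ⟨hD, hv⟩ : D ∈ ds ∧ nextFree nxt D s = v := by simpa [hT, nextFree] using h
    exact Or.inr ⟨hD, hv.symm⟩

lemma assign_eq_self (h : ∀ D ∈ ds, (T D).isSome) : (assign nxt s ds T).val = T := by
  funext D
  by_cases hD : D ∈ ds
  · obtain ⟨v, hv⟩ := Option.isSome_iff_exists.1 (h D hD)
    rw [assign_of_some hv, hv]
  · rw [assign_val, if_neg hD]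

lemma assign_le (h : ∀ v, T D = some v → v ≤ nextFree nxt D s) :
    ∀ v, (assign nxt s ds T).val D = some v → v ≤ nextFree nxt D s := by
  intro v hv
  rcases of_assign_eq_some hv with hv | ⟨-, rfl⟩
  · exact h v hv
  · exact le_rfl

lemma enteredBy_assign (h : ∀ v, T D = some v → v ≤ nextFree nxt D s)
    (hD : (T D).isSome ∨ D ∈ ds) : EnteredBy (assign nxt s ds T).val D (nextFree nxt D s) := by
  obtain ⟨v, hv⟩ := Option.isSome_iff_exists.1 ((isSome_assign_iff (nxt := nxt) (s := s)).2 hD)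
  exact ⟨v, hv, assign_le h v hv⟩

end Assign

section EntranceLoop

variable {p : ℕ} {G : SCG p} {X : List (Fin p × ℤ)} {nxt prv : Table p}

/-- The treatment of an entry. -/
def entranceStep (G : SCG p) (nxt : Table p) (σ : EntranceState p) (e : Entry p) :
    Timed (EntranceState p) := do
  match e.skip with
  | none => do
    let r₂ ← descendants G (fun _ => pure true) e.C σ.vis₂
    let tNC ← assign nxt e.time r₂.2 σ.tNC
    pure ⟨σ.vis₁, r₂.1, tNC⟩
  | some x => do
    let r₁ ← descendants G (fun w => pure (decide (w ≠ x))) e.C σ.vis₁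
    let tNC ← assign nxt e.time r₁.2 σ.tNC
    let r₂ ← descendants G (fun _ => pure true) e.C σ.vis₂
    let tNC ← assign nxt (e.time + 1) r₂.2 tNC
    pure ⟨r₁.1, r₂.1, tNC⟩

/-- The list of entries in the order of their treatment. -/
def sortedEntries (G : SCG p) (X : List (Fin p × ℤ)) (Y : Fin p) (t : ℤ) (nxt prv : Table p) :
    List (Entry p) :=
  (heapSort Entry.before
    (entries G nxt (firstTimes X).val (ancestorTimes G prv Y t).val).val).val

lemma entranceTimes_val (Y : Fin p) (t : ℤ) :
    (entranceTimes G X Y t nxt prv).val =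
      (forEach (sortedEntries G X Y t nxt prv)
        ⟨Arr.const false, Arr.const false, Arr.const none⟩ (entranceStep G nxt)).val.tNC := rfl

variable {σ : EntranceState p} {e : Entry p} {x : Fin p}

lemma entranceStep_of_skip_eq_none (h : e.skip = none) :
    (entranceStep G nxt σ e).val =
      ⟨σ.vis₁, (descendants G (fun _ => pure true) e.C σ.vis₂).val.1,
        (assign nxt e.time (descendants G (fun _ => pure true) e.C σ.vis₂).val.2 σ.tNC).val⟩ := by
  unfold entranceStep
  rw [h]
  rfl

lemma entranceStep_of_skip_eq_some (h : e.skip = some x) :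
    (entranceStep G nxt σ e).val =
      ⟨(descendants G (fun w => pure (decide (w ≠ x))) e.C σ.vis₁).val.1,
        (descendants G (fun _ => pure true) e.C σ.vis₂).val.1,
        (assign nxt (e.time + 1) (descendants G (fun _ => pure true) e.C σ.vis₂).val.2
          (assign nxt e.time
            (descendants G (fun w => pure (decide (w ≠ x))) e.C σ.vis₁).val.2 σ.tNC).val).val⟩ := by
  unfold entranceStep
  rw [h]
  rfl

lemma EnteredBy.entranceStep {D : Fin p} {s : ℤ} (h : EnteredBy σ.tNC D s) :
    EnteredBy (entranceStep G nxt σ e).val.tNC D s := by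
  cases hskip : e.skip with
  | none =>
    rw [entranceStep_of_skip_eq_none hskip]
    exact h.assign
  | some x =>
    rw [entranceStep_of_skip_eq_some hskip]
    exact h.assign.assign

lemma OkEdge.reflTransGen_edge {ok : Fin p → Timed Bool} {u w : Fin p}
    (h : ReflTransGen (OkEdge G ok) u w) : ReflTransGen G.Edge u w :=
  ReflTransGen.mono (fun _ _ h => h.1) _ _ h

lemma edge_reflTransGen_of_mem_descendants {ok : Fin p → Timed Bool} {C D : Fin p}
    {vis : Arr (Fin p) Bool} (hD : D ∈ (descendants G ok C vis).val.2) :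
    ReflTransGen G.Edge C D :=
  OkEdge.reflTransGen_edge (reflTransGen_of_mem_descendants hD).2

lemma of_entranceStep_tNC_eq_some {D : Fin p} {v : ℤ}
    (h : (entranceStep G nxt σ e).val.tNC D = some v) :
    σ.tNC D = some v ∨ ReflTransGen G.Edge e.C D ∧
      (v = nextFree nxt D e.time ∨ v = nextFree nxt D (e.time + 1)) := by
  cases hskip : e.skip with
  | none =>
    rw [entranceStep_of_skip_eq_none hskip] at h
    rcases of_assign_eq_some h with h | ⟨hD, hv⟩
    · exact Or.inl h
    · exact Or.inr ⟨edge_reflTransGen_of_mem_descendants hD, Or.inl hv⟩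
  | some x =>
    rw [entranceStep_of_skip_eq_some hskip] at h
    rcases of_assign_eq_some h with h | ⟨hD, hv⟩
    · rcases of_assign_eq_some h with h | ⟨hD, hv⟩
      · exact Or.inl h
      · exact Or.inr ⟨edge_reflTransGen_of_mem_descendants hD, Or.inl hv⟩
    · exact Or.inr ⟨edge_reflTransGen_of_mem_descendants hD, Or.inr hv⟩

/-- The marks `vis` are closed under edges and every marked series has an entrance time in `T`. -/
structure MarksEntered (G : SCG p) (vis : Arr (Fin p) Bool) (T : Arr (Fin p) (Option ℤ)) :
    Prop where
  closed : ∀ u w, vis u = true → G.Edge u w → vis w = true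
  isSome : ∀ D, vis D = true → (T D).isSome

section Marks

variable {vis : Arr (Fin p) Bool} {T T' : Arr (Fin p) (Option ℤ)} {ok : Fin p → Timed Bool}
  {C : Fin p}

lemma MarksEntered.assign (h : MarksEntered G vis T) {s : ℤ} {ds : List (Fin p)} :
    MarksEntered G vis (assign nxt s ds T).val :=
  ⟨h.closed, fun D hD => isSome_assign_iff.2 (Or.inl (h.isSome D hD))⟩

lemma MarksEntered.isSome_or_mem_descendants (h : MarksEntered G vis T) (hC : (ok C).val = true)
    {D : Fin p} (hD : ReflTransGen (OkEdge G ok) C D) :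
    (T D).isSome ∨ D ∈ (descendants G ok C vis).val.2 :=
  ((marked_descendants_iff D).1 (marked_descendants_of_reflTransGen
    (fun u w hu huw => h.closed u w hu huw.1) hC hD)).imp_left (h.isSome D)

lemma MarksEntered.descendants (h : MarksEntered G vis T)
    (hok : ∀ D, ReflTransGen G.Edge C D → (ok D).val = true)
    (hT' : ∀ D, (T D).isSome ∨ D ∈ (descendants G ok C vis).val.2 → (T' D).isSome) :
    MarksEntered G (descendants G ok C vis).val.1 T' where
  closed u w hu huw := by
    rcases (marked_descendants_iff u).1 hu with hvis | hmem
    · exact (marked_descendants_iff w).2 (Or.inl (h.closed u w hvis huw))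
    · exact descendants_closed (fun u w hu huw => h.closed u w hu huw.1) u w hu
        ⟨huw, hok w ((edge_reflTransGen_of_mem_descendants hmem).tail huw)⟩
  isSome D hD := hT' D (((marked_descendants_iff D).1 hD).imp_left (h.isSome D))

end Marks

/-- `T` records the entrance times due to the entries in `pre`, no series being avoided. -/
structure RecordsEntries (G : SCG p) (nxt : Table p) (pre : List (Entry p))
    (T : Arr (Fin p) (Option ℤ)) : Prop where
  value : ∀ D v, T D = some v →
    ∃ e ∈ pre, v = nextFree nxt D e.time ∧ ReflTransGen G.Edge e.C D
  enteredBy : ∀ e ∈ pre, ∀ D, ReflTransGen G.Edge e.C D → EnteredBy T D (nextFree nxt D e.time)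

variable {pre : List (Entry p)} {T : Arr (Fin p) (Option ℤ)}

lemma RecordsEntries.le_nextFree (hnxt : IsNextTable X nxt) (h : RecordsEntries G nxt pre T)
    {s : ℤ} (hpre : ∀ e' ∈ pre, e'.time ≤ s) {D : Fin p} {v : ℤ} (hv : T D = some v) :
    v ≤ nextFree nxt D s := by
  obtain ⟨e', he', rfl, -⟩ := h.value D v hv
  exact hnxt.nextFree_mono D (hpre e' he')

lemma RecordsEntries.assign (hnxt : IsNextTable X nxt) (h : RecordsEntries G nxt pre T)
    (hpre : ∀ e' ∈ pre, e'.time ≤ e.time) {ds : List (Fin p)}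
    (hds : ∀ D ∈ ds, ReflTransGen G.Edge e.C D)
    (hcover : ∀ D, ReflTransGen G.Edge e.C D → (T D).isSome ∨ D ∈ ds) :
    RecordsEntries G nxt (pre ++ [e]) (assign nxt e.time ds T).val where
  value D v hv := by
    rcases of_assign_eq_some hv with hv | ⟨hD, hv⟩
    · obtain ⟨e', he', h'⟩ := h.value D v hv
      exact ⟨e', List.mem_append_left _ he', h'⟩
    · exact ⟨e, by simp, hv, hds D hD⟩
  enteredBy e' he' D hD := by
    rcases List.mem_append.1 he' with he' | he'
    · exact (h.enteredBy e' he' D hD).assign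
    · obtain rfl := List.mem_singleton.1 he'
      exact enteredBy_assign (fun _ => h.le_nextFree hnxt hpre) (hcover D hD)

/-- The invariant of the loop over the entries as long as no entry has to avoid a descendant of
its own series. -/
structure EntranceInvariant (G : SCG p) (nxt : Table p) (pre : List (Entry p))
    (σ : EntranceState p) : Prop where
  records : RecordsEntries G nxt pre σ.tNC
  marks₁ : MarksEntered G σ.vis₁ σ.tNC
  marks₂ : MarksEntered G σ.vis₂ σ.tNC

lemma EntranceInvariant.step_of_skip_eq_none (hnxt : IsNextTable X nxt)
    (hσ : EntranceInvariant G nxt pre σ) (hpre : ∀ e' ∈ pre, e'.time ≤ e.time)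
    (hskip : e.skip = none) :
    EntranceInvariant G nxt (pre ++ [e]) (entranceStep G nxt σ e).val := by
  rw [entranceStep_of_skip_eq_none hskip]
  refine ⟨hσ.records.assign hnxt hpre (fun D => edge_reflTransGen_of_mem_descendants)
    fun D hD => hσ.marks₂.isSome_or_mem_descendants rfl
      (ReflTransGen.mono (fun _ _ h => ⟨h, rfl⟩) _ _ hD),
    hσ.marks₁.assign, hσ.marks₂.descendants (fun _ _ => rfl) fun D hD => isSome_assign_iff.2 hD⟩

lemma EntranceInvariant.step_of_not_reflTransGen (hnxt : IsNextTable X nxt)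
    (hσ : EntranceInvariant G nxt pre σ) (hpre : ∀ e' ∈ pre, e'.time ≤ e.time)
    (hskip : e.skip = some x) (hx : ¬ ReflTransGen G.Edge e.C x) :
    EntranceInvariant G nxt (pre ++ [e]) (entranceStep G nxt σ e).val := by
  have hok : ∀ D, ReflTransGen G.Edge e.C D → decide (D ≠ x) = true := fun D hD =>
    decide_eq_true fun h => hx (h ▸ hD)
  have hcover : ∀ D, ReflTransGen G.Edge e.C D → (σ.tNC D).isSome ∨
      D ∈ (descendants G (fun w => pure (decide (w ≠ x))) e.C σ.vis₁).val.2 := by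
    refine fun D hD => hσ.marks₁.isSome_or_mem_descendants (hok _ .refl) ?_
    induction hD with
    | refl => exact .refl
    | tail hab hbc ih => exact ih.tail ⟨hbc, hok _ (hab.tail hbc)⟩
  have hsecond : ∀ D ∈ (descendants G (fun _ => pure true) e.C σ.vis₂).val.2,
      ((assign nxt e.time (descendants G (fun w => pure (decide (w ≠ x))) e.C
        σ.vis₁).val.2 σ.tNC).val D).isSome := fun D hD =>
    isSome_assign_iff.2 (hcover D (edge_reflTransGen_of_mem_descendants hD))
  rw [entranceStep_of_skip_eq_some hskip, assign_eq_self hsecond]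
  exact ⟨hσ.records.assign hnxt hpre (fun D => edge_reflTransGen_of_mem_descendants) hcover,
    hσ.marks₁.descendants hok fun D hD => isSome_assign_iff.2 hD,
    hσ.marks₂.descendants (fun _ _ => rfl) fun D hD =>
      hD.elim (fun h => isSome_assign_iff.2 (Or.inl h)) (hsecond D)⟩

/-- `T` records the entrance times due to the entry `e` that has to avoid its descendant `x`. -/
structure RecordsCyclicEntry (G : SCG p) (nxt : Table p) (e : Entry p) (x : Fin p)
    (T : Arr (Fin p) (Option ℤ)) : Prop where
  skip_eq : e.skip = some x
  reaches : ReflTransGen G.Edge e.C x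
  enteredBy_avoiding : ∀ D, ReflTransGen (fun u w => G.Edge u w ∧ w ≠ x) e.C D →
    EnteredBy T D (nextFree nxt D e.time)
  enteredBy : ∀ D, ReflTransGen G.Edge e.C D → EnteredBy T D (nextFree nxt D (e.time + 1))

lemma EntranceInvariant.step_of_reflTransGen (hnxt : IsNextTable X nxt)
    (hσ : EntranceInvariant G nxt pre σ) (hpre : ∀ e' ∈ pre, e'.time ≤ e.time)
    (hskip : e.skip = some x) (hne : e.C ≠ x) (hx : ReflTransGen G.Edge e.C x) :
    RecordsCyclicEntry G nxt e x (entranceStep G nxt σ e).val.tNC where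
  skip_eq := hskip
  reaches := hx
  enteredBy_avoiding D hD := by
    rw [entranceStep_of_skip_eq_some hskip]
    exact (enteredBy_assign (fun _ => hσ.records.le_nextFree hnxt hpre)
      (hσ.marks₁.isSome_or_mem_descendants (decide_eq_true hne)
        (ReflTransGen.mono (fun u w h => ⟨h.1, decide_eq_true h.2⟩) _ _ hD))).assign
  enteredBy D hD := by
    rw [entranceStep_of_skip_eq_some hskip]
    refine enteredBy_assign (fun v hv => ?_) (hσ.marks₂.assign.isSome_or_mem_descendants rfl
      (ReflTransGen.mono (fun _ _ h => ⟨h, rfl⟩) _ _ hD))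
    exact (assign_le (fun _ => hσ.records.le_nextFree hnxt hpre) v hv).trans
      (hnxt.nextFree_mono D (by omega))

lemma RecordsCyclicEntry.entranceStep {e' : Entry p} (h : RecordsCyclicEntry G nxt e x σ.tNC) :
    RecordsCyclicEntry G nxt e x (entranceStep G nxt σ e').val.tNC :=
  ⟨h.skip_eq, h.reaches, fun D hD => (h.enteredBy_avoiding D hD).entranceStep,
    fun D hD => (h.enteredBy D hD).entranceStep⟩

end EntranceLoop

section EntranceTimes

variable {p : ℕ} {G : SCG p} {X : List (Fin p × ℤ)} {nxt prv : Table p} {Y : Fin p} {t : ℤ}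

lemma Entry.time_le_of_before {a b : Entry p} (h : Entry.before a b) : a.time ≤ b.time := by
  simp only [Entry.before, Bool.or_eq_true, decide_eq_true_eq, Bool.and_eq_true] at h
  rcases h with h | h
  · exact h.le
  · exact h.1.le

lemma Entry.before_total (a b : Entry p) : Entry.before a b || Entry.before b a := by
  simp only [Entry.before, Bool.or_eq_true, decide_eq_true_eq, Bool.and_eq_true]
  rcases lt_trichotomy a.time b.time with h | h | h
  · simp [h]
  · cases a.skip <;> cases b.skip <;> simp [h]
  · simp [h]

lemma Entry.before_trans (a b c : Entry p) (hab : Entry.before a b) (hbc : Entry.before b c) :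
    Entry.before a c := by
  simp only [Entry.before, Bool.or_eq_true, decide_eq_true_eq, Bool.and_eq_true] at *
  rcases hab with hab | ⟨hab, hab'⟩ <;> rcases hbc with hbc | ⟨hbc, hbc'⟩
  · exact Or.inl (hab.trans hbc)
  · exact Or.inl (hbc ▸ hab)
  · exact Or.inl (hab ▸ hbc)
  · refine Or.inr ⟨hab.trans hbc, ?_⟩
    cases ha : a.skip <;> cases hb : b.skip <;> cases hc : c.skip <;> simp_all

lemma mem_sortedEntries {e : Entry p} : e ∈ sortedEntries G X Y t nxt prv ↔
    e ∈ (entries G nxt (firstTimes X).val (ancestorTimes G prv Y t).val).val :=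
  (heapSort_spec Entry.before_total Entry.before_trans _).1.mem_iff

theorem entranceTimes_sound (hnxt : IsNextTable X nxt) {D : Fin p} {v : ℤ}
    (h : (entranceTimes G X Y t nxt prv).val D = some v) :
    (D, v) ∉ X ∧ ∃ x ∈ X, x.2 ≤ v ∧ TransGen G.Edge x.1 D := by
  rw [entranceTimes_val] at h
  revert D v
  refine forEach_inv (fun σ : EntranceState p => ∀ {D v}, σ.tNC D = some v →
    (D, v) ∉ X ∧ ∃ x ∈ X, x.2 ≤ v ∧ TransGen G.Edge x.1 D) _ _ _ (by simp) ?_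
  intro e he σ hσ D v h
  rcases of_entranceStep_tNC_eq_some h with h | ⟨hreach, hv⟩
  · exact hσ h
  · obtain ⟨⟨-, x, hx, hxt, hxE⟩, -⟩ :=
      (hnxt.isValid_of_mem_entries e (mem_sortedEntries.1 he)).isLeast
    have htime : e.time ≤ v ∧ (D, v) ∉ X := by
      rcases hv with rfl | rfl
      · exact ⟨hnxt.le_nextFree _ _, hnxt.nextFree_notMem _ _⟩
      · exact ⟨(Int.le_add_one le_rfl).trans (hnxt.le_nextFree _ _), hnxt.nextFree_notMem _ _⟩
    exact ⟨htime.2, x, hx, hxt.trans htime.1, TransGen.head' hxE hreach⟩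

lemma time_le_of_prefix_sortedEntries {pre : List (Entry p)} {e : Entry p}
    (h : pre ++ [e] <+: sortedEntries G X Y t nxt prv) : ∀ e' ∈ pre, e'.time ≤ e.time := by
  have hsorted := (heapSort_spec Entry.before_total Entry.before_trans _).2.sublist h.sublist
  exact fun e' he' => Entry.time_le_of_before
    ((List.pairwise_append.1 hsorted).2.2 e' he' e List.mem_cons_self)

/-- The first entry that has to avoid a descendant of its series determines what is recorded. -/
lemma records_entranceTimes (hnxt : IsNextTable X nxt) :
    RecordsEntries G nxt (sortedEntries G X Y t nxt prv) (entranceTimes G X Y t nxt prv).val ∨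
      ∃ e ∈ sortedEntries G X Y t nxt prv, ∃ x,
        RecordsCyclicEntry G nxt e x (entranceTimes G X Y t nxt prv).val := by
  rw [entranceTimes_val]
  suffices h : EntranceInvariant G nxt _ _ ∨ _ from h.imp_left EntranceInvariant.records
  refine forEach_prefix_inv (fun pre (σ : EntranceState p) => EntranceInvariant G nxt pre σ ∨
    ∃ e ∈ sortedEntries G X Y t nxt prv, ∃ x, RecordsCyclicEntry G nxt e x σ.tNC) _
    (sortedEntries G X Y t nxt prv) _ ?_ ?_
  · exact Or.inl ⟨⟨by simp, by simp⟩, ⟨by simp, by simp⟩, ⟨by simp, by simp⟩⟩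
  rintro pre e σ hprefix (hσ | ⟨e', he', x, hx⟩)
  · have hpre := time_le_of_prefix_sortedEntries hprefix
    have he : e ∈ sortedEntries G X Y t nxt prv := hprefix.subset (by simp)
    cases hskip : e.skip with
    | none => exact Or.inl (hσ.step_of_skip_eq_none hnxt hpre hskip)
    | some x =>
      by_cases hx : ReflTransGen G.Edge e.C x
      · have hvalid := hnxt.isValid_of_mem_entries e (mem_sortedEntries.1 he)
        have hne : e.C ≠ x := by
          rintro rfl
          exact hvalid.isLeast.1.1 (hvalid.skip_mem _ hskip).1
        exact Or.inr ⟨e, he, x, hσ.step_of_reflTransGen hnxt hpre hskip hne hx⟩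
      · exact Or.inl (hσ.step_of_not_reflTransGen hnxt hpre hskip hx)
  · exact Or.inr ⟨e', he', x, hx.entranceStep⟩

/-- The regular case: `ncSet X T` contains every vertex outside the interventions that an
intervention can reach through a possible edge followed by a possible walk to `Y_t`, and it
contains with a vertex all its possible descendants outside the interventions. -/
structure RegularEntrance (G : SCG p) (X : List (Fin p × ℤ)) (Y : Fin p) (t : ℤ)
    (T : Arr (Fin p) (Option ℤ)) : Prop where
  closed : ∀ u ∈ ncSet X T, ∀ w ∉ X, ReflTransGen G.Edge u.1 w.1 → u.2 ≤ w.2 → w ∈ ncSet X T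
  entrance : ∀ x ∈ X, ∀ c ∉ X, TimeEdge G.Edge x c →
    ReflTransGen (TimeEdgeFrom G.Edge {x | x ∈ X}ᶜ) c (Y, t) → c ∈ ncSet X T

/-- The cyclic case: `(C, τ)` is an entry whose skipped parent `x` is a descendant of `C`. -/
structure CyclicEntrance (G : SCG p) (X : List (Fin p × ℤ)) (Y : Fin p) (t : ℤ)
    (T : Arr (Fin p) (Option ℤ)) (C : Fin p) (τ : ℤ) (x : Fin p) : Prop where
  notMem : (C, τ) ∉ X
  skip_mem : (x, τ) ∈ X
  edge : G.Edge x C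
  reaches : ReflTransGen G.Edge C x
  time_le : τ ≤ t
  walk : C ≠ Y → ReflTransGen (TimeEdgeFrom G.Edge {x | x ∈ X}ᶜ) (C, τ) (Y, t)
  mem_ncSet_avoiding : ∀ u ∉ X, ReflTransGen (fun u w => G.Edge u w ∧ w ≠ x) C u.1 → τ ≤ u.2 →
    u ∈ ncSet X T
  mem_ncSet : ∀ u ∉ X, ReflTransGen G.Edge C u.1 → τ + 1 ≤ u.2 → u ∈ ncSet X T

lemma RecordsEntries.regularEntrance (hnxt : IsNextTable X nxt) (hprv : IsPrevTable X prv)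
    {T : Arr (Fin p) (Option ℤ)}
    (h : RecordsEntries G nxt (sortedEntries G X Y t nxt prv) T) :
    RegularEntrance G X Y t T where
  closed u hu w hw huw hle := by
    obtain ⟨-, v, hv, hvu⟩ := hu
    obtain ⟨e, he, rfl, hreach⟩ := h.value u.1 v hv
    exact ⟨hw, (h.enteredBy e he w.1 (hreach.trans huw)).mono
      (hnxt.nextFree_le (((hnxt.le_nextFree _ _).trans hvu).trans hle) hw)⟩
  entrance x hx c hc hxc hwalk := by
    obtain ⟨a, ha, hca⟩ := ancestorTimes_complete hprv hwalk
    have hct : c.2 ∈ entryTimes G X c.1 := ⟨hc, x, hx, hxc.2, hxc.1⟩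
    obtain ⟨e, he, heC⟩ := hnxt.exists_mem_entries hct ha hca
    have hle : e.time ≤ c.2 := (hnxt.isValid_of_mem_entries e he).isLeast.2 (heC ▸ hct)
    exact ⟨hc, (h.enteredBy e (mem_sortedEntries.2 he) c.1 (by rw [heC])).mono
      (hnxt.nextFree_le hle hc)⟩

lemma RecordsCyclicEntry.cyclicEntrance (hnxt : IsNextTable X nxt) (hprv : IsPrevTable X prv)
    {T : Arr (Fin p) (Option ℤ)} {e : Entry p} {x : Fin p} (h : RecordsCyclicEntry G nxt e x T)
    (he : e ∈ sortedEntries G X Y t nxt prv) : CyclicEntrance G X Y t T e.C e.time x := by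
  have hvalid := hnxt.isValid_of_mem_entries e (mem_sortedEntries.1 he)
  obtain ⟨hx, hxC⟩ := hvalid.skip_mem x h.skip_eq
  obtain ⟨a, ha, hea⟩ := hvalid.le_anc
  have hwalk := ancestorTimes_sound hprv ha
  refine ⟨hvalid.isLeast.1.1, hx, hxC, h.reaches, hea.trans (TimeEdgeFrom.time_le hwalk),
    fun hCY => ?_, fun u hu hCu hle => ⟨hu, ?_⟩, fun u hu hCu hle => ⟨hu, ?_⟩⟩
  · rcases hwalk.cases_head with h | ⟨w, hfirst, hrest⟩
    · exact absurd (congrArg Prod.fst h) hCY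
    · exact hrest.head ⟨⟨hfirst.1.1, hea.trans hfirst.1.2⟩, hvalid.isLeast.1.1⟩
  · exact (h.enteredBy_avoiding u.1 hCu).mono (hnxt.nextFree_le hle hu)
  · exact (h.enteredBy u.1 hCu).mono (hnxt.nextFree_le hle hu)

theorem regular_or_cyclic_entranceTimes (hnxt : IsNextTable X nxt) (hprv : IsPrevTable X prv) :
    RegularEntrance G X Y t (entranceTimes G X Y t nxt prv).val ∨
      ∃ C τ x, CyclicEntrance G X Y t (entranceTimes G X Y t nxt prv).val C τ x := by
  rcases records_entranceTimes (G := G) (prv := prv) (Y := Y) (t := t) hnxt with h | ⟨e, he, x, h⟩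
  · exact Or.inl (h.regularEntrance hnxt hprv)
  · exact Or.inr ⟨e.C, e.time, x, h.cyclicEntrance hnxt hprv he⟩

end EntranceTimes

/-! ### Simple walks, forks and open paths -/

section SimpleWalks

variable {W : Type*} {R : W → W → Prop} {u v w x y : W} {l q : List W}

/-- `u :: l` is a walk along `R` from `u` to `x` that visits no vertex twice. -/
structure IsSimpleWalk (R : W → W → Prop) (u x : W) (l : List W) : Prop where
  isChain : (u :: l).IsChain R
  nodup : (u :: l).Nodup
  getLast? : (u :: l).getLast? = some x

namespace IsSimpleWalk

lemma refl (x : W) : IsSimpleWalk R x x [] := ⟨by simp, by simp, by simp⟩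

lemma mono {R' : W → W → Prop} (hR : ∀ a b, R a b → R' a b) (h : IsSimpleWalk R u x l) :
    IsSimpleWalk R' u x l := ⟨h.isChain.imp hR, h.nodup, h.getLast?⟩

lemma exists_suffix (h : IsSimpleWalk R u x l) (hv : v ∈ u :: l) :
    ∃ q, v :: q <:+ u :: l ∧ IsSimpleWalk R v x q := by
  obtain ⟨s, q, hsq⟩ := List.append_of_mem hv
  have hsuf : v :: q <:+ u :: l := ⟨s, hsq.symm⟩
  refine ⟨q, hsuf, h.isChain.suffix hsuf, h.nodup.sublist hsuf.sublist, ?_⟩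
  have hlast := h.getLast?
  rw [hsq, List.getLast?_append] at hlast
  simpa using hlast

lemma reflTransGen_of_mem (h : IsSimpleWalk R u x l) (hv : v ∈ u :: l) : ReflTransGen R u v :=
  h.isChain.induction (ReflTransGen R u) _ (fun _ _ hab ha => ha.tail hab) (fun _ => .refl) v hv

lemma reflTransGen (h : IsSimpleWalk R u x l) : ReflTransGen R u x :=
  h.reflTransGen_of_mem (List.mem_of_getLast? h.getLast?)

lemma eq_or_mem {A : Set W} (h : IsSimpleWalk R u x l) (hR : ∀ a b, R a b → a ∈ A)
    (hv : v ∈ u :: l) : v = x ∨ v ∈ A := by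
  obtain ⟨q, -, hq⟩ := h.exists_suffix hv
  rcases hq.reflTransGen.cases_head with hvx | ⟨c, hvc, -⟩
  · exact Or.inl hvx
  · exact Or.inr (hR v c hvc)

lemma isChain_reverse (h : IsSimpleWalk R u x l) :
    (l.reverse ++ [u]).IsChain fun a b => R b a := by
  rw [← List.reverse_cons, List.isChain_reverse]
  exact h.isChain

end IsSimpleWalk

theorem exists_branch (h : ReflTransGen R u x) (hu : u ∈ q) :
    ∃ v ∈ q, ∃ l, IsSimpleWalk R v x l ∧ ∀ w ∈ l, w ∉ q := by
  induction h with
  | refl => exact ⟨u, hu, [], .refl u, by simp⟩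
  | @tail b c _ hbc ih =>
    obtain ⟨v, hv, l, hl, hlq⟩ := ih
    by_cases hcq : c ∈ q
    · exact ⟨c, hcq, [], .refl c, by simp⟩
    by_cases hcl : c ∈ l
    · obtain ⟨s, r, rfl⟩ := List.append_of_mem hcl
      have hpre : v :: (s ++ [c]) <+: v :: (s ++ c :: r) := ⟨r, by simp⟩
      refine ⟨v, hv, s ++ [c], ⟨hl.isChain.prefix hpre, hl.nodup.sublist hpre.sublist, ?_⟩,
        fun w hw => hlq w (by simp only [List.mem_append, List.mem_cons] at hw ⊢; tauto)⟩
      rw [← List.cons_append, List.getLast?_concat]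
    · have hcv : c ∉ v :: l := fun hc => (List.mem_cons.1 hc).elim (fun h => hcq (h ▸ hv)) hcl
      refine ⟨v, hv, l ++ [c], ⟨?_, ?_, ?_⟩, fun w hw => ?_⟩
      · rw [← List.cons_append, List.isChain_append]
        simpa [hl.getLast?] using ⟨hl.isChain, hbc⟩
      · rw [← List.cons_append, ← List.concat_eq_append]
        exact List.Nodup.concat hcv hl.nodup
      · rw [← List.cons_append, List.getLast?_concat]
      · rcases List.mem_append.1 hw with hw | hw
        · exact hlq w hw
        · rwa [List.mem_singleton.1 hw]

lemma exists_isSimpleWalk (h : ReflTransGen R u x) : ∃ l, IsSimpleWalk R u x l := by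
  obtain ⟨v, hv, l, hl, -⟩ := exists_branch h (List.mem_singleton_self u)
  exact ⟨l, List.mem_singleton.1 hv ▸ hl⟩

theorem exists_fork (hx : ReflTransGen R u x) (hy : ReflTransGen R u y) :
    ∃ v m q, IsSimpleWalk R v x m ∧ IsSimpleWalk R v y q ∧ ∀ w ∈ m, w ∉ v :: q := by
  obtain ⟨l, hl⟩ := exists_isSimpleWalk hy
  obtain ⟨v, hv, m, hm, hml⟩ := exists_branch hx (List.mem_cons_self (a := u) (l := l))
  obtain ⟨q, hq, hvq⟩ := hl.exists_suffix hv
  exact ⟨v, m, q, hm, hvq, fun w hw hwq => hml w hw (hq.subset hwq)⟩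

end SimpleWalks

section Forks

variable {W : Type*} {E : W → W → Prop} {v x y : W} {m q : List W} {A Z : Set W}

lemma not_isCollider_fork (hE : ∀ a b, E a b → ¬ E b a) (hm : (m ++ [v]).IsChain fun a b => E b a)
    (hq : (v :: q).IsChain E) (c : W) : ¬ IsCollider E (m ++ v :: q) c := by
  rintro ⟨a, b, hinf, hac, hbc⟩
  induction m with
  | nil =>
    have hacb := hq.infix hinf
    simp only [List.isChain_cons_cons] at hacb
    exact hE _ _ hbc hacb.2.1
  | cons d m ih =>
    rw [List.cons_append, List.infix_cons_iff] at hinf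
    rcases hinf with hpre | hinf
    · have hpre' : [a, c] <+: d :: m ++ [v] := by
        refine List.prefix_of_prefix_length_le (l₃ := d :: m ++ v :: q)
          ((List.prefix_append [a, c] [b]).trans hpre) ⟨q, by simp⟩ (by simp)
      have hca := hm.prefix hpre'
      simp only [List.isChain_cons_cons] at hca
      exact hE _ _ hac hca.1
    · exact ih (hm.suffix (List.suffix_cons _ _)) hinf

lemma isProperPath_fork (hm : IsSimpleWalk E v x m) (hq : IsSimpleWalk E v y q)
    (hmq : ∀ w ∈ m, w ∉ v :: q) (hx : x ∈ A) (hmA : ∀ w ∈ m, w ∈ A → w = x)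
    (hqA : ∀ w ∈ v :: q, w ∉ A) : IsProperPath E A {y} (m.reverse ++ v :: q) := by
  have hnodup : (m.reverse ++ v :: q).Nodup :=
    List.nodup_append.2 ⟨List.nodup_reverse.2 (List.nodup_cons.1 hm.nodup).2, hq.nodup,
      fun w hw w' hw' hww' => hmq w (List.mem_reverse.1 hw) (hww' ▸ hw')⟩
  have hpath : IsPath E (m.reverse ++ v :: q) :=
    ⟨hnodup, List.isChain_split.2
      ⟨hm.isChain_reverse.imp fun _ _ h => Or.inr h, hq.isChain.imp fun _ _ h => Or.inl h⟩⟩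
  have hhead : (m.reverse ++ v :: q).head? = some x := by
    have hlast := hm.getLast?
    have hvx : v ≠ x := fun h => hqA v List.mem_cons_self (h ▸ hx)
    cases m with
    | nil => exact absurd (by simpa using hlast) hvx
    | cons b m =>
      rw [List.getLast?_cons_cons] at hlast
      rw [List.head?_append, List.head?_reverse, hlast, Option.some_or]
  refine ⟨hpath, ⟨x, hx, hhead⟩, ⟨y, rfl, ?_⟩, fun w hw hwA => ?_⟩
  · rw [List.getLast?_append, hq.getLast?, Option.some_or]
  · obtain ⟨r, hr⟩ := List.head?_eq_some_iff.1 hhead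
    rw [hr] at hnodup hw
    have hwx : w ≠ x := fun h => (List.nodup_cons.1 hnodup).1 (h ▸ hw)
    rcases List.mem_append.1 (hr ▸ List.mem_cons_of_mem x hw) with hw | hw
    · exact hwx (hmA w (List.mem_reverse.1 hw) hwA)
    · exact hqA w hw hwA

lemma not_isCausal_fork (hE : ∀ a b, E a b → ¬ E b a) (hm : (v :: m).IsChain E) (hm₀ : m ≠ []) :
    ¬ IsCausal E (m.reverse ++ v :: q) := by
  intro hcausal
  obtain ⟨b, m, rfl⟩ := List.exists_cons_of_ne_nil hm₀
  have hbv : [b, v].IsChain E := List.IsChain.infix hcausal ⟨m.reverse, q, by simp⟩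
  exact hE _ _ (List.isChain_cons_cons.1 hm).1 (List.isChain_cons_cons.1 hbv).1

theorem not_adjustmentCriterion_of_fork (hE : ∀ a b, E a b → ¬ E b a)
    (hm : IsSimpleWalk E v x m) (hq : IsSimpleWalk E v y q) (hmq : ∀ w ∈ m, w ∉ v :: q)
    (hx : x ∈ A) (hmA : ∀ w ∈ m, w ∈ A → w = x) (hqA : ∀ w ∈ v :: q, w ∉ A)
    (hmZ : ∀ w ∈ m, w ∉ Z) (hqZ : ∀ w ∈ v :: q, w ∉ Z) : ¬ AdjustmentCriterion E A {y} Z := by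
  intro hcrit
  have hm₀ : m ≠ [] := by
    rintro rfl
    have hvx : v = x := by simpa using hm.getLast?
    exact hqA v List.mem_cons_self (hvx ▸ hx)
  rcases hcrit.2 _ (isProperPath_fork hm hq hmq hx hmA hqA) (not_isCausal_fork hE hm.isChain hm₀)
    with ⟨w, hw, -, hwZ⟩ | ⟨c, hc, -⟩
  · rcases List.mem_append.1 hw with hw | hw
    · exact hmZ w (List.mem_reverse.1 hw) hwZ
    · exact hqZ w hw hwZ
  · exact not_isCollider_fork hE hm.isChain_reverse hq.isChain c hc

end Forks

section Candidates

variable {V : Type*} {E : V → V → Prop}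

lemma FTCG.asymm (F : FTCG V) (a b : V × ℤ) (h : F.Edge a b) : ¬ F.Edge b a := fun h' =>
  F.acyclic a (TransGen.head h (TransGen.single h'))

lemma IsCandidate.timeEdge {F : FTCG V} (hF : IsCandidate E F) {a b : V × ℤ}
    (h : F.Edge a b) : TimeEdge E a b := by
  have hle := F.forward a b h
  have ha : (a.1, b.2 - ((b.2 - a.2).toNat : ℤ)) = a := Prod.ext rfl (by simp only; omega)
  exact ⟨(hF a.1 b.1).2 ⟨b.2, (b.2 - a.2).toNat, by rwa [ha]⟩, hle⟩

/-- The full-time graph with all possible edges between different times, and with those edges at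
one time along which `r` increases. -/
def rankFTCG (E : V → V → Prop) (r : V × ℤ → ℕ) : FTCG V where
  Edge a b := E a.1 b.1 ∧ toLex (a.2, r a) < toLex (b.2, r b)
  forward a b h := (Prod.Lex.lt_iff.1 h.2).elim le_of_lt fun h => h.1.le
  acyclic a h := by
    have hlt : ∀ b, TransGen (fun a b : V × ℤ => E a.1 b.1 ∧
        toLex (a.2, r a) < toLex (b.2, r b)) a b → toLex (a.2, r a) < toLex (b.2, r b) := by
      intro b hb
      induction hb with
      | single h => exact h.2
      | tail _ h ih => exact ih.trans h.2
    exact (hlt a h).false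

lemma isCandidate_rankFTCG (r : V × ℤ → ℕ) : IsCandidate E (rankFTCG E r) := fun _ _ =>
  ⟨fun h => ⟨0, 1, h, Prod.Lex.lt_iff.2 (Or.inl (by simp))⟩, fun ⟨_, _, h⟩ => h.1⟩

/-- Rank the vertices by their position in `L`. -/
theorem exists_candidate_of_nodup {L : List (V × ℤ)} (hL : L.Nodup) :
    ∃ F : FTCG V, IsCandidate E F ∧
      ∀ l : List (V × ℤ), l.Sublist L → l.IsChain (TimeEdge E) → l.IsChain F.Edge := by
  classical
  refine ⟨rankFTCG E L.idxOf, isCandidate_rankFTCG _, fun l hl hchain => ?_⟩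
  have hrank : L.Pairwise fun a b => L.idxOf a < L.idxOf b :=
    List.pairwise_iff_getElem.2 fun i j hi hj hij => by
      rwa [hL.idxOf_getElem, hL.idxOf_getElem]
  rw [List.isChain_iff_getElem] at hchain ⊢
  intro i hi
  have hlt := List.pairwise_iff_getElem.1 (hrank.sublist hl) i (i + 1) (by omega) hi (by omega)
  refine ⟨(hchain i hi).1, Prod.Lex.lt_iff.2 ?_⟩
  exact (hchain i hi).2.lt_or_eq.imp id fun h => ⟨h, hlt⟩

theorem exists_candidate_of_branch {q l : List (V × ℤ)} {v x : V × ℤ}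
    (hq : q.IsChain (TimeEdge E)) (hqn : q.Nodup) (hl : IsSimpleWalk (TimeEdge E) v x l)
    (hv : v ∈ q) (hlq : ∀ w ∈ l, w ∉ q) :
    ∃ F : FTCG V, IsCandidate E F ∧ q.IsChain F.Edge ∧ IsSimpleWalk F.Edge v x l := by
  obtain ⟨F, hF, hchain⟩ := exists_candidate_of_nodup (E := E) (L := q ++ l)
    (List.nodup_append.2 ⟨hqn, (List.nodup_cons.1 hl.nodup).2,
      fun w hw w' hw' hww' => hlq w' hw' (hww' ▸ hw)⟩)
  refine ⟨F, hF, hchain q (List.sublist_append_left q l) hq,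
    hchain (v :: l) ?_ hl.isChain, hl.nodup, hl.getLast?⟩
  exact (List.singleton_sublist.2 hv).append (List.Sublist.refl l)

variable {A N Z : Set (V × ℤ)} {r x c y d : V × ℤ}

theorem exists_candidate_mem_forb (hx : x ∈ A) (hy : y ∉ A) (hd : d ∉ A) (hxc : TimeEdge E x c)
    (hcy : ReflTransGen (TimeEdgeFrom E Aᶜ) c y) (hcd : ReflTransGen (TimeEdgeFrom E Aᶜ) c d) :
    ∃ F : FTCG V, IsCandidate E F ∧ d ∈ Forb F.Edge A {y} := by
  obtain ⟨l, hl⟩ := exists_isSimpleWalk hcy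
  have hlA : ∀ w ∈ c :: l, w ∉ A := fun w hw =>
    (hl.eq_or_mem (fun _ _ h => h.2) hw).elim (fun h => h ▸ hy) id
  have hnodup : (x :: c :: l).Nodup := List.nodup_cons.2 ⟨fun h => hlA x h hx, hl.nodup⟩
  obtain ⟨v, hv, m, hm, hml⟩ := exists_branch (q := x :: c :: l) hcd (by simp)
  have hvA : v ∉ A := (hm.eq_or_mem (fun _ _ h => h.2) List.mem_cons_self).elim (fun h => h ▸ hd) id
  obtain ⟨F, hF, hcausal, hvd⟩ := exists_candidate_of_branch
    (List.isChain_cons_cons.2 ⟨hxc, hl.isChain.imp fun _ _ h => h.1⟩) hnodup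
    (hm.mono fun _ _ h => h.1) hv hml
  have hproper : IsProperPath F.Edge A {y} (x :: c :: l) :=
    ⟨⟨hnodup, hcausal.imp fun _ _ h => Or.inl h⟩, ⟨x, hx, rfl⟩, ⟨y, rfl, hl.getLast?⟩, hlA⟩
  exact ⟨F, hF, x :: c :: l, hproper, hcausal, v, hv, hvA, hvd.reflTransGen⟩

theorem not_commonAdjustment_of_fork (hNA : Disjoint N A) (hx : x ∈ A) (hy : y ∉ A)
    (hry : ReflTransGen (TimeEdgeFrom E N) r y) (hrx : ReflTransGen (TimeEdgeFrom E N) r x)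
    (hZA : Disjoint Z A) (hZy : Disjoint Z {y}) (hZN : Disjoint Z N) :
    ¬ CommonAdjustmentCriterion E A {y} Z := by
  intro hcrit
  obtain ⟨v, m, q, hm, hq, hmq⟩ := exists_fork hrx hry
  have hmem : ∀ w ∈ m, w = x ∨ w ∈ N := fun w hw =>
    hm.eq_or_mem (fun _ _ h => h.2) (List.mem_cons_of_mem v hw)
  have hqmem : ∀ w ∈ v :: q, w = y ∨ w ∈ N := fun w hw => hq.eq_or_mem (fun _ _ h => h.2) hw
  obtain ⟨F, hF, hqF, hmF⟩ := exists_candidate_of_branch (hq.isChain.imp fun _ _ h => h.1)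
    hq.nodup (hm.mono fun _ _ h => h.1) List.mem_cons_self hmq
  refine not_adjustmentCriterion_of_fork F.asymm hmF ⟨hqF, hq.nodup, hq.getLast?⟩ hmq hx
    (fun w hw hwA => (hmem w hw).resolve_right fun h => Set.disjoint_left.1 hNA h hwA)
    (fun w hw => ?_) (fun w hw hwZ => ?_) (fun w hw hwZ => ?_) (hcrit F hF)
  · rcases hqmem w hw with rfl | h
    exacts [hy, Set.disjoint_left.1 hNA h]
  · rcases hmem w hw with rfl | h
    exacts [Set.disjoint_left.1 hZA hwZ hx, Set.disjoint_left.1 hZN hwZ h]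
  · rcases hqmem w hw with rfl | h
    exacts [Set.disjoint_left.1 hZy hwZ rfl, Set.disjoint_left.1 hZN hwZ h]

end Candidates

section OpenPaths

variable {W : Type*} {E : W → W → Prop} {A N : Set W} {x y a c b w : W} {π l : List W}

lemma isCollider_iff_of_suffix (hπ : π.Nodup) (h : a :: c :: b :: l <:+ π) :
    IsCollider E π c ↔ E a c ∧ E b c := by
  refine ⟨?_, fun hc => ⟨a, b, List.IsInfix.trans ⟨[], l, rfl⟩ h.isInfix, hc⟩⟩
  rintro ⟨a', b', ⟨s, r, hsr⟩, hc⟩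
  obtain ⟨pre, rfl⟩ := h
  have hsplit : (s ++ [a']) ++ c :: (b' :: r) = (pre ++ [a]) ++ c :: (b :: l) := by
    simpa using hsr
  have hc' : c ∉ s ++ [a'] ∧ c ∉ b' :: r := by
    rw [← hsr] at hπ
    have hπ' : ((s ++ [a']) ++ c :: (b' :: r)).Nodup := by simpa using hπ
    rw [List.nodup_middle, List.nodup_cons] at hπ'
    simpa only [List.mem_append, not_or] using hπ'.1
  obtain ⟨hleft, -, hright⟩ := List.append_cons_inj_of_notMem hc'.1 hc'.2 |>.1 hsplit
  have ha : a' = a := by simpa using congrArg List.getLast? hleft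
  have hb : b' = b := (List.cons.inj hright).1
  rwa [ha, hb] at hc

namespace IsProperPath

lemma notMem_of_suffix (hπ : IsProperPath E A {y} π) (h : a :: l <:+ π) (hw : w ∈ l) :
    w ∉ A := by
  obtain ⟨s, rfl⟩ := h
  exact hπ.2.2.2 w (by cases s <;> simp [hw])

lemma edge_or_edge_of_suffix (hπ : IsProperPath E A {y} π)
    (h : a :: c :: l <:+ π) : E a c ∨ E c a :=
  (List.isChain_cons_cons.1 (hπ.1.2.suffix h)).1

lemma eq_of_suffix (hπ : IsProperPath E A {y} π) (h : [w] <:+ π) : w = y := by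
  obtain ⟨s, rfl⟩ := h
  obtain ⟨z, rfl, hz⟩ := hπ.2.2.1
  simpa using hz

lemma exists_eq_cons_cons (hπ : IsProperPath E A {y} π)
    (hy : y ∉ A) : ∃ x ∈ A, ∃ c l, π = x :: c :: l := by
  obtain ⟨x, hx, hhead⟩ := hπ.2.1
  obtain ⟨l, rfl⟩ := List.head?_eq_some_iff.1 hhead
  cases l with
  | nil => exact absurd (hπ.eq_of_suffix (List.suffix_refl _) ▸ hx) hy
  | cons c l => exact ⟨x, hx, c, l, rfl⟩

lemma isSimpleWalk_of_suffix (hπ : IsProperPath E A {y} π) (h : a :: l <:+ π)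
    (hl : (a :: l).IsChain E) : IsSimpleWalk E a y l := by
  refine ⟨hl, hπ.1.1.sublist h.sublist, ?_⟩
  obtain ⟨s, rfl⟩ := h
  obtain ⟨z, rfl, hz⟩ := hπ.2.2.1
  simpa using hz

lemma isChain_of_suffix (hπ : IsProperPath E A {y} π)
    (hcoll : ∀ c, TransGen E a c → ¬ IsCollider E π c) (h : a :: w :: l <:+ π) (haw : E a w) :
    (a :: w :: l).IsChain E := by
  induction l generalizing a w with
  | nil => simpa using haw
  | cons b l ih =>
    have hsuf : w :: b :: l <:+ π := (List.suffix_cons a _).trans h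
    rcases hπ.edge_or_edge_of_suffix hsuf with hwb | hbw
    · exact List.isChain_cons_cons.2 ⟨haw, ih (fun c hc => hcoll c (.head haw hc)) hsuf hwb⟩
    · exact absurd ((isCollider_iff_of_suffix hπ.1.1 h).2 ⟨haw, hbw⟩) (hcoll w (.single haw))

end IsProperPath

theorem forb_subset_union (hclosed : ∀ u ∈ N, ∀ w ∉ A, ReflTransGen E u w → w ∈ N)
    (hentrance : ∀ x ∈ A, ∀ c ∉ A, E x c → ReflTransGen (fun u w => E u w ∧ u ∉ A) c y → c ∈ N)
    (hy : y ∉ A) : Forb E A {y} ⊆ A ∪ N := by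
  rintro d ⟨π, hπ, hcausal, w, hw, hwA, hwd⟩
  by_cases hdA : d ∈ A
  · exact Or.inl hdA
  obtain ⟨x, hx, c, l, rfl⟩ := hπ.exists_eq_cons_cons hy
  have hwl : w ∈ c :: l := (List.mem_cons.1 hw).resolve_left fun h => hwA (h ▸ hx)
  have hwalk : IsSimpleWalk E c y l :=
    hπ.isSimpleWalk_of_suffix (List.suffix_cons x _) (List.isChain_cons_cons.1 hcausal).2
  have hwalkA : IsSimpleWalk (fun u w => E u w ∧ u ∉ A) c y l := by
    refine ⟨List.isChain_iff_getElem.2 fun i hi => ?_, hwalk.nodup, hwalk.getLast?⟩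
    exact ⟨List.isChain_iff_getElem.1 hwalk.isChain i hi, hπ.2.2.2 _ (List.getElem_mem _)⟩
  have hcN : c ∈ N := hentrance x hx c (hπ.2.2.2 c List.mem_cons_self)
    (List.isChain_cons_cons.1 hcausal).1 hwalkA.reflTransGen
  exact Or.inr (hclosed c hcN d hdA ((hwalk.reflTransGen_of_mem hwl).trans hwd))

/-- `π` is a proper path from `A` to `y` that is open when one adjusts for all vertices outside
`A ∪ N`. -/
structure IsOpenProperPath (E : W → W → Prop) (A N : Set W) (y : W) (π : List W) : Prop where
  isProperPath : IsProperPath E A {y} π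
  not_blocks : ¬ Blocks E (A ∪ N)ᶜ π

namespace IsOpenProperPath

lemma mem_of_not_isCollider (hπ : IsOpenProperPath E A N y π) (hw : w ∈ π) (hwA : w ∉ A)
    (hwc : ¬ IsCollider E π w) : w ∈ N := by
  by_contra hwN
  exact hπ.not_blocks (Or.inl ⟨w, hw, hwc, fun h => h.elim hwA hwN⟩)

lemma mem_of_edge (hE : ∀ a b, E a b → ¬ E b a) (hπ : IsOpenProperPath E A N y π) (hy : y ∈ N)
    (h : a :: w :: l <:+ π) (hwa : E w a) : w ∈ N := by
  cases l with
  | nil => rwa [hπ.isProperPath.eq_of_suffix ((List.suffix_cons a _).trans h)]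
  | cons b l =>
    refine hπ.mem_of_not_isCollider (h.subset (by simp))
      (hπ.isProperPath.notMem_of_suffix h List.mem_cons_self) fun hc => ?_
    exact hE _ _ hwa ((isCollider_iff_of_suffix hπ.isProperPath.1.1 h).1 hc).1

lemma not_isCollider (hE : ∀ a b, E a b → ¬ E b a) (hπ : IsOpenProperPath E A N y π)
    (hy : y ∈ N) (hclosed : ∀ u ∈ N, ∀ w ∉ A, ReflTransGen E u w → w ∈ N) (c : W) :
    ¬ IsCollider E π c := by
  intro hc
  have hmem : c ∈ N := by
    obtain ⟨a, b, ⟨s, l, hsl⟩, -, hbc⟩ := id hc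
    have hsuf : a :: c :: b :: l <:+ π := ⟨s, by simpa using hsl⟩
    have hbN : b ∈ N := hπ.mem_of_edge hE hy ((List.suffix_cons a _).trans hsuf) hbc
    exact hclosed b hbN c (hπ.isProperPath.notMem_of_suffix hsuf List.mem_cons_self) (.single hbc)
  refine hπ.not_blocks (Or.inr ⟨c, hc, fun d hcd hdZ => hdZ ?_⟩)
  exact (em (d ∈ A)).imp id fun hdA => hclosed c hmem d hdA hcd

end IsOpenProperPath

lemma IsSimpleWalk.reflTransGen_of_closed
    (hclosed : ∀ u ∈ N, ∀ w ∉ A, ReflTransGen E u w → w ∈ N) (ha : a ∈ N) (hl : ∀ w ∈ l, w ∉ A)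
    (h : IsSimpleWalk E a y l) : ReflTransGen (fun u w => E u w ∧ u ∈ N) a y := by
  have hmem : ∀ w ∈ a :: l, w ∈ N := fun w hw =>
    (List.mem_cons.1 hw).elim (fun hwa => hwa ▸ ha) fun hwl =>
      hclosed a ha w (hl w hwl) (h.reflTransGen_of_mem hw)
  have hchain : (a :: l).IsChain fun u w => E u w ∧ u ∈ N := List.isChain_iff_getElem.2 fun i hi =>
    ⟨List.isChain_iff_getElem.1 h.isChain i hi, hmem _ (List.getElem_mem _)⟩
  exact IsSimpleWalk.reflTransGen ⟨hchain, h.nodup, h.getLast?⟩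

lemma IsOpenProperPath.exists_fork_of_suffix (hE : ∀ a b, E a b → ¬ E b a)
    (hπ : IsOpenProperPath E A N y π) (hy : y ∈ N)
    (hclosed : ∀ u ∈ N, ∀ w ∉ A, ReflTransGen E u w → w ∈ N) (h : a :: c :: l <:+ π) (hca : E c a)
    (hax : ReflTransGen (fun u w => E u w ∧ u ∈ N) a x) :
    ∃ r ∈ N, ReflTransGen (fun u w => E u w ∧ u ∈ N) r x ∧
      ReflTransGen (fun u w => E u w ∧ u ∈ N) r y := by
  have hcN : c ∈ N := hπ.mem_of_edge hE hy h hca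
  have hcx : ReflTransGen (fun u w => E u w ∧ u ∈ N) c x := .head ⟨hca, hcN⟩ hax
  have hsuf : c :: l <:+ π := (List.suffix_cons a _).trans h
  induction l generalizing a c with
  | nil => exact ⟨c, hcN, hcx, hπ.isProperPath.eq_of_suffix hsuf ▸ .refl⟩
  | cons b l ih =>
    rcases hπ.isProperPath.edge_or_edge_of_suffix hsuf with hcb | hbc
    · have hwalk : IsSimpleWalk E c y (b :: l) := hπ.isProperPath.isSimpleWalk_of_suffix hsuf
        (hπ.isProperPath.isChain_of_suffix (fun c _ => hπ.not_isCollider hE hy hclosed c) hsuf hcb)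
      exact ⟨c, hcN, hcx, hwalk.reflTransGen_of_closed hclosed hcN fun w hw =>
        hπ.isProperPath.notMem_of_suffix hsuf hw⟩
    · have hbN : b ∈ N := hπ.mem_of_edge hE hy hsuf hbc
      exact ih hsuf hbc hcx hbN (.head ⟨hbc, hbN⟩ hcx) ((List.suffix_cons c _).trans hsuf)

/-- All descendants outside `A` of a collider in `N` are in `N`, hence an open path contains no
collider; being non-causal, it goes against the arrows up to a fork and then along them. -/
theorem IsOpenProperPath.exists_fork (hE : ∀ a b, E a b → ¬ E b a)
    (hπ : IsOpenProperPath E A N y π) (hyA : y ∉ A) (hy : y ∈ N)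
    (hclosed : ∀ u ∈ N, ∀ w ∉ A, ReflTransGen E u w → w ∈ N) (hcausal : ¬ IsCausal E π) :
    ∃ r ∈ N, ∃ x ∈ A, ReflTransGen (fun u w => E u w ∧ u ∈ N) r x ∧
      ReflTransGen (fun u w => E u w ∧ u ∈ N) r y := by
  obtain ⟨x, hx, c, l, hxc⟩ := hπ.isProperPath.exists_eq_cons_cons hyA
  have hsuf : x :: c :: l <:+ π := hxc ▸ List.suffix_refl _
  rcases hπ.isProperPath.edge_or_edge_of_suffix hsuf with hxc' | hcx
  · refine absurd ?_ hcausal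
    rw [hxc]
    exact hπ.isProperPath.isChain_of_suffix (fun c _ => hπ.not_isCollider hE hy hclosed c) hsuf hxc'
  · obtain ⟨r, hr, hrx, hry⟩ := hπ.exists_fork_of_suffix hE hy hclosed hsuf hcx .refl
    exact ⟨r, hr, x, hx, hrx, hry⟩

/-- A path that leaves `x ∈ A` along an arrow would need a collider, whose descendants are not
ancestors of `y` in the summary graph, since the series of `y` lies on no cycle. -/
theorem commonAdjustment_of_not_transGen {V : Type*} {E : V → V → Prop} {A : Set (V × ℤ)}
    {y : V × ℤ} (hA : ∀ x ∈ A, x.1 = y.1) (hyA : y ∉ A) (hcyc : ¬ TransGen E y.1 y.1) :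
    CommonAdjustmentCriterion E A {y} {w | TransGen E w.1 y.1} := by
  intro F hF
  have hdesc : ∀ {u w : V × ℤ}, ReflTransGen F.Edge u w → ReflTransGen E u.1 w.1 := fun h =>
    h.lift Prod.fst fun _ _ h => (hF.timeEdge h).1
  constructor
  · refine Set.disjoint_left.2 ?_
    rintro d ⟨π, hπ, hcausal, -⟩ -
    obtain ⟨x, hx, c, l, rfl⟩ := hπ.exists_eq_cons_cons hyA
    have hxc := (hF.timeEdge (List.isChain_cons_cons.1 hcausal).1).1
    have hcy := (hπ.isSimpleWalk_of_suffix (List.suffix_cons x _)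
      (List.isChain_cons_cons.1 hcausal).2).reflTransGen
    exact hcyc (.head' (hA x hx ▸ hxc) (hdesc hcy))
  · intro π hπ hcausal
    by_contra hopen
    simp only [Blocks, not_or, not_exists, not_and, not_forall, not_not] at hopen
    obtain ⟨hnonCollider, hcollider⟩ := hopen
    obtain ⟨x, hx, c, l, rfl⟩ := hπ.exists_eq_cons_cons hyA
    rcases hπ.edge_or_edge_of_suffix (List.suffix_refl _) with hxc | hcx
    · refine hcausal (hπ.isChain_of_suffix (fun w hxw hw => ?_) (List.suffix_refl _) hxc)
      obtain ⟨d, hwd, hd⟩ := hcollider w hw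
      have hxw' : TransGen E y.1 w.1 := hA x hx ▸ hxw.lift Prod.fst fun _ _ h => (hF.timeEdge h).1
      exact hcyc ((hxw'.trans_left (hdesc hwd)).trans hd)
    · have hcy : E c.1 y.1 := hA x hx ▸ (hF.timeEdge hcx).1
      refine hnonCollider c (by simp) (fun hc => ?_) (.single hcy)
      cases l with
      | nil => exact hcyc (.single (hπ.eq_of_suffix (List.suffix_cons x _) ▸ hcy))
      | cons b l =>
        have hxc := ((isCollider_iff_of_suffix hπ.1.1 (List.suffix_refl _)).1 hc).1
        exact F.asymm _ _ hxc hcx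

end OpenPaths

/-! ### The outcome of the algorithm -/

instance : LawfulMonad Timed := LawfulMonad.mk'
  (id_map := fun x => by cases x; simp [Functor.map])
  (pure_bind := fun a f => by simp [bind, pure])
  (bind_assoc := fun x f g => by simp [bind, add_assoc])

@[simp] lemma Timed.map_cost {α β : Type} (f : α → β) (m : Timed α) : (f <$> m).cost = m.cost :=
  rfl

@[simp] lemma Timed.map_val {α β : Type} (f : α → β) (m : Timed α) : (f <$> m).val = f m.val :=
  rfl

section Outcome

variable {p : ℕ} (G : SCG p) (X : List (Fin p × ℤ)) (Y : Fin p) (t : ℤ)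

/-- Marks the series `S` if its recorded entrance time is at most `t`. -/
def markEntered (tNC : Arr (Fin p) (Option ℤ)) (inS : Arr (Fin p) Bool) (S : Fin p) :
    Timed (Arr (Fin p) Bool) := do
  let e ← tNC.get S
  if leTimes e (some t) then inS.set S true else pure inS

/-- Marks the series of the intervention `x` if it takes place at time `t`. -/
def markIntervened (inS : Arr (Fin p) Bool) (x : Fin p × ℤ) : Timed (Arr (Fin p) Bool) :=
  if x.2 = t then inS.set x.1 true else pure inS

/-- The marks of the series that are non-conditionable or intervened on at time `t`: the set `𝒮`
of step 3 of the algorithm. -/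
def finalMarks (tNC : Arr (Fin p) (Option ℤ)) : Timed (Arr (Fin p) Bool) := do
  let inS ← newArr p false
  let inS ← forEach (List.finRange p) inS (markEntered t tNC)
  forEach X inS (markIntervened t)

/-- Step 3 of the algorithm, the test for directed paths from `(Y, t)` to an intervention. -/
def directTest (tNC : Arr (Fin p) (Option ℤ)) : Timed Bool := do
  let inS ← finalMarks X t tNC
  let vis ← newArr p false
  let r ← descendants G (fun w => inS.get w) Y vis
  anyOf X fun x => do
    let b ← r.1.get x.1
    pure (b && decide (x.2 = t))

/-- Steps 4 and 5 of the algorithm, the test for fork paths. -/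
def forkTest (prv : Table p) (tNC : Arr (Fin p) (Option ℤ)) : Timed Bool := do
  let accY ← accessTimes G prv tNC (Y, t)
  let accX ← forEach X [] fun l x => do
    let a ← accessTimes G prv tNC x
    pure (a :: l)
  anyOf accX fun a =>
    anyOf (List.finRange p) fun F => do
      let e ← tNC.get F
      let s₁ ← a.get F
      let s₂ ← accY.get F
      pure (leTimes e s₁ && leTimes e s₂)

lemma decideIdentifiable_eq : decideIdentifiable G X Y t = (do
    let nxt ← nextTable X
    let prv ← prevTable X
    let tNC ← entranceTimes G X Y t nxt prv
    let direct ← directTest G X Y t tNC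
    if direct then pure false
    else do
      let fork ← forkTest G X Y t prv tNC
      pure (!fork)) := by
  simp only [directTest, forkTest, finalMarks, bind_assoc]
  rfl

variable {G X Y t}

lemma leTimes_iff (a b : Option ℤ) :
    leTimes a b = true ↔ ∃ s s', a = some s ∧ b = some s' ∧ s ≤ s' := by
  rcases a with _ | a <;> rcases b with _ | b <;> simp [leTimes]

lemma leTimes_some_iff (T : Arr (Fin p) (Option ℤ)) (S : Fin p) :
    leTimes (T S) (some t) = true ↔ EnteredBy T S t := by
  simp [leTimes_iff, EnteredBy]

lemma markEntered_val (T : Arr (Fin p) (Option ℤ)) (M : Arr (Fin p) Bool) (a S : Fin p) :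
    (markEntered t T M a).val S = true ↔ M S = true ∨ S = a ∧ EnteredBy T S t := by
  unfold markEntered
  rw [Timed.bind_val, Arr.get_val, ← leTimes_some_iff]
  split <;> by_cases hS : S = a <;> simp_all [Arr.update_apply]

lemma markIntervened_val (M : Arr (Fin p) Bool) (x : Fin p × ℤ) (S : Fin p) :
    (markIntervened t M x).val S = true ↔ M S = true ∨ (S, t) = x := by
  unfold markIntervened
  have hx : (S, t) = x ↔ x.2 = t ∧ S = x.1 := by rw [Prod.ext_iff, and_comm, eq_comm (a := t)]
  split <;> by_cases hS : S = x.1 <;> simp_all [Arr.update_apply]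

lemma finalMarks_val (T : Arr (Fin p) (Option ℤ)) (S : Fin p) :
    (finalMarks X t T).val S = true ↔ EnteredBy T S t ∨ (S, t) ∈ X := by
  have hentered := forEach_prefix_inv (fun pre (M : Arr (Fin p) Bool) =>
      M S = true ↔ S ∈ pre ∧ EnteredBy T S t) (markEntered t T) (List.finRange p)
    (Arr.const false) (by simp) fun pre a M _ hM => by
      rw [markEntered_val, hM, List.mem_append, List.mem_singleton, ← or_and_right]
  simp only [List.mem_finRange, true_and] at hentered
  exact forEach_prefix_inv (fun pre (M : Arr (Fin p) Bool) =>
      M S = true ↔ EnteredBy T S t ∨ (S, t) ∈ pre) (markIntervened t) X _ (by simpa using hentered)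
    fun pre x M _ hM => by
      rw [markIntervened_val, hM, List.mem_append, List.mem_singleton, or_assoc]

/-- The edges of the subgraph of `G` induced by the series marked in `M`, provided that the first
vertex is marked as well. -/
def MarkedEdge (G : SCG p) (M : Arr (Fin p) Bool) (u w : Fin p) : Prop := G.Edge u w ∧ M w = true

lemma directTest_val (T : Arr (Fin p) (Option ℤ)) :
    (directTest G X Y t T).val = true ↔
      (finalMarks X t T).val Y = true ∧
        ∃ x ∈ X, x.2 = t ∧ ReflTransGen (MarkedEdge G (finalMarks X t T).val) Y x.1 := by
  have hval : (directTest G X Y t T).val = (anyOf X fun x => do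
    let b ← (descendants G (fun w => (finalMarks X t T).val.get w) Y
      (Arr.const false)).val.1.get x.1
    pure (b && decide (x.2 = t))).val := rfl
  rw [hval, anyOf_val]
  simp only [Timed.bind_val, Arr.get_val, Timed.pure_val, Bool.and_eq_true, decide_eq_true_eq]
  constructor
  · rintro ⟨x, hx, hmarked, hxt⟩
    obtain ⟨hY, hwalk⟩ := reflTransGen_of_mem_descendants
      (((marked_descendants_iff x.1).1 hmarked).resolve_left (by simp))
    exact ⟨hY, x, hx, hxt, hwalk⟩
  · rintro ⟨hY, x, hx, hxt, hwalk⟩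
    exact ⟨x, hx, marked_descendants_of_reflTransGen (by simp) hY hwalk, hxt⟩

lemma mem_forEach_accessTimes_iff (prv : Table p) (T a : Arr (Fin p) (Option ℤ)) :
    a ∈ (forEach X [] fun l x => do
      let a ← accessTimes G prv T x
      pure (a :: l)).val ↔ ∃ x ∈ X, a = (accessTimes G prv T x).val := by
  refine forEach_prefix_inv (fun pre L => a ∈ L ↔ ∃ x ∈ pre, a = (accessTimes G prv T x).val)
    _ X [] (by simp) fun pre x L _ hL => ?_
  simp only [Timed.bind_val, Timed.pure_val, List.mem_cons, hL, List.mem_append, or_and_right,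
    exists_or, exists_eq_left, List.not_mem_nil, or_false]
  exact or_comm

lemma forkTest_val (prv : Table p) (T : Arr (Fin p) (Option ℤ)) :
    (forkTest G X Y t prv T).val = true ↔ ∃ x ∈ X, ∃ F e s₁ s₂, T F = some e ∧
      (accessTimes G prv T x).val F = some s₁ ∧ e ≤ s₁ ∧
      (accessTimes G prv T (Y, t)).val F = some s₂ ∧ e ≤ s₂ := by
  unfold forkTest
  simp only [Timed.bind_val, anyOf_val, mem_forEach_accessTimes_iff, List.mem_finRange, true_and,
    Arr.get_val, Timed.pure_val, Bool.and_eq_true, leTimes_iff]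
  constructor
  · rintro ⟨_, ⟨x, hx, rfl⟩, F, ⟨e, s₁, he, hs₁, hle₁⟩, ⟨e', s₂, he', hs₂, hle₂⟩⟩
    obtain rfl : e = e' := Option.some.inj (he.symm.trans he')
    exact ⟨x, hx, F, e, s₁, s₂, he, hs₁, hle₁, hs₂, hle₂⟩
  · rintro ⟨x, hx, F, e, s₁, s₂, he, hs₁, hle₁, hs₂, hle₂⟩
    exact ⟨_, ⟨x, hx, rfl⟩, F, ⟨e, s₁, he, hs₁, hle₁⟩, ⟨e, s₂, he, hs₂, hle₂⟩⟩

end Outcome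

/-! ### Walks along the edges of the summary graph -/

section Walks

variable {V : Type*} {E : V → V → Prop} {A N : Set (V × ℤ)}

lemma TimeEdgeFrom.reflTransGen_fst {u w : V × ℤ} (h : ReflTransGen (TimeEdgeFrom E A) u w) :
    ReflTransGen E u.1 w.1 :=
  h.lift Prod.fst fun _ _ h => h.1.1

lemma TimeEdgeFrom.confine {c r z : V × ℤ}
    (hN : ∀ d ∉ A, ReflTransGen (TimeEdgeFrom E Aᶜ) c d → d ∈ N)
    (hcr : ReflTransGen (TimeEdgeFrom E Aᶜ) c r) (hrz : ReflTransGen (TimeEdgeFrom E Aᶜ) r z) :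
    ReflTransGen (TimeEdgeFrom E N) r z := by
  induction hrz with
  | refl => exact .refl
  | tail hrb hbz ih => exact ih.tail ⟨hbz.1, hN _ hbz.2 (hcr.trans hrb)⟩

lemma TimeEdgeFrom.of_start_le {S : V} {s s' : ℤ} {z : V × ℤ} (hs : s' ≤ s) (hS : (S, s') ∈ A)
    (h : TransGen (TimeEdgeFrom E A) (S, s) z) : TransGen (TimeEdgeFrom E A) (S, s') z := by
  obtain ⟨w, hSw, hwz⟩ := TransGen.head'_iff.1 h
  exact TransGen.head' ⟨⟨hSw.1.1, hs.trans hSw.1.2⟩, hS⟩ hwz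

lemma TimeEdgeFrom.avoid_end {r y : V × ℤ} (hry : r ≠ y)
    (h : ReflTransGen (TimeEdgeFrom E N) r y) : TransGen (TimeEdgeFrom E (N \ {y})) r y := by
  induction h using ReflTransGen.head_induction_on with
  | refl => exact absurd rfl hry
  | @head a b hab _ ih =>
    by_cases hb : b = y
    · exact .single ⟨hb ▸ hab.1, hab.2, hry⟩
    · exact .head ⟨hab.1, hab.2, hry⟩ (ih hb)

lemma exists_walk_to_mem_or_walk {S S' : V} (s : ℤ) (h : ReflTransGen E S S') :
    (∃ x ∈ A, ReflTransGen (TimeEdgeFrom E Aᶜ) (S, s) x) ∨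
      ReflTransGen (TimeEdgeFrom E Aᶜ) (S, s) (S', s) := by
  induction h with
  | refl => exact Or.inr .refl
  | @tail b c _ hbc ih =>
    rcases ih with ih | ih
    · exact Or.inl ih
    · by_cases hb : (b, s) ∈ A
      · exact Or.inl ⟨_, hb, ih⟩
      · exact Or.inr (ih.tail ⟨⟨hbc, le_rfl⟩, hb⟩)

lemma exists_walk_to_mem {S S' : V} {s : ℤ} (h : ReflTransGen E S S') (hS' : (S', s) ∈ A) :
    ∃ x ∈ A, ReflTransGen (TimeEdgeFrom E Aᶜ) (S, s) x :=
  (exists_walk_to_mem_or_walk s h).elim id fun hwalk => ⟨_, hS', hwalk⟩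

lemma exists_entrance {x : V × ℤ} (hx : x ∈ A) {D : V} {s : ℤ} (hxs : x.2 ≤ s)
    (hD : (D, s) ∉ A) (h : TransGen E x.1 D) :
    ∃ x' ∈ A, ∃ c ∉ A, TimeEdge E x' c ∧ ReflTransGen (TimeEdgeFrom E Aᶜ) c (D, s) := by
  induction h with
  | @single b hxb => exact ⟨x, hx, (b, s), hD, ⟨hxb, hxs⟩, .refl⟩
  | @tail b c _ hbc ih =>
    by_cases hb : (b, s) ∈ A
    · exact ⟨(b, s), hb, (c, s), hD, ⟨hbc, le_rfl⟩, .refl⟩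
    · obtain ⟨x', hx', c', hc', hxc', hwalk⟩ := ih hb
      exact ⟨x', hx', c', hc', hxc', hwalk.tail ⟨⟨hbc, le_rfl⟩, hb⟩⟩

/-- Every vertex outside `A` reached from the entrance `c` is forbidden in some candidate, hence
no admissible set can block the walk from `x` back to `r` and on to `y`. -/
theorem not_isIdentifiable_of_fork {x' c r x y : V × ℤ} (hx' : x' ∈ A) (hx'c : TimeEdge E x' c)
    (hcr : ReflTransGen (TimeEdgeFrom E Aᶜ) c r) (hx : x ∈ A) (hy : y ∉ A)
    (hrx : ReflTransGen (TimeEdgeFrom E Aᶜ) r x) (hry : ReflTransGen (TimeEdgeFrom E Aᶜ) r y) :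
    ¬ IsIdentifiable E A {y} := by
  rintro ⟨Z, hZA, hZy, hcrit⟩
  set N : Set (V × ℤ) := {d | d ∉ A ∧ ReflTransGen (TimeEdgeFrom E Aᶜ) c d}
  have hmem : ∀ d ∉ A, ReflTransGen (TimeEdgeFrom E Aᶜ) c d → d ∈ N := fun d hd hcd => ⟨hd, hcd⟩
  have hNA : Disjoint N A := Set.disjoint_left.2 fun d hd => hd.1
  have hZN : Disjoint Z N := Set.disjoint_left.2 fun d hdZ hd => by
    obtain ⟨F, hF, hdF⟩ := exists_candidate_mem_forb hx' hy hd.1 hx'c (hcr.trans hry) hd.2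
    exact Set.disjoint_left.1 (hcrit F hF).1 hdF hdZ
  exact not_commonAdjustment_of_fork hNA hx hy (TimeEdgeFrom.confine hmem hcr hry)
    (TimeEdgeFrom.confine hmem hcr hrx) hZA hZy hZN hcrit

end Walks

/-! ### Correctness -/

section Correctness

variable {p : ℕ} {G : SCG p} {X : List (Fin p × ℤ)} {Y : Fin p} {t : ℤ}
  {T : Arr (Fin p) (Option ℤ)} {prv nxt : Table p}

/-- One of the two tests of the algorithm succeeds: the effect is declared non-identifiable. -/
def DetectsFork (G : SCG p) (X : List (Fin p × ℤ)) (Y : Fin p) (t : ℤ) (prv : Table p)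
    (T : Arr (Fin p) (Option ℤ)) : Prop :=
  (directTest G X Y t T).val = true ∨ (forkTest G X Y t prv T).val = true

lemma decideIdentifiable_val : (decideIdentifiable G X Y t).val = true ↔
    ¬ DetectsFork G X Y t (prevTable X).val
      (entranceTimes G X Y t (nextTable X).val (prevTable X).val).val := by
  rw [decideIdentifiable_eq, DetectsFork]
  simp only [Timed.bind_val]
  split <;> simp only [Timed.bind_val, Timed.pure_val] <;> simp_all

theorem not_isIdentifiable_of_directTest (hnxt : IsNextTable X nxt) (hY : (Y, t) ∉ X)
    (h : (directTest G X Y t (entranceTimes G X Y t nxt prv).val).val = true) :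
    ¬ IsIdentifiable G.Edge {x | x ∈ X} {(Y, t)} := by
  rw [directTest_val, finalMarks_val] at h
  obtain ⟨hmarked, x, hx, rfl, hYx⟩ := h
  obtain ⟨e, he, het⟩ := hmarked.resolve_right hY
  obtain ⟨-, x₀, hx₀, hx₀e, hx₀Y⟩ := entranceTimes_sound hnxt he
  obtain ⟨x', hx', c, -, hx'c, hcY⟩ :=
    exists_entrance (A := {x | x ∈ X}) hx₀ (hx₀e.trans het) hY hx₀Y
  obtain ⟨x'', hx'', hYx''⟩ := exists_walk_to_mem (A := {x | x ∈ X})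
    (ReflTransGen.mono (fun _ _ h => h.1) _ _ hYx) hx
  exact not_isIdentifiable_of_fork hx' hx'c hcY hx'' hY hYx'' .refl

theorem not_isIdentifiable_of_forkTest (hnxt : IsNextTable X nxt) (hprv : IsPrevTable X prv)
    (hY : (Y, t) ∉ X)
    (h : (forkTest G X Y t prv (entranceTimes G X Y t nxt prv).val).val = true) :
    ¬ IsIdentifiable G.Edge {x | x ∈ X} {(Y, t)} := by
  set T := (entranceTimes G X Y t nxt prv).val
  rw [forkTest_val] at h
  obtain ⟨x, hx, F, e, s₁, s₂, he, hs₁, hle₁, hs₂, hle₂⟩ := h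
  obtain ⟨hFe, x₀, hx₀, hx₀e, hx₀F⟩ := entranceTimes_sound hnxt he
  obtain ⟨x', hx', c, -, hx'c, hcF⟩ := exists_entrance (A := {x | x ∈ X}) hx₀ hx₀e hFe hx₀F
  have hwalk : ∀ v s, (accessTimes G prv T v).val F = some s → e ≤ s →
      ReflTransGen (TimeEdgeFrom G.Edge {x | x ∈ X}ᶜ) (F, e) v := by
    intro v s hs hes
    have hsub : ncSet X T \ {v} ⊆ {x | x ∈ X}ᶜ := fun u hu => hu.1.1
    exact (TimeEdgeFrom.of_start_le hes hFe (TransGen.mono (fun _ _ h => h.mono hsub) _ _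
      (accessTimes_sound hprv hs))).to_reflTransGen
  exact not_isIdentifiable_of_fork hx' hx'c hcF hx hY (hwalk x s₁ hs₁ hle₁) (hwalk _ s₂ hs₂ hle₂)

lemma reflTransGen_markedEdge {z : Fin p × ℤ}
    (h : ReflTransGen (TimeEdgeFrom G.Edge (ncSet X T)) (Y, t) z) (hzt : z.2 ≤ t)
    (hz : z ∈ ncSet X T ∨ z ∈ X) :
    ReflTransGen (MarkedEdge G (finalMarks X t T).val) Y z.1 := by
  induction h with
  | refl => exact .refl
  | @tail b c hb hbc ih =>
    refine (ih (hbc.1.2.trans hzt) (Or.inl hbc.2)).tail ⟨hbc.1.1, ?_⟩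
    rw [finalMarks_val]
    rcases hz with ⟨-, hentered⟩ | hcX
    · exact Or.inl (hentered.mono hzt)
    · have hct : c.2 = t := hzt.antisymm ((TimeEdgeFrom.time_le hb).trans hbc.1.2)
      exact Or.inr (hct ▸ hcX)

lemma detectsFork_of_walks (hprv : IsPrevTable X prv) (hXt : ∀ x ∈ X, x.2 ≤ t)
    {r x : Fin p × ℤ} (hr : r ∈ ncSet X T) (hx : x ∈ X)
    (hrx : ReflTransGen (TimeEdgeFrom G.Edge (ncSet X T)) r x)
    (hry : ReflTransGen (TimeEdgeFrom G.Edge (ncSet X T)) r (Y, t)) :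
    DetectsFork G X Y t prv T := by
  by_cases hrY : r = (Y, t)
  · subst hrY
    exact Or.inl <| (directTest_val T).2 ⟨(finalMarks_val T Y).2 (Or.inl hr.2), x, hx,
      (hXt x hx).antisymm (TimeEdgeFrom.time_le hrx),
      reflTransGen_markedEdge hrx (hXt x hx) (Or.inr hx)⟩
  · obtain ⟨hrX, e, he, hle⟩ := hr
    have hrx_ne : r ≠ x := fun h => hrX (h ▸ hx)
    obtain ⟨s₁, hs₁, hle₁⟩ := accessTimes_complete hprv (TimeEdgeFrom.avoid_end hrx_ne hrx)
    obtain ⟨s₂, hs₂, hle₂⟩ := accessTimes_complete hprv (TimeEdgeFrom.avoid_end hrY hry)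
    exact Or.inr <| (forkTest_val prv T).2
      ⟨x, hx, r.1, e, s₁, s₂, he, hs₁, hle.trans hle₁, hs₂, hle.trans hle₂⟩

lemma detectsFork_of_root (hprv : IsPrevTable X prv) (hXt : ∀ x ∈ X, x.2 ≤ t)
    {r : Fin p × ℤ} (hrX : r ∉ X)
    (hN : ∀ d ∉ X, ReflTransGen (TimeEdgeFrom G.Edge {x | x ∈ X}ᶜ) r d → d ∈ ncSet X T)
    (hx : ∃ x ∈ {x | x ∈ X}, ReflTransGen (TimeEdgeFrom G.Edge {x | x ∈ X}ᶜ) r x)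
    (hry : ReflTransGen (TimeEdgeFrom G.Edge {x | x ∈ X}ᶜ) r (Y, t)) :
    DetectsFork G X Y t prv T := by
  obtain ⟨x, hx, hrx⟩ := hx
  exact detectsFork_of_walks hprv hXt (hN r hrX .refl) hx
    (TimeEdgeFrom.confine hN .refl hrx) (TimeEdgeFrom.confine hN .refl hry)

namespace CyclicEntrance

variable {C x : Fin p} {τ : ℤ}

lemma reflTransGen_avoiding (h : CyclicEntrance G X Y t T C τ x) {z : Fin p × ℤ}
    (hz : ReflTransGen (TimeEdgeFrom G.Edge {x | x ∈ X}ᶜ) (C, τ) z) (hzX : z ∉ X) (hzτ : z.2 = τ) :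
    ReflTransGen (fun u w => G.Edge u w ∧ w ≠ x) C z.1 := by
  induction hz with
  | refl => exact .refl
  | @tail b c hb hbc ih =>
    have hbτ : b.2 = τ := (hbc.1.2.trans hzτ.le).antisymm (TimeEdgeFrom.time_le hb)
    refine (ih hbc.2 hbτ).tail ⟨hbc.1.1, fun hcx => hzX ?_⟩
    rw [show c = (x, τ) from Prod.ext hcx hzτ]
    exact h.skip_mem

lemma mem_ncSet_of_walk (h : CyclicEntrance G X Y t T C τ x) {d : Fin p × ℤ} (hd : d ∉ X)
    (hwalk : ReflTransGen (TimeEdgeFrom G.Edge {x | x ∈ X}ᶜ) (C, τ) d) : d ∈ ncSet X T := by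
  have hle : τ ≤ d.2 := TimeEdgeFrom.time_le hwalk
  rcases hle.lt_or_eq with hlt | heq
  · exact h.mem_ncSet d hd (TimeEdgeFrom.reflTransGen_fst hwalk) hlt
  · exact h.mem_ncSet_avoiding d hd (h.reflTransGen_avoiding hwalk hd heq.symm) hle

lemma detectsFork_of_walk (h : CyclicEntrance G X Y t T C τ x) (hprv : IsPrevTable X prv)
    (hXt : ∀ x ∈ X, x.2 ≤ t)
    (hwalk : ReflTransGen (TimeEdgeFrom G.Edge {x | x ∈ X}ᶜ) (C, τ) (Y, t)) :
    DetectsFork G X Y t prv T :=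
  detectsFork_of_root hprv hXt h.notMem (fun _ => h.mem_ncSet_of_walk)
    (exists_walk_to_mem h.reaches h.skip_mem) hwalk

/-- If the entry is on the target series itself, then either the walk from `C` to `x` at time `t`
meets an intervention, or it closes to a cycle that can be entered at time `τ`. -/
lemma detectsFork_of_eq (h : CyclicEntrance G X Y t T Y τ x) (hprv : IsPrevTable X prv)
    (hXt : ∀ x ∈ X, x.2 ≤ t) (hY : (Y, t) ∉ X) (hτ : τ < t) : DetectsFork G X Y t prv T := by
  have hN : ∀ d ∉ X, ReflTransGen (TimeEdgeFrom G.Edge {x | x ∈ X}ᶜ) (Y, t) d → d ∈ ncSet X T :=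
    fun d hd hwalk => h.mem_ncSet d hd (TimeEdgeFrom.reflTransGen_fst hwalk)
      (hτ.trans_le (TimeEdgeFrom.time_le hwalk))
  by_cases hmeets : ∃ x ∈ {x | x ∈ X}, ReflTransGen (TimeEdgeFrom G.Edge {x | x ∈ X}ᶜ) (Y, t) x
  · exact detectsFork_of_root hprv hXt hY hN hmeets .refl
  · have hYx := (exists_walk_to_mem_or_walk t h.reaches).resolve_left hmeets
    have hxX : (x, t) ∉ X := fun hx => hmeets ⟨_, hx, hYx⟩
    exact h.detectsFork_of_walk hprv hXt <| TransGen.to_reflTransGen <|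
      TimeEdgeFrom.of_start_le hτ.le h.notMem (TransGen.tail' hYx ⟨⟨h.edge, le_rfl⟩, hxX⟩)

theorem detectsFork (h : CyclicEntrance G X Y t T C τ x) (hprv : IsPrevTable X prv)
    (hXt : ∀ x ∈ X, x.2 ≤ t) (hY : (Y, t) ∉ X) : DetectsFork G X Y t prv T := by
  by_cases hCY : C = Y
  · subst hCY
    rcases h.time_le.lt_or_eq with hlt | rfl
    · exact h.detectsFork_of_eq hprv hXt hY hlt
    · exact h.detectsFork_of_walk hprv hXt .refl
  · exact h.detectsFork_of_walk hprv hXt (h.walk hCY)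

end CyclicEntrance

theorem RegularEntrance.commonAdjustmentCriterion (h : RegularEntrance G X Y t T)
    (hprv : IsPrevTable X prv) (hXt : ∀ x ∈ X, x.2 ≤ t) (hY : (Y, t) ∉ X)
    (hYT : (Y, t) ∈ ncSet X T) (hfork : ¬ DetectsFork G X Y t prv T) :
    CommonAdjustmentCriterion G.Edge {x | x ∈ X} {(Y, t)} ({x | x ∈ X} ∪ ncSet X T)ᶜ := by
  intro F hF
  have hclosed : ∀ u ∈ ncSet X T, ∀ w ∉ {x | x ∈ X}, ReflTransGen F.Edge u w → w ∈ ncSet X T :=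
    fun u hu w hw huw => h.closed u hu w hw (huw.lift Prod.fst fun _ _ hab => (hF.timeEdge hab).1)
      (by simpa [reflTransGen_eq_self] using huw.lift Prod.snd F.forward)
  refine ⟨Set.disjoint_compl_right_iff_subset.2 (forb_subset_union hclosed ?_ hY), ?_⟩
  · intro x hx c hc hxc hcY
    exact h.entrance x hx c hc (hF.timeEdge hxc)
      (ReflTransGen.mono (fun _ _ huw => ⟨hF.timeEdge huw.1, huw.2⟩) _ _ hcY)
  · intro π hπ hcausal
    by_contra hblocks
    obtain ⟨r, hr, x, hx, hrx, hry⟩ :=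
      IsOpenProperPath.exists_fork F.asymm ⟨hπ, hblocks⟩ hY hYT hclosed hcausal
    exact hfork (detectsFork_of_walks hprv hXt hr hx
      (ReflTransGen.mono (fun _ _ huw => ⟨hF.timeEdge huw.1, huw.2⟩) _ _ hrx)
      (ReflTransGen.mono (fun _ _ huw => ⟨hF.timeEdge huw.1, huw.2⟩) _ _ hry))

theorem RegularEntrance.isIdentifiable (h : RegularEntrance G X Y t T)
    (hprv : IsPrevTable X prv) (hXt : ∀ x ∈ X, x.2 ≤ t) (hY : (Y, t) ∉ X)
    (hfork : ¬ DetectsFork G X Y t prv T) {x : Fin p × ℤ} (hx : x ∈ X)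
    (hxY : TransGen G.Edge x.1 Y) : IsIdentifiable G.Edge {x | x ∈ X} {(Y, t)} := by
  obtain ⟨x', hx', c, hc, hx'c, hcY⟩ :=
    exists_entrance (A := {x | x ∈ X}) hx (hXt x hx) hY hxY
  have hYT : (Y, t) ∈ ncSet X T := h.closed c (h.entrance x' hx' c hc hx'c hcY) _ hY
    (TimeEdgeFrom.reflTransGen_fst hcY) (TimeEdgeFrom.time_le hcY)
  exact ⟨({x | x ∈ X} ∪ ncSet X T)ᶜ, Set.disjoint_left.2 fun w hw hwX => hw (Or.inl hwX),
    Set.disjoint_singleton_right.2 fun hw => hw (Or.inr hYT),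
    h.commonAdjustmentCriterion hprv hXt hY hYT hfork⟩

lemma isIdentifiable_empty {V : Type*} (E : V → V → Prop) (B : Set (V × ℤ)) :
    IsIdentifiable E ∅ B := by
  refine ⟨∅, Set.empty_disjoint _, Set.empty_disjoint _, fun F _ =>
    ⟨Set.disjoint_empty _, fun π hπ => ?_⟩⟩
  obtain ⟨x, hx, -⟩ := hπ.2.1
  exact absurd hx (Set.notMem_empty x)

lemma isIdentifiable_of_not_transGen {V : Type*} {E : V → V → Prop} {A : Set (V × ℤ)}
    {y : V × ℤ} (hA : ∀ x ∈ A, x.1 = y.1) (hyA : y ∉ A) (hcyc : ¬ TransGen E y.1 y.1) :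
    IsIdentifiable E A {y} :=
  ⟨{w | TransGen E w.1 y.1}, Set.disjoint_left.2 fun w hw hwA => hcyc (hA w hwA ▸ hw),
    Set.disjoint_singleton_right.2 hcyc, commonAdjustment_of_not_transGen hA hyA hcyc⟩

theorem isIdentifiable_of_not_detectsFork (hnxt : IsNextTable X nxt) (hprv : IsPrevTable X prv)
    (hY : (Y, t) ∉ X) (hXt : ∀ x ∈ X, x.2 ≤ t) (hXY : ∀ x ∈ X, Y ∈ Desc G.Edge x.1)
    (hfork : ¬ DetectsFork G X Y t prv (entranceTimes G X Y t nxt prv).val) :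
    IsIdentifiable G.Edge {x | x ∈ X} {(Y, t)} := by
  by_cases hcausal : ∃ x ∈ X, TransGen G.Edge x.1 Y
  · obtain ⟨x, hx, hxY⟩ := hcausal
    rcases regular_or_cyclic_entranceTimes hnxt hprv with hreg | ⟨C, τ, x, hcyc⟩
    · exact hreg.isIdentifiable hprv hXt hY hfork hx hxY
    · exact absurd (hcyc.detectsFork hprv hXt hY) hfork
  have hXeq : ∀ x ∈ X, x.1 = Y := fun x hx =>
    ((reflTransGen_iff_eq_or_transGen.1 (hXY x hx)).resolve_right
      fun hxY => hcausal ⟨x, hx, hxY⟩).symm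
  rcases Set.eq_empty_or_nonempty {x | x ∈ X} with hX | ⟨x, hx⟩
  · exact hX ▸ isIdentifiable_empty G.Edge {(Y, t)}
  · exact isIdentifiable_of_not_transGen hXeq hY fun hcyc => hcausal ⟨x, hx, hXeq x hx ▸ hcyc⟩

theorem isIdentifiable_iff (G : SCG p) (X : List (Fin p × ℤ)) (Y : Fin p) (t : ℤ)
    (hY : (Y, t) ∉ X) (hXt : ∀ x ∈ X, x.2 ≤ t) (hXY : ∀ x ∈ X, Y ∈ Desc G.Edge x.1) :
    IsIdentifiable G.Edge {x | x ∈ X} {(Y, t)} ↔ (decideIdentifiable G X Y t).val = true := by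
  have hnxt := isNextTable_nextTable X
  have hprv := isPrevTable_prevTable X
  rw [decideIdentifiable_val]
  refine ⟨fun hid hfork => ?_, isIdentifiable_of_not_detectsFork hnxt hprv hY hXt hXY⟩
  rcases hfork with hdirect | hfork
  · exact not_isIdentifiable_of_directTest hnxt hY hdirect hid
  · exact not_isIdentifiable_of_forkTest hnxt hprv hY hfork hid

end Correctness

/-! ### Running time of the searches -/

section EdgeCount

variable {p : ℕ} (G : SCG p)

lemma sum_length_ch : ∑ v, (G.ch v).length = G.numEdges := by
  have hcard (v) : (G.ch v).length = ∑ w, if G.Edge v w then 1 else 0 := by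
    rw [← Finset.card_filter, ← List.toFinset_card_of_nodup (G.ch_nodup v)]
    congr 1
    ext w
    rw [List.mem_toFinset, Finset.mem_filter_univ, SCG.Edge]
  simp only [hcard, SCG.numEdges, Finset.card_filter, ← Finset.univ_product_univ,
    Finset.sum_product]

lemma sum_length_pa : ∑ v, (G.pa v).length = G.numEdges := by
  have hcard (v) : (G.pa v).length = ∑ u, if G.Edge u v then 1 else 0 := by
    rw [← Finset.card_filter, ← List.toFinset_card_of_nodup (G.pa_nodup v)]
    congr 1
    ext u
    rw [List.mem_toFinset, Finset.mem_filter_univ, G.mem_pa, SCG.Edge]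
  simp only [hcard, SCG.numEdges, Finset.card_filter, ← Finset.univ_product_univ,
    Finset.sum_product]
  exact Finset.sum_comm

lemma sum_affine (a b : ℕ) (f : Fin p → ℕ) : ∑ v, (a + b * f v) = a * p + b * ∑ v, f v := by
  rw [Finset.sum_add_distrib, ← Finset.mul_sum]
  simp [mul_comm]

end EdgeCount

section SearchCost

variable {p : ℕ} (G : SCG p) {best : Fin p → ℤ → Timed (Option ℤ)}

/-- The number of steps that the backward search spends on a vertex of the series `P`, provided
that `best` takes at most `B` steps and the queue has at most `M` elements: one removal from the
queue and the treatment of the parents. -/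
def searchWeight (B M : ℕ) (P : Fin p) : ℕ :=
  (2 * Nat.log 2 (M + 1) + 3) + (B + Nat.log 2 (M + 1) + 6) * (G.pa P).length

lemma sum_searchWeight (B M : ℕ) : ∑ P, searchWeight G B M P =
    (2 * Nat.log 2 (M + 1) + 3) * p + (B + Nat.log 2 (M + 1) + 6) * G.numEdges := by
  simp only [searchWeight, sum_affine, sum_length_pa]

variable {B M : ℕ} {σ : SearchState p}

lemma relax_cost_le (hB : ∀ P s, (best P s).cost ≤ B) (hσ : σ.queue.Leftist)
    (hM : σ.potential 1 ≤ M) (s : ℤ) (P : Fin p) :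
    (relax best s σ P).cost ≤ B + Nat.log 2 (M + 1) + 5 := by
  have hbest := hB P s
  unfold relax
  rw [Timed.bind_cost, Arr.get_cost, Arr.get_val]
  split
  · simp only [Timed.pure_cost]
    omega
  · simp only [Timed.bind_cost, Arr.set_cost]
    cases (best P s).val with
    | none =>
      simp only [Timed.pure_cost]
      omega
    | some τ =>
      have hinsert := Heap.insert_cost_le later (P, τ) hσ ((card_queue_le_potential σ).trans hM)
      simp only [Timed.bind_cost, Timed.pure_cost]
      omega

lemma forEach_relax_cost_le (hB : ∀ P s, (best P s).cost ≤ B) (hσ : σ.queue.Leftist)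
    (hM : σ.potential 1 ≤ M) (w : Fin p → ℕ) (s : ℤ) (l : List (Fin p)) :
    ((forEach l σ (relax best s)).val.queue.Leftist ∧
      (forEach l σ (relax best s)).val.potential 1 ≤ M) ∧
    (forEach l σ (relax best s)).cost + (forEach l σ (relax best s)).val.potential w ≤
      (B + Nat.log 2 (M + 1) + 6) * l.length + σ.potential w := by
  have h := forEach_amortized (fun _ σ => σ.queue.Leftist ∧ σ.potential 1 ≤ M)
    (SearchState.potential w) (fun _ => B + Nat.log 2 (M + 1) + 5) (f := relax best s) (l := l)
    ⟨hσ, hM⟩ fun pre P σ _ ⟨hleft, hpot⟩ =>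
      ⟨⟨leftist_queue_relax hleft, (potential_relax_le best 1 s σ P).trans hpot⟩,
        add_le_add (relax_cost_le hB hleft hpot s P) (potential_relax_le best w s σ P)⟩
  simpa [mul_comm] using h

theorem search_cost_le (hB : ∀ P s, (best P s).cost ≤ B) (k : ℕ) (hσ : σ.queue.Leftist)
    (hM : σ.potential 1 ≤ M) :
    (search G best k σ).cost ≤ σ.potential (searchWeight G B M) + 3 := by
  induction k generalizing σ with
  | zero => simp [search]
  | succ k ih =>
    rw [search_succ]
    simp only [Timed.bind_cost, step_cost]
    cases hp : (σ.queue.pop later).val with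
    | none =>
      have hempty := (Heap.pop_eq_none_iff _ _).1 hp
      have hpop := Heap.pop_cost_le (before := later) hσ (n := 0) (by rw [hempty]; simp)
      simp only [zero_add, Nat.log_one_right] at hpop
      simp only [Timed.pure_cost]
      omega
    | some uQ =>
      obtain ⟨u, Q⟩ := uQ
      have hpop := Heap.pop_cost_le (before := later) hσ ((card_queue_le_potential σ).trans hM)
      have hM' : (⟨Q, σ.seen, σ.val⟩ : SearchState p).potential 1 ≤ M :=
        (Nat.le_add_left _ _).trans ((potential_of_pop hp).symm.le.trans hM)
      obtain ⟨⟨hleft, hpot⟩, hround⟩ := forEach_relax_cost_le (σ := ⟨Q, σ.seen, σ.val⟩) hB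
        (hσ.of_pop hp) hM' (searchWeight G B M) u.2 (G.pa u.1)
      have hrest := ih hleft hpot
      rw [potential_of_pop hp, searchWeight]
      simp only [Timed.bind_cost]
      omega

lemma SearchState.IsInitial.search_cost_le {v : Fin p × ℤ} (hσ : σ.IsInitial v)
    (hleft : σ.queue.Leftist) (hB : ∀ P s, (best P s).cost ≤ 3) (k : ℕ) :
    (search G best k σ).cost ≤ (4 * Nat.log 2 (p + 3) + 18) * (p + G.numEdges) + 3 := by
  have hsearch := CommonAdjustment.search_cost_le G hB k hleft hσ.potential_one_le
  have hpot := hσ.potential_le (searchWeight G 3 (p + 2))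
  have hweight : searchWeight G 3 (p + 2) v.1 ≤ ∑ P, searchWeight G 3 (p + 2) P :=
    Finset.single_le_sum (fun _ _ => Nat.zero_le _) (Finset.mem_univ v.1)
  rw [sum_searchWeight] at hpot hweight
  simp only [add_assoc, Nat.reduceAdd] at hpot hweight
  refine (hsearch.trans (add_le_add_left (hpot.trans (add_le_add_left hweight _)) 3)).trans ?_
  nlinarith [Nat.zero_le (Nat.log 2 (p + 3) * G.numEdges)]

lemma insert_leaf_cost_le (v : Fin p × ℤ) : (Heap.leaf.insert later v).cost ≤ 2 := by
  simpa using Heap.insert_cost_le later v (h := Heap.leaf) trivial (n := 0) (by simp)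

lemma ancestorTimes_cost_le (prv : Table p) (Y : Fin p) (t : ℤ) :
    (ancestorTimes G prv Y t).cost ≤
      (4 * Nat.log 2 (p + 3) + 18) * (p + G.numEdges) + 2 * p + 9 := by
  have hinsert := insert_leaf_cost_le (Y, t)
  have hsearch := (SearchState.isInitial_update Y t).search_cost_le G
    (Heap.Leftist.insert later (Y, t) (h := Heap.leaf) trivial)
    (best := fun P s => do
      let τ ← free prv P s
      pure (some τ)) (fun P s => by simp) (p + 2)
  unfold ancestorTimes
  simp only [Timed.bind_cost, newArr_cost, Arr.set_cost, newArr_val, Arr.set_val]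
  omega

lemma accessTimes_cost_le (prv : Table p) (tNC : Arr (Fin p) (Option ℤ)) (v : Fin p × ℤ) :
    (accessTimes G prv tNC v).cost ≤
      (4 * Nat.log 2 (p + 3) + 18) * (p + G.numEdges) + 2 * p + 9 := by
  have hinsert := insert_leaf_cost_le v
  have hsearch := (SearchState.isInitial_const v).search_cost_le G
    (Heap.Leftist.insert later v (h := Heap.leaf) trivial) (accessBest_cost_le prv tNC v) (p + 2)
  have hcost : (accessTimes G prv tNC v).cost = (Heap.leaf.insert later v).cost +
      ((p + 1) + ((p + 1) + (search G (accessBest prv tNC v) (p + 2)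
        ⟨(Heap.leaf.insert later v).val, Arr.const false, Arr.const none⟩).cost)) := rfl
  omega

end SearchCost

section ExploreCost

variable {p : ℕ} (G : SCG p) {ok : Fin p → Timed Bool}

/-- The number of steps that a forward search spends on a series, including eight steps for the
later treatment of the series in the list of results. -/
def exploreWeight (v : Fin p) : ℕ := 9 + 4 * (G.ch v).length

/-- The number of steps that forward searches which share the marks `vis` can still take. -/
def unmarkedWeight (vis : Arr (Fin p) Bool) : ℕ := ∑ P, if vis P then 0 else exploreWeight G P

lemma unmarkedWeight_le (vis : Arr (Fin p) Bool) :
    unmarkedWeight G vis ≤ 9 * p + 4 * G.numEdges := by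
  rw [← sum_length_ch G, ← sum_affine]
  exact Finset.sum_le_sum fun P _ => by split <;> simp [exploreWeight]

lemma enter_cost_le (hok : ∀ w, (ok w).cost ≤ 1) (σ : List (Fin p) × Arr (Fin p) Bool)
    (w : Fin p) : (enter ok σ w).cost ≤ 3 := by
  have hokw := hok w
  unfold enter
  simp only [Timed.bind_cost, Arr.get_cost]
  split
  · simp only [Timed.pure_cost]
    omega
  · simp only [Timed.bind_cost, Arr.set_cost, Timed.pure_cost]
    omega

lemma stackPotential_exploreWeight (stack : List (Fin p)) (vis : Arr (Fin p) Bool) :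
    stackPotential (exploreWeight G) (stack, vis) =
      (stack.map (exploreWeight G)).sum + unmarkedWeight G vis := rfl

lemma explore_cost_le (hok : ∀ w, (ok w).cost ≤ 1) (k : ℕ) (stack : List (Fin p))
    (vis : Arr (Fin p) Bool) (acc : List (Fin p)) :
    (explore G ok k stack vis acc).cost + 8 * (explore G ok k stack vis acc).val.2.length +
      unmarkedWeight G (explore G ok k stack vis acc).val.1 ≤
      1 + 8 * acc.length + stackPotential (exploreWeight G) (stack, vis) := by
  induction k generalizing stack vis acc with
  | zero =>
    simp only [explore, Timed.pure_cost, Timed.pure_val, stackPotential_exploreWeight]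
    omega
  | succ k ih =>
    cases stack with
    | nil => simp [explore, stackPotential_exploreWeight]
    | cons v stack =>
      have hround := forEach_cost_le 3 (enter ok) (G.ch v) (stack, vis)
        fun w σ => enter_cost_le hok σ w
      have hrest := ih (forEach (G.ch v) (stack, vis) (enter ok)).val.1
        (forEach (G.ch v) (stack, vis) (enter ok)).val.2 (v :: acc)
      have hpop : stackPotential (exploreWeight G) (v :: stack, vis) =
          9 + 4 * (G.ch v).length + stackPotential (exploreWeight G) (stack, vis) := by
        simp only [stackPotential, List.map_cons, List.sum_cons, exploreWeight]
        ring
      rw [Prod.mk.eta, stackPotential_forEach_enter, List.length_cons] at hrest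
      rw [explore_cons]
      simp only [Timed.bind_cost, Timed.bind_val, step_cost]
      omega

lemma descendants_cost_le (hok : ∀ w, (ok w).cost ≤ 1) (C : Fin p) (vis : Arr (Fin p) Bool) :
    (descendants G ok C vis).cost + 8 * (descendants G ok C vis).val.2.length +
      unmarkedWeight G (descendants G ok C vis).val.1 ≤ 4 + unmarkedWeight G vis := by
  have hokC := hok C
  by_cases h : vis C = false ∧ (ok C).val = true
  · have hexplore := explore_cost_le G hok (p + 1) [C] (vis.update C true) []
    have hmark := sum_unmarked_update (exploreWeight G) h.1
    have hcost : (descendants G ok C vis).cost = 1 + ((ok C).cost + (1 +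
        (explore G ok (p + 1) [C] (vis.update C true) []).cost)) := by
      unfold descendants
      simp [h.1, h.2]
    rw [descendants_val_of h.1 h.2, hcost]
    simp only [stackPotential_exploreWeight, List.map_singleton, List.sum_singleton,
      List.length_nil, unmarkedWeight] at hexplore ⊢
    omega
  · have hcost : (descendants G ok C vis).cost = 1 + (ok C).cost := by
      unfold descendants
      rcases hvis : vis C <;> rcases hval : (ok C).val <;> simp_all
    rw [descendants_val_of_not h, hcost]
    simp only [List.length_nil]
    omega

lemma assign_cost_le (nxt : Table p) (s : ℤ) (ds : List (Fin p)) (T : Arr (Fin p) (Option ℤ)) :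
    (assign nxt s ds T).cost ≤ ds.length * 4 := by
  refine forEach_cost_le 3 _ ds T fun D T' => ?_
  rw [Timed.bind_cost, Arr.get_cost, Arr.get_val]
  cases T' D <;> simp

lemma entranceStep_cost_le (nxt : Table p) (σ : EntranceState p) (e : Entry p) :
    (entranceStep G nxt σ e).cost +
      (unmarkedWeight G (entranceStep G nxt σ e).val.vis₁ +
        unmarkedWeight G (entranceStep G nxt σ e).val.vis₂) ≤
      8 + (unmarkedWeight G σ.vis₁ + unmarkedWeight G σ.vis₂) := by
  have hdesc₂ := descendants_cost_le G (ok := fun _ => pure true) (by simp) e.C σ.vis₂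
  unfold entranceStep
  cases e.skip with
  | none =>
    have hassign := assign_cost_le nxt e.time
      (descendants G (fun _ => pure true) e.C σ.vis₂).val.2 σ.tNC
    simp only [Timed.bind_cost, Timed.bind_val, Timed.pure_cost, Timed.pure_val]
    omega
  | some x =>
    have hdesc₁ := descendants_cost_le G (ok := fun w => pure (decide (w ≠ x))) (by simp) e.C
      σ.vis₁
    set r₁ := descendants G (fun w => pure (decide (w ≠ x))) e.C σ.vis₁
    set r₂ := descendants G (fun _ => pure true) e.C σ.vis₂
    have hassign₁ := assign_cost_le nxt e.time r₁.val.2 σ.tNC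
    have hassign₂ := assign_cost_le nxt (e.time + 1) r₂.val.2
      (assign nxt e.time r₁.val.2 σ.tNC).val
    change r₁.cost + ((assign nxt e.time r₁.val.2 σ.tNC).cost + (r₂.cost +
      ((assign nxt (e.time + 1) r₂.val.2 (assign nxt e.time r₁.val.2 σ.tNC).val).cost + 0))) +
      (unmarkedWeight G r₁.val.1 + unmarkedWeight G r₂.val.1) ≤ _
    omega

end ExploreCost

/-! ### Running time of the algorithm -/

section EntranceCost

variable {p : ℕ} (G : SCG p) (X : List (Fin p × ℤ)) (nxt prv : Table p)

lemma firstTimes_cost_le : (firstTimes X).cost ≤ p + 1 + X.length * 3 := by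
  unfold firstTimes
  simp only [Timed.bind_cost, newArr_cost]
  exact add_le_add_right (forEach_cost_le 2 _ X _ fun _ _ => by simp) _

variable (first anc : Arr (Fin p) (Option ℤ)) (L : List (Entry p)) (C : Fin p)

lemma earliestParentTime_cost_le :
    (earliestParentTime G first C).cost ≤ (G.pa C).length * 2 :=
  forEach_cost_le 1 _ _ _ fun x m => by simp

lemma simultaneousParents_cost_le (s : ℤ) :
    (simultaneousParents G nxt C s).cost ≤ (G.pa C).length * 2 :=
  forEach_cost_le 1 _ _ _ fun x l => by simp

lemma entryStep_cost_le :
    (entryStep G nxt first anc L C).cost ≤ 2 + 4 * (G.pa C).length := by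
  have hmin := earliestParentTime_cost_le G first C
  unfold entryStep
  simp only [Timed.bind_cost, Arr.get_cost, Arr.get_val]
  split
  next tmin a _ _ =>
    have hsimul := simultaneousParents_cost_le G nxt C (free nxt C tmin).val
    simp only [Timed.bind_cost, free_cost]
    split <;> simp only [Timed.bind_cost, Timed.pure_cost] <;> omega
  next =>
    simp only [Timed.pure_cost]
    omega

lemma length_entryStep_le : (entryStep G nxt first anc L C).val.length ≤ L.length + 1 := by
  unfold entryStep
  simp only [Timed.bind_val, Arr.get_val]
  split
  next =>
    simp only [Timed.bind_val]
    split <;> simp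
  next => simp

lemma entries_cost_le : (entries G nxt first anc).cost ≤ 3 * p + 4 * G.numEdges := by
  rw [entries_eq]
  refine (forEach_cost_sum (fun C => 2 + 4 * (G.pa C).length) _ _ _
    fun C L => entryStep_cost_le G nxt first anc L C).trans ?_
  rw [← sum_length_pa G, ← sum_affine, ← List.ofFn_eq_map, List.sum_ofFn]
  exact Finset.sum_le_sum fun C _ => by omega

lemma length_entries_le : (entries G nxt first anc).val.length ≤ p := by
  rw [entries_eq]
  have hlength := forEach_prefix_inv (fun pre (L : List (Entry p)) => L.length ≤ pre.length)
    (entryStep G nxt first anc) (List.finRange p) [] le_rfl fun pre C L _ hL => by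
      simpa using (length_entryStep_le G nxt first anc L C).trans (Nat.add_le_add_right hL 1)
  simpa using hlength

lemma forEach_entranceStep_cost_le (es : List (Entry p)) (σ : EntranceState p) :
    (forEach es σ (entranceStep G nxt)).cost ≤
      es.length * 9 + 2 * (9 * p + 4 * G.numEdges) := by
  have hcost := (forEach_amortized (fun _ _ => True)
    (fun σ : EntranceState p => unmarkedWeight G σ.vis₁ + unmarkedWeight G σ.vis₂) (fun _ => 8)
    (l := es) (s := σ) trivial
    fun _ e σ _ _ => ⟨trivial, entranceStep_cost_le G nxt σ e⟩).2
  have hvis₁ := unmarkedWeight_le G σ.vis₁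
  have hvis₂ := unmarkedWeight_le G σ.vis₂
  simp only [List.map_const', List.sum_replicate, smul_eq_mul] at hcost
  omega

lemma length_sortedEntries_le (Y : Fin p) (t : ℤ) :
    (sortedEntries G X Y t nxt prv).length ≤ p := by
  rw [sortedEntries, (heapSort_spec Entry.before_total Entry.before_trans _).1.length_eq]
  exact length_entries_le G nxt _ _

lemma entranceTimes_cost_le (Y : Fin p) (t : ℤ) :
    (entranceTimes G X Y t nxt prv).cost ≤
      X.length * 3 + (7 * Nat.log 2 (p + 3) + 61) * (p + G.numEdges) + 13 := by
  set anc := (ancestorTimes G prv Y t).val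
  set L := (entries G nxt (firstTimes X).val anc).val
  have hanc := ancestorTimes_cost_le G prv Y t
  have hfirst := firstTimes_cost_le X
  have hentries := entries_cost_le G nxt (firstTimes X).val anc
  have hsort : (heapSort Entry.before L).cost ≤ p * (3 * Nat.log 2 (p + 3) + 6) := by
    have hL : L.length ≤ p := length_entries_le G nxt _ _
    refine (heapSort_cost_le Entry.before L).trans ?_
    gcongr
    omega
  have hloop := forEach_entranceStep_cost_le G nxt (sortedEntries G X Y t nxt prv)
    ⟨Arr.const false, Arr.const false, Arr.const none⟩
  have hsorted := length_sortedEntries_le G X nxt prv Y t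
  have hcost : (entranceTimes G X Y t nxt prv).cost = (ancestorTimes G prv Y t).cost +
      ((firstTimes X).cost + ((entries G nxt (firstTimes X).val anc).cost +
      ((heapSort Entry.before L).cost + ((p + 1) + ((p + 1) + ((p + 1) +
      ((forEach (sortedEntries G X Y t nxt prv)
        (⟨Arr.const false, Arr.const false, Arr.const none⟩ : EntranceState p)
        (entranceStep G nxt)).cost + 0))))))) := rfl
  nlinarith [Nat.zero_le (Nat.log 2 (p + 3) * G.numEdges)]

end EntranceCost

section TotalCost

variable {p : ℕ} (G : SCG p) (X : List (Fin p × ℤ)) (Y : Fin p) (t : ℤ)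

lemma finalMarks_cost_le (tNC : Arr (Fin p) (Option ℤ)) :
    (finalMarks X t tNC).cost ≤ 4 * p + 1 + X.length * 2 := by
  have hentered := forEach_cost_le 2 (markEntered t tNC) (List.finRange p) (newArr p false).val
    fun S M => by unfold markEntered; rw [Timed.bind_cost]; split <;> simp
  have hintervened := forEach_cost_le 1 (markIntervened t) X
    (forEach (List.finRange p) (newArr p false).val (markEntered t tNC)).val
    fun x M => by unfold markIntervened; split <;> simp
  rw [List.length_finRange] at hentered
  simp only [finalMarks, Timed.bind_cost, newArr_cost] at hentered hintervened ⊢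
  omega

lemma directTest_cost_le (tNC : Arr (Fin p) (Option ℤ)) :
    (directTest G X Y t tNC).cost ≤ X.length * 4 + 14 * (p + G.numEdges) + 6 := by
  set reached := descendants G (fun w => (finalMarks X t tNC).val.get w) Y (Arr.const false)
  have hmarks := finalMarks_cost_le X t tNC
  have hreached : reached.cost + 8 * reached.val.2.length + unmarkedWeight G reached.val.1 ≤
      4 + unmarkedWeight G (Arr.const false) := descendants_cost_le G (by simp) Y _
  have hweight := unmarkedWeight_le G (Arr.const false)
  have htest := anyOf_cost_le 1 X (fun x => do
    let b ← reached.val.1.get x.1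
    pure (b && decide (x.2 = t))) (fun x _ => by simp)
  have hcost : (directTest G X Y t tNC).cost = (finalMarks X t tNC).cost + ((p + 1) +
      (reached.cost + (anyOf X fun x => do
        let b ← reached.val.1.get x.1
        pure (b && decide (x.2 = t))).cost)) := rfl
  omega

lemma length_forEach_accessTimes (prv : Table p) (tNC : Arr (Fin p) (Option ℤ)) :
    (forEach X [] fun l x => do
      let a ← accessTimes G prv tNC x
      pure (a :: l)).val.length = X.length :=
  forEach_prefix_inv (fun pre (l : List (Arr (Fin p) (Option ℤ))) => l.length = pre.length)
    (fun l x => do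
      let a ← accessTimes G prv tNC x
      pure (a :: l)) X [] rfl fun pre x l _ hl => by simpa using hl

lemma anyOf_leTimes_cost_le (tNC s₁ s₂ : Arr (Fin p) (Option ℤ)) :
    (anyOf (List.finRange p) fun F => do
      let e ← tNC.get F
      let a ← s₁.get F
      let b ← s₂.get F
      pure (leTimes e a && leTimes e b)).cost ≤ p * 4 :=
  (anyOf_cost_le 3 _ _ fun F _ => by simp).trans_eq (by rw [List.length_finRange])

lemma forkTest_cost_le (prv : Table p) (tNC : Arr (Fin p) (Option ℤ)) :
    (forkTest G X Y t prv tNC).cost ≤ (X.length + 1) *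
      ((4 * Nat.log 2 (p + 3) + 24) * (p + G.numEdges) + 11) := by
  set c := (4 * Nat.log 2 (p + 3) + 18) * (p + G.numEdges) + 2 * p + 9 with hc
  have haccY : (accessTimes G prv tNC (Y, t)).cost ≤ c := accessTimes_cost_le G prv tNC _
  have haccX := forEach_cost_le c (fun l x => do
    let a ← accessTimes G prv tNC x
    pure (a :: l)) X [] fun x l => by simpa using accessTimes_cost_le G prv tNC x
  have htest := anyOf_cost_le (p * 4) _ _ fun a (_ : a ∈ (forEach X [] fun l x => do
    let a ← accessTimes G prv tNC x
    pure (a :: l)).val) => anyOf_leTimes_cost_le tNC a (accessTimes G prv tNC (Y, t)).val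
  rw [length_forEach_accessTimes] at htest
  have hcost : (forkTest G X Y t prv tNC).cost ≤
      c + (X.length * (c + 1) + X.length * (p * 4 + 1)) :=
    add_le_add haccY (add_le_add haccX htest)
  calc (forkTest G X Y t prv tNC).cost
      ≤ (X.length + 1) * (c + (p * 4 + 2)) := hcost.trans (by nlinarith [Nat.zero_le p])
    _ ≤ _ := by
      refine Nat.mul_le_mul_left _ ?_
      nlinarith [Nat.zero_le (Nat.log 2 (p + 3)), Nat.zero_le G.numEdges]

lemma decideIdentifiable_cost_le_add :
    (decideIdentifiable G X Y t).cost ≤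
      2 * (X.length * (3 * Nat.log 2 (X.length + 1) + 9) + 1) +
      (X.length * 3 + (7 * Nat.log 2 (p + 3) + 61) * (p + G.numEdges) + 13) +
      (X.length * 4 + 14 * (p + G.numEdges) + 6) +
      (X.length + 1) * ((4 * Nat.log 2 (p + 3) + 24) * (p + G.numEdges) + 11) := by
  rw [decideIdentifiable_eq]
  simp only [Timed.bind_cost]
  set T := (entranceTimes G X Y t (nextTable X).val (prevTable X).val).val
  have hnxt := nextTable_cost_le X
  have hprv := prevTable_cost_le X
  have hentrance := entranceTimes_cost_le G X (nextTable X).val (prevTable X).val Y t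
  have hdirect := directTest_cost_le G X Y t T
  have hfork := forkTest_cost_le G X Y t (prevTable X).val T
  split
  · simp only [Timed.pure_cost]
    omega
  · simp only [Timed.bind_cost, Timed.pure_cost]
    omega

theorem decideIdentifiable_cost_le_natLog (hX : X ≠ []) :
    (decideIdentifiable G X Y t).cost ≤ 200 * (X.length * (Nat.log 2 (X.length + 1) +
      (Nat.log 2 (p + 3) + 1) * (p + G.numEdges))) := by
  refine (decideIdentifiable_cost_le_add G X Y t).trans ?_
  have hn : 1 ≤ X.length := List.length_pos_iff.2 hX
  have hS : 1 ≤ p + G.numEdges := le_add_right Y.pos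
  generalize X.length = n at *
  generalize p + G.numEdges = S at *
  generalize Nat.log 2 (n + 1) = a
  generalize Nat.log 2 (p + 3) = b
  have hSn : S ≤ n * S := Nat.le_mul_of_pos_left S hn
  have hnS : n ≤ n * S := Nat.le_mul_of_pos_right n hS
  have hbS : b * S ≤ n * (b * S) := Nat.le_mul_of_pos_left _ hn
  nlinarith [Nat.zero_le (n * a)]

end TotalCost

section RealBound

lemma natLog_two_le_two_mul_log {m : ℕ} (hm : m ≠ 0) : (Nat.log 2 m : ℝ) ≤ 2 * Real.log m := by
  have hpow : (2 : ℝ) ^ Nat.log 2 m ≤ m := by exact_mod_cast Nat.pow_log_le_self 2 hm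
  have hlog := Real.log_le_log (by positivity) hpow
  rw [Real.log_pow] at hlog
  nlinarith [Real.log_two_gt_d9, (Nat.log 2 m).cast_nonneg (α := ℝ)]

lemma natLog_two_add_le (k : ℕ) {m : ℕ} (hm : 1 ≤ m) :
    (Nat.log 2 (m + k) : ℝ) ≤ 2 * Real.log (k + 1) + 2 * Real.log m := by
  have hm' : (1 : ℝ) ≤ m := by exact_mod_cast hm
  have hlog : Real.log ((m + k : ℕ) : ℝ) ≤ Real.log ((k + 1) * m) :=
    Real.log_le_log (by positivity) (by push_cast; nlinarith [k.cast_nonneg (α := ℝ)])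
  rw [Real.log_mul (by positivity) (by positivity)] at hlog
  linarith [natLog_two_le_two_mul_log (m := m + k) (by omega)]

lemma half_lt_log {m : ℕ} (hm : 2 ≤ m) : 1 / 2 < Real.log m := by
  have hlog : Real.log 2 ≤ Real.log m := Real.log_le_log (by norm_num) (by exact_mod_cast hm)
  linarith [Real.log_two_gt_d9]

lemma le_one_add_two_mul_mul_log (n : ℕ) : (n : ℝ) ≤ 1 + 2 * (n * Real.log n) := by
  rcases n.lt_or_ge 2 with hn | hn
  · interval_cases n <;> norm_num
  · nlinarith [half_lt_log hn, n.cast_nonneg (α := ℝ)]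

lemma mul_log_add_log_mul_le {n p : ℕ} (hp : 1 ≤ p) {S : ℝ} (hS : 1 ≤ S)
    (hS' : p = 1 → S ≤ 2) :
    n * (2 + 2 * Real.log n + (4 + 2 * Real.log p) * S) ≤
      22 * (1 + n * (Real.log n + S * Real.log p)) := by
  have hn : 0 ≤ n * Real.log n := mul_nonneg n.cast_nonneg (Real.log_natCast_nonneg n)
  rcases hp.eq_or_lt with rfl | hp
  · have hnS : (n : ℝ) * S ≤ n * 2 := mul_le_mul_of_nonneg_left (hS' rfl) n.cast_nonneg
    norm_num
    linarith [le_one_add_two_mul_mul_log n]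
  · have hlog : 1 ≤ 2 * Real.log p := by linarith [half_lt_log hp]
    have hSlog : 1 ≤ 2 * (S * Real.log p) := by nlinarith
    have hterms : 2 + 2 * Real.log n + (4 + 2 * Real.log p) * S ≤
        2 * Real.log n + 14 * (S * Real.log p) := by nlinarith
    nlinarith [mul_le_mul_of_nonneg_left hterms n.cast_nonneg,
      mul_le_mul_of_nonneg_left hSlog n.cast_nonneg, n.cast_nonneg (α := ℝ)]

theorem decideIdentifiable_cost_le {p : ℕ} (G : SCG p) {X : List (Fin p × ℤ)} (Y : Fin p) (t : ℤ)
    (hX : X ≠ []) :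
    ((decideIdentifiable G X Y t).cost : ℝ) ≤
      4400 * (1 + X.length * (Real.log X.length + (G.numEdges + p) * Real.log p)) := by
  have hp : 1 ≤ p := Y.pos
  have hn : 1 ≤ X.length := List.length_pos_iff.2 hX
  have hE : G.numEdges ≤ p * p := (Finset.card_filter_le _ _).trans (by simp)
  have hS : (1 : ℝ) ≤ G.numEdges + p := by exact_mod_cast le_add_left hp
  have hS' : p = 1 → (G.numEdges + p : ℝ) ≤ 2 := by
    rintro rfl
    exact_mod_cast Nat.add_le_add_right hE 1
  have hlogn : (Nat.log 2 (X.length + 1) : ℝ) ≤ 2 + 2 * Real.log X.length := by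
    have h := natLog_two_add_le 1 hn
    norm_num at h
    linarith [Real.log_two_lt_d9]
  have hlogp : (Nat.log 2 (p + 3) : ℝ) + 1 ≤ 4 + 2 * Real.log p := by
    have h := natLog_two_add_le 3 hp
    rw [show ((3 : ℕ) + 1 : ℝ) = 2 ^ 2 by norm_num, Real.log_pow] at h
    push_cast at h
    linarith [Real.log_two_lt_d9]
  calc ((decideIdentifiable G X Y t).cost : ℝ)
      ≤ 200 * (X.length * (Nat.log 2 (X.length + 1) +
          (Nat.log 2 (p + 3) + 1) * (G.numEdges + p))) := by
        rw [add_comm (G.numEdges : ℝ)]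
        exact_mod_cast decideIdentifiable_cost_le_natLog G X Y t hX
    _ ≤ 200 * (X.length * (2 + 2 * Real.log X.length +
          (4 + 2 * Real.log p) * (G.numEdges + p))) := by gcongr
    _ ≤ 200 * (22 * (1 + X.length * (Real.log X.length + (G.numEdges + p) * Real.log p))) :=
        mul_le_mul_of_nonneg_left (mul_log_add_log_mul_le hp hS hS') (by norm_num)
    _ = 4400 * (1 + X.length * (Real.log X.length + (G.numEdges + p) * Real.log p)) := by ring

end RealBound

end CommonAdjustment

theorem mainTheorem3 :
    (∀ (p : ℕ) (G : CommonAdjustment.SCG p) (X : List (Fin p × ℤ)) (Y : Fin p) (t : ℤ),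
      X.Nodup → (Y, t) ∉ X → (∀ x ∈ X, x.2 ≤ t) →
      (∀ x ∈ X, Y ∈ CommonAdjustment.Desc G.Edge x.1) →
      (CommonAdjustment.IsIdentifiable G.Edge {x | x ∈ X} {(Y, t)} ↔
        (CommonAdjustment.decideIdentifiable G X Y t).val = true)) ∧
    ∃ K : ℝ, ∀ (p : ℕ) (G : CommonAdjustment.SCG p) (X : List (Fin p × ℤ)) (Y : Fin p) (t : ℤ),
      X.Nodup → X ≠ [] →
      ((CommonAdjustment.decideIdentifiable G X Y t).cost : ℝ) ≤
        K * (1 + X.length * (Real.log X.length + (G.numEdges + p) * Real.log p)) :=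
  ⟨fun _ G X Y t _ hY hXt hXY => CommonAdjustment.isIdentifiable_iff G X Y t hY hXt hXY,
    4400, fun _ G _ Y t _ hX => CommonAdjustment.decideIdentifiable_cost_le G Y t hX⟩
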